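/- **Setting.** Let $(X,Z,C,Y_1,Y_0)$ be covariates, a binary treatment assignment, a binary principal stratum and two potential outcomes with finite second moments. The observed data are $O=(X,Z,S,Y)$ with $S=ZC$ and $Y=ZY_1+(1-Z)Y_0$. Assume $Z\perp\!\!\!\perp(C,Y_1,Y_0)\mid X$. Fix $c\in\{0,1\}$ with $\mathrm P(C=c)>0$, and write $e_1(X)=\mathrm P(Z=1\mid X)$, $e_0=1-e_1$, $\pi_c(X)=\mathrm P(C=c\mid X)$, $\pi_c=\mathrm E[\pi_c(X)]$, $\mu_{1c}(X)=\mathrm E[Y_1\mid X,C=c]$ and $\mu_0(X)=\mathrm E[Y\mid X,Z=0]$. Let $$\Delta_c^{\mathrm{PI}}=\frac{\mathrm E\{\pi_c(X)[\mu_{1c}(X)-\mu_0(X)]\}}{\pi_c},$$ regarded as a functional of the law of $O$ through $\pi_c(X)=\mathrm P(S=c\mid X,Z=1)$, $\mu_{1c}(X)=\mathrm E[Y\mid X,Z=1,S=c]$ and $\mu_0(X)=\mathrm E[Y\mid X,Z=0]$. For nuisance functions $\eta=(e_1,\pi_c,\mu_{1c},\mu_0)$ put $$\phi_{\pi}(O;\eta)=\tfrac{Z}{e_1(X)}[\mathrm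 I(C=c)-\pi_c(X)]+\pi_c(X),$$ $$\phi_{1}(O;\eta)=\tfrac{Z}{e_1(X)}\mathrm I(C=c)[Y-\mu_{1c}(X)]+\tfrac{Z}{e_1(X)}\mu_{1c}(X)[\mathrm I(C=c)-\pi_c(X)]+\pi_c(X)\mu_{1c}(X),$$ $$\phi_{0}(O;\eta)=\tfrac{1-Z}{e_0(X)}\pi_c(X)[Y-\mu_{0}(X)]+\tfrac{Z}{e_1(X)}\mu_{0}(X)[\mathrm I(C=c)-\pi_c(X)]+\pi_c(X)\mu_{0}(X),$$ where $Z\,\mathrm I(C=c)=Z\,\mathrm I(S=c)$ is observed. **Estimator.** Let $O_1,O_2,\dots$ be i.i.d. copies of $O$. The evaluation observations $1,\dots,n$ are divided into a fixed number of folds. For each fold $k$, estimates $\tilde\eta_k=(\tilde e_1,\tilde\pi_c,\tilde\mu_{1c},\tilde\mu_0)$, with $\tilde e_0=1-\tilde e_1$ and $0\le\tilde\pi_c\le1$, are computed (measurably) from finitely many observations outside fold $k$. This includes cross-fitting, and sample splitting with a separate training sample. Let $$\hat\Delta_{c,\mathrm{IF}}^{\mathrm{PI}}=\frac{\frac1n\sum_{i\le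 n}\phi_1(O_i;\tilde\eta_{k(i)})-\frac1n\sum_{i\le n}\phi_0(O_i;\tilde\eta_{k(i)})}{\frac1n\sum_{i\le n}\phi_\pi(O_i;\tilde\eta_{k(i)})},$$ where $k(i)$ is the fold of $i$. **Assumptions.** Let $\|\cdot\|_2$ be the $L^2$ norm and $\|\cdot\|_\infty$ the essential supremum norm with respect to the law of $X$, the estimates being held fixed. Assume, for every fold: * positivity: for some $\epsilon>0$, $\epsilon\le e_1(X)<1-\epsilon$ almost surely; * bounded contrast: $\mu_{1c}(X)-\mu_0(X)$ is essentially bounded; * consistency: $\|\tilde e_1-e_1\|_2$, $\|\tilde\pi_c-\pi_c\|_2$, $\|\tilde\mu_{1c}-\mu_{1c}\|_2$ and $\|\tilde\mu_0-\mu_0\|_2$ are $o_p(1)$; * bounded propensity score estimation: $\|1/\tilde e_1\|_\infty=O_p(1)$ and $\|1/\tilde e_0\|_\infty=O_p(1)$ (in particular $0<\tilde e_1<1$ almost everywhere with probability tending to one); * rates: $\|\tilde e_1-e_1\|_2\|\tilde\pi_c-\pi_c\|_2$, $\|\tilde e_1-e_1\|_2\|\tilde\mu_{1c}-\mu_{1c}\|_2$,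 $\|\tilde e_1-e_1\|_2\|\tilde\mu_0-\mu_0\|_2$ and $\|\tilde\pi_c-\pi_c\|_2\|\tilde\mu_0-\mu_0\|_2$ are all $o_p(n^{-1/2})$. **Conclusion.** The estimator $\hat\Delta_{c,\mathrm{IF}}^{\mathrm{PI}}$ is root-$n$ consistent and asymptotically normal: $$\hat\Delta_{c,\mathrm{IF}}^{\mathrm{PI}}-\Delta_c^{\mathrm{PI}}=O_p(n^{-1/2}),\qquad \sqrt n\,(\hat\Delta_{c,\mathrm{IF}}^{\mathrm{PI}}-\Delta_c^{\mathrm{PI}})\xrightarrow{d}\mathrm N\big(0,\operatorname{var}\varphi(O)\big).$$ Here $$\varphi(O)=\frac1{\pi_c}\big\{\phi_1(O;\eta)-\phi_0(O;\eta)-\Delta_c^{\mathrm{PI}}\phi_\pi(O;\eta)\big\},$$ evaluated at the true $\eta$, is the nonparametric influence function of $\Delta_c^{\mathrm{PI}}$: it is centered, square integrable, and along each path $d\rho_t=(1+ts)\,d\rho$ through the law $\rho$ of $O$ with bounded centered score $s$, the derivative of $\Delta_c^{\mathrm{PI}}(\rho_t)$ at $t=0$ is $\mathrm E[\varphi(O)s(O)]$.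 Under principal ignorability, $\mathrm E[Y_0\mid X,C=1]=\mathrm E[Y_0\mid X,C=0]$, one has $\Delta_c^{\mathrm{PI}}=\Delta_c:=\mathrm E[Y_1-Y_0\mid C=c]$. -/

import Mathlib

open MeasureTheory ProbabilityTheory Filter Topology
open scoped ENNReal

namespace PrincipalStrat

/-- An observed data point `O = (X, Z, S, Y)`: covariates, treatment assignment, treatment
actually received, outcome (`true` stands for 1 and `false` for 0). -/
abbrev Obs (𝒳 : Type*) : Type _ := 𝒳 × Bool × Bool × ℝ

/-- The observed data of an individual with full data `(X, Z, C, Y₁, Y₀)`, under consistency: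
`S = Z C` and `Y = Z Y₁ + (1 - Z) Y₀`. -/
def observe {Ω 𝒳 : Type*} (X : Ω → 𝒳) (Z C : Ω → Bool) (Y1 Y0 : Ω → ℝ) (ω : Ω) : Obs 𝒳 :=
  (X ω, Z ω, Z ω && C ω, if Z ω then Y1 ω else Y0 ω)

/-- The number 1 if `b` is true and 0 otherwise. -/
def ind (b : Bool) : ℝ := if b then 1 else 0

/-- `f` is a version of the regression function `x ↦ E[W | X = x]` under the law `μ`. -/
def IsRegression {Ω 𝒳 : Type*} [MeasurableSpace Ω] [m𝒳 : MeasurableSpace 𝒳]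
    (μ : Measure Ω) (X : Ω → 𝒳) (W : Ω → ℝ) (f : 𝒳 → ℝ) : Prop :=
  Measurable f ∧ (fun ω => f (X ω)) =ᵐ[μ] condExp (m𝒳.comap X) μ W

/-- A quadruple of (true or estimated) nuisance functions: the propensity score `e₁` (with
`e₀ = 1 - e₁`), the principal score `π_c`, and the outcome means `μ_{1c}` and `μ₀`. -/
structure Nuisance (𝒳 : Type*) where
  e : 𝒳 → ℝ
  pi : 𝒳 → ℝ
  mu1 : 𝒳 → ℝ
  mu0 : 𝒳 → ℝ

/-- `η` consists of (versions of) the true nuisance functions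
`e₁(X) = P(Z = 1 | X)`, `π_c(X) = P(C = c | X)`, `μ_{1c}(X) = E[Y₁ | X, C = c]` and
`μ₀(X) = E[Y | X, Z = 0]`. -/
structure IsTrueNuisance {Ω 𝒳 : Type*} [MeasurableSpace Ω] [MeasurableSpace 𝒳]
    (P : Measure Ω) (c : Bool) (X : Ω → 𝒳) (Z C : Ω → Bool) (Y1 Y0 : Ω → ℝ)
    (η : Nuisance 𝒳) : Prop where
  e_eq : IsRegression P X (fun ω => ind (Z ω)) η.e
  pi_eq : IsRegression P X (fun ω => ind (C ω == c)) η.pi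
  mu1_eq : IsRegression (ProbabilityTheory.cond P {ω | C ω = c}) X Y1 η.mu1
  mu0_eq : IsRegression (ProbabilityTheory.cond P {ω | Z ω = false}) X
    (fun ω => if Z ω then Y1 ω else Y0 ω) η.mu0

/-- Principal ignorability `E[Y₀ | X, C = 1] = E[Y₀ | X, C = 0]`: one and the same function of the
covariates is a version of both regressions (the regression given `C = c` being determined only
where `P(C = c | X) > 0`). -/
def PrincipalIgnorability {Ω 𝒳 : Type*} [MeasurableSpace Ω] [MeasurableSpace 𝒳]
    (P : Measure Ω) (X : Ω → 𝒳) (C : Ω → Bool) (Y0 : Ω → ℝ) : Prop :=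
  ∃ g : 𝒳 → ℝ, IsRegression (ProbabilityTheory.cond P {ω | C ω = true}) X Y0 g ∧
    IsRegression (ProbabilityTheory.cond P {ω | C ω = false}) X Y0 g

/-- The principal causal effect `Δ_c = E[Y₁ - Y₀ | C = c]`. -/
noncomputable def delta {Ω : Type*} [MeasurableSpace Ω] (P : Measure Ω) (c : Bool)
    (C : Ω → Bool) (Y1 Y0 : Ω → ℝ) : ℝ :=
  ∫ ω, (Y1 ω - Y0 ω) ∂(ProbabilityTheory.cond P {ω | C ω = c})

/-- The observed-data functional `Δ_c^PI`, evaluated at a law `ρ` of `O = (X, Z, S, Y)`: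
`E[π_c(X) (μ_{1c}(X) - μ₀(X))] / E[π_c(X)]` with `π_c(X) = P(S = c | X, Z = 1)`,
`μ_{1c}(X) = E[Y | X, Z = 1, S = c]` and `μ₀(X) = E[Y | X, Z = 0]`, all computed under `ρ`. -/
noncomputable def deltaPI {𝒳 : Type*} [m𝒳 : MeasurableSpace 𝒳] (c : Bool)
    (ρ : Measure (Obs 𝒳)) : ℝ :=
  let p : Obs 𝒳 → ℝ := condExp (m𝒳.comap Prod.fst)
    (ProbabilityTheory.cond ρ {o | o.2.1 = true}) (fun o => ind (o.2.2.1 == c))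
  let m1 : Obs 𝒳 → ℝ := condExp (m𝒳.comap Prod.fst)
    (ProbabilityTheory.cond ρ {o | o.2.1 = true ∧ o.2.2.1 = c}) (fun o => o.2.2.2)
  let m0 : Obs 𝒳 → ℝ := condExp (m𝒳.comap Prod.fst)
    (ProbabilityTheory.cond ρ {o | o.2.1 = false}) (fun o => o.2.2.2)
  (∫ o, p o * (m1 o - m0 o) ∂ρ) / (∫ o, p o ∂ρ)

/-- Uncentered influence function of `π_c`. Note `Z I(C = c) = Z I(S = c)`. -/
noncomputable def phiPi {𝒳 : Type*} (c : Bool) (η : Nuisance 𝒳) : Obs 𝒳 → ℝ :=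
  fun (x, z, s, _) => ind z / η.e x * (ind (s == c) - η.pi x) + η.pi x

/-- Uncentered influence function of `ν_{1c} = E[π_c(X) μ_{1c}(X)]`. -/
noncomputable def phiNu1 {𝒳 : Type*} (c : Bool) (η : Nuisance 𝒳) : Obs 𝒳 → ℝ :=
  fun (x, z, s, y) => ind z / η.e x * ind (s == c) * (y - η.mu1 x)
    + ind z / η.e x * η.mu1 x * (ind (s == c) - η.pi x) + η.pi x * η.mu1 x

/-- Uncentered influence function of `ν_{0c}^PI = E[π_c(X) μ₀(X)]`. -/
noncomputable def phiNu0 {𝒳 : Type*} (c : Bool) (η : Nuisance 𝒳) : Obs 𝒳 → ℝ :=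
  fun (x, z, s, y) => (1 - ind z) / (1 - η.e x) * η.pi x * (y - η.mu0 x)
    + ind z / η.e x * η.mu0 x * (ind (s == c) - η.pi x) + η.pi x * η.mu0 x

/-- The influence function of `Δ_c^PI`, given the nuisance functions `η` and the values
`piBar = E[π_c(X)]` and `Δ = Δ_c^PI`. -/
noncomputable def phiDelta {𝒳 : Type*} (c : Bool) (η : Nuisance 𝒳) (piBar Δ : ℝ)
    (o : Obs 𝒳) : ℝ :=
  (phiNu1 c η o - phiNu0 c η o - Δ * phiPi c η o) / piBar

/-- `φ` is the nonparametric influence function of the functional `T` at the law `ρ`: it is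
centered and square integrable, and along every path `dρ_t = (1 + t s) dρ` with a bounded
centered score `s`, the derivative of `t ↦ T(ρ_t)` at 0 is `E_ρ[φ s]`. -/
def IsInfluenceFunction {𝒪 : Type*} [MeasurableSpace 𝒪] (T : Measure 𝒪 → ℝ)
    (ρ : Measure 𝒪) (φ : 𝒪 → ℝ) : Prop :=
  MemLp φ 2 ρ ∧ ∫ o, φ o ∂ρ = 0 ∧
    ∀ s : 𝒪 → ℝ, Measurable s → (∃ B : ℝ, ∀ o, |s o| ≤ B) → ∫ o, s o ∂ρ = 0 →
      HasDerivAt (fun t : ℝ => T (ρ.withDensity fun o => ENNReal.ofReal (1 + t * s o)))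
        (∫ o, φ o * s o ∂ρ) 0

/-- A `K`-fold scheme for cross-fitting. At stage `n` each of the observations `i < n` belongs to
one fold, and the nuisance functions used in fold `k` are computed by the learner from the
observations with indices in `train n k`, none of which lies in fold `k`. With
`train n k = {i < n | fold n i ≠ k}` this is ordinary cross-fitting; with one fold and
`train n k ⊆ {n, n + 1, …}` it is sample splitting. -/
structure CrossFit (𝒳 : Type*) [MeasurableSpace 𝒳] (K : ℕ) where
  fold : ℕ → ℕ → Fin K
  train : ℕ → Fin K → Finset ℕ
  learner : ∀ (n : ℕ) (k : Fin K), (train n k → Obs 𝒳) → Nuisance 𝒳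
  disjoint : ∀ n k i, i < n → fold n i = k → i ∉ train n k
  measurable_e : ∀ n k, Measurable fun p : (train n k → Obs 𝒳) × 𝒳 => (learner n k p.1).e p.2
  measurable_pi : ∀ n k, Measurable fun p : (train n k → Obs 𝒳) × 𝒳 => (learner n k p.1).pi p.2
  measurable_mu1 : ∀ n k, Measurable fun p : (train n k → Obs 𝒳) × 𝒳 => (learner n k p.1).mu1 p.2
  measurable_mu0 : ∀ n k, Measurable fun p : (train n k → Obs 𝒳) × 𝒳 => (learner n k p.1).mu0 p.2

/-- The nuisance estimates used in fold `k` at stage `n`, for the data sequence `o`. -/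
def CrossFit.estimate {𝒳 : Type*} [MeasurableSpace 𝒳] {K : ℕ} (S : CrossFit 𝒳 K)
    (n : ℕ) (k : Fin K) (o : ℕ → Obs 𝒳) : Nuisance 𝒳 :=
  S.learner n k fun j => o j

/-- The cross-fitted sample average of an estimating function that depends on nuisances. -/
noncomputable def CrossFit.average {𝒳 : Type*} [MeasurableSpace 𝒳] {K : ℕ} (S : CrossFit 𝒳 K)
    (φ : Nuisance 𝒳 → Obs 𝒳 → ℝ) (n : ℕ) (o : ℕ → Obs 𝒳) : ℝ :=
  (∑ i ∈ Finset.range n, φ (S.estimate n (S.fold n i) o) (o i)) / n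

/-- The cross-fitted influence-function-based estimator
`(ν̂_{1c} - ν̂_{0c}^PI) / π̂_c` of `Δ_c^PI`. -/
noncomputable def CrossFit.deltaIF {𝒳 : Type*} [MeasurableSpace 𝒳] {K : ℕ} (S : CrossFit 𝒳 K)
    (c : Bool) (n : ℕ) (o : ℕ → Obs 𝒳) : ℝ :=
  (S.average (phiNu1 c) n o - S.average (phiNu0 c) n o) / S.average (phiPi c) n o

/-- The `L²(ν)` distance `‖f̂(X) - f(X)‖₂` of two functions of the covariates. -/
noncomputable def l2err {𝒳 : Type*} [MeasurableSpace 𝒳] (ν : Measure 𝒳) (f g : 𝒳 → ℝ) : ℝ≥0∞ :=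
  eLpNorm (fun x => f x - g x) 2 ν

/-- The essential supremum of `1 / f`, with `1 / f = ∞` where `f ≤ 0`. -/
noncomputable def invSup {𝒳 : Type*} [MeasurableSpace 𝒳] (ν : Measure 𝒳) (f : 𝒳 → ℝ) : ℝ≥0∞ :=
  essSup (fun x => (ENNReal.ofReal (f x))⁻¹) ν

/-- `R_n = o_p(a_n)` for nonnegative random quantities `R_n`. -/
def IsLittleOP {Ω : Type*} [MeasurableSpace Ω] (Q : Measure Ω) (R : ℕ → Ω → ℝ≥0∞)
    (a : ℕ → ℝ) : Prop :=
  ∀ δ : ℝ, 0 < δ → Tendsto (fun n => Q {ω | ENNReal.ofReal (δ * a n) < R n ω}) atTop (𝓝 0)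

/-- `R_n = O_p(a_n)` for nonnegative random quantities `R_n`. -/
def IsBigOP {Ω : Type*} [MeasurableSpace Ω] (Q : Measure Ω) (R : ℕ → Ω → ℝ≥0∞)
    (a : ℕ → ℝ) : Prop :=
  ∀ δ : ℝ, 0 < δ → ∃ M : ℝ, ∀ᶠ n in atTop,
    Q {ω | ENNReal.ofReal (M * a n) < R n ω} ≤ ENNReal.ofReal δ

end PrincipalStrat

namespace PrincipalStrat

/-! ### Regression functions -/

/-! Identification. Under ignorability the law of `(X, C, Y₁, Y₀)` among the treated has density
`e₁(X)` with respect to the population (`map_restrict_treated`). The density depends on `X` alone,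
so regressions given `X` are the same in either arm as in the population. Positivity carries almost
sure statements about covariates from an arm back to the population. The result is `Identified`, a
property of the law of `O` from which the influence function and the asymptotics are derived. Under
principal ignorability the common regression of `Y₀` in the two strata is its population regression,
hence equals `μ₀`.

Second-order structure. The numerator `E[π(μ₁ - μ₀)]` and the denominator `E[π]` are means of
estimating functions made of inverse-weighted residuals plus plug-in terms. Residuals are orthogonal
to functions of `X`, and the weights `Z/e₁ - 1` and `(1 - Z)/e₀ - 1` have mean zero given `X`, so
first-order changes of the nuisances do not move the means. This is used twice. - The law is tilted
by a density within `τ` of 1. Regressions then move by `O(τ)`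
(`IsRegression.abs_sub_le_of_withDensity`), so numerator and denominator at the tilted law are the
tilted means of the fixed estimating functions up to `O(τ²)` (`Identified.exists_expansion`). The
path `1 + t s` and the quotient rule give the influence function. - The nuisances are replaced by
estimates. The bias is then a sum of products of two estimation errors
(`BoundedEstimate.integral_score_sub`), which Cauchy–Schwarz and the rates make `o(n^{-1/2})`.
Boundedness of `μ₁ - μ₀` is what keeps the list of products down to four.

Asymptotics. Given the training data, which are independent of the fold, the sum over a fold of
differences between estimated and true scores has mean `o(√n)` by the bias bound and variance `o(n)`
by mean square continuity, so Chebyshev's inequality makes it `o_p(√n)`. The cross-fitted averages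
are therefore asymptotically linear. The central limit theorem for `φ`, consistency of the
denominator and Slutsky's lemma give normality, and tightness of the limit gives the root-n rate. -/

lemma stronglyMeasurable_comap {Ω 𝒳 : Type*} [m𝒳 : MeasurableSpace 𝒳] {X : Ω → 𝒳} {h : 𝒳 → ℝ}
    (hh : Measurable h) : StronglyMeasurable[m𝒳.comap X] fun ω => h (X ω) :=
  (hh.comp (comap_measurable X)).stronglyMeasurable

section Regression

variable {Ω 𝒳 : Type*} [MeasurableSpace Ω] [m𝒳 : MeasurableSpace 𝒳] {μ : Measure Ω}
  {X : Ω → 𝒳} {W : Ω → ℝ} {f : 𝒳 → ℝ}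

lemma IsRegression.integrable_comp (h : IsRegression μ X W f) :
    Integrable (fun ω => f (X ω)) μ :=
  integrable_condExp.congr h.2.symm

lemma IsRegression.setIntegral_eq [IsFiniteMeasure μ] (hX : Measurable X) (hW : Integrable W μ)
    (h : IsRegression μ X W f) {A : Set 𝒳} (hA : MeasurableSet A) :
    ∫ ω in X ⁻¹' A, f (X ω) ∂μ = ∫ ω in X ⁻¹' A, W ω ∂μ := by
  rw [← setIntegral_condExp hX.comap_le hW ⟨A, hA, rfl⟩]
  exact integral_congr_ae (ae_restrict_of_ae h.2)

lemma isRegression_of_setIntegral_eq [IsFiniteMeasure μ] (hX : Measurable X) (hW : Integrable W μ)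
    (hf : Measurable f) (hfi : Integrable (fun ω => f (X ω)) μ)
    (h : ∀ A : Set 𝒳, MeasurableSet A →
      ∫ ω in X ⁻¹' A, f (X ω) ∂μ = ∫ ω in X ⁻¹' A, W ω ∂μ) :
    IsRegression μ X W f := by
  refine ⟨hf, ae_eq_condExp_of_forall_setIntegral_eq hX.comap_le hW
    (fun s _ _ => hfi.integrableOn) ?_ (stronglyMeasurable_comap hf).aestronglyMeasurable⟩
  rintro _ ⟨A, hA, rfl⟩ -
  exact h A hA

/-- A conditional expectation is measurable for the σ-algebra of `X`, so it factors through `X`. The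
equality is pointwise rather than almost sure, so the conditional expectations inside `deltaPI` can
be rewritten literally. -/
lemma exists_isRegression (μ : Measure Ω) (X : Ω → 𝒳) (W : Ω → ℝ) :
    ∃ f : 𝒳 → ℝ, Measurable f ∧ (fun ω => f (X ω)) = μ[W | m𝒳.comap X] := by
  obtain ⟨f, hf, h⟩ := (stronglyMeasurable_condExp (m := m𝒳.comap X) (μ := μ)
    (f := W)).measurable.exists_eq_measurable_comp
  exact ⟨f, hf, h.symm⟩

lemma IsRegression.mul [IsFiniteMeasure μ] (hW : Integrable W μ)
    (h : IsRegression μ X W f) {w : 𝒳 → ℝ} (hw : Measurable w)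
    (hwW : Integrable (fun ω => w (X ω) * W ω) μ) :
    IsRegression μ X (fun ω => w (X ω) * W ω) (fun x => w x * f x) := by
  refine ⟨hw.mul h.1, ?_⟩
  filter_upwards [h.2, condExp_mul_of_stronglyMeasurable_left (stronglyMeasurable_comap hw)
    hwW hW] with ω h1 h2
  have h3 : (μ[fun ω => w (X ω) * W ω | m𝒳.comap X]) ω = w (X ω) * (μ[W | m𝒳.comap X]) ω := h2
  rw [h3, h1]

lemma IsRegression.integral_eq [IsFiniteMeasure μ] (hX : Measurable X)
    (h : IsRegression μ X W f) : ∫ ω, f (X ω) ∂μ = ∫ ω, W ω ∂μ := by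
  rw [integral_congr_ae h.2, integral_condExp hX.comap_le]

lemma IsRegression.ae_eq {g : 𝒳 → ℝ} (hf : IsRegression μ X W f) (hg : IsRegression μ X W g) :
    (fun ω => f (X ω)) =ᵐ[μ] fun ω => g (X ω) :=
  hf.2.trans hg.2.symm

lemma IsRegression.congr {V : Ω → ℝ} (h : IsRegression μ X W f) (hWV : W =ᵐ[μ] V) :
    IsRegression μ X V f :=
  ⟨h.1, h.2.trans (condExp_congr_ae hWV)⟩

lemma IsRegression.ae_le [IsFiniteMeasure μ] {V : Ω → ℝ} {g : 𝒳 → ℝ} (hW : Integrable W μ)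
    (hV : Integrable V μ) (hf : IsRegression μ X W f) (hg : IsRegression μ X V g)
    (h : W ≤ᵐ[μ] V) : ∀ᵐ ω ∂μ, f (X ω) ≤ g (X ω) := by
  filter_upwards [hf.2, hg.2, condExp_mono (m := m𝒳.comap X) hW hV h] with ω h1 h2 h3
  rw [h1, h2]
  exact h3

/-- The conditional measure is a constant multiple of the restriction, and the constant cancels from
the set-integral identities that characterize a regression. When `S` is null both measures vanish
and both sides only ask that `f` be measurable. -/
lemma isRegression_cond_iff [IsFiniteMeasure μ] (hX : Measurable X) {S : Set Ω}
    (hW : Integrable W (μ.restrict S)) :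
    IsRegression (ProbabilityTheory.cond μ S) X W f ↔ IsRegression (μ.restrict S) X W f := by
  by_cases h0 : μ S = 0
  · simp [IsRegression, ProbabilityTheory.cond, Measure.restrict_eq_zero.2 h0, Filter.EventuallyEq]
  have hc0 : (μ S)⁻¹ ≠ 0 := ENNReal.inv_ne_zero.2 (measure_ne_top μ S)
  have hct : (μ S)⁻¹ ≠ ∞ := ENNReal.inv_ne_top.2 h0
  have hfin : IsFiniteMeasure (ProbabilityTheory.cond μ S) := by
    rw [ProbabilityTheory.cond]
    exact Measure.smul_finite _ hct
  have hWc : Integrable W (ProbabilityTheory.cond μ S) := hW.smul_measure hct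
  have hset : ∀ (g : Ω → ℝ) (A : Set Ω), ∫ ω in A, g ω ∂(ProbabilityTheory.cond μ S)
      = ((μ S)⁻¹).toReal * ∫ ω in A, g ω ∂(μ.restrict S) := fun g A => by
    rw [ProbabilityTheory.cond, Measure.restrict_smul, integral_smul_measure, smul_eq_mul]
  have hc : ((μ S)⁻¹).toReal ≠ 0 := ENNReal.toReal_ne_zero.2 ⟨hc0, hct⟩
  constructor
  · intro h
    have hi := h.integrable_comp
    rw [ProbabilityTheory.cond, integrable_smul_measure hc0 hct] at hi
    refine isRegression_of_setIntegral_eq hX hW h.1 hi fun A hA => ?_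
    have := h.setIntegral_eq hX hWc hA
    rw [hset, hset] at this
    exact mul_left_cancel₀ hc this
  · intro h
    refine isRegression_of_setIntegral_eq hX hWc h.1 (h.integrable_comp.smul_measure hct)
      fun A hA => ?_
    rw [hset, hset, h.setIntegral_eq hX hW hA]

/-- A regression function given a subgroup `T`, multiplied by the conditional probability of `T`. -/
lemma IsRegression.mul_restrict [IsFiniteMeasure μ] (hX : Measurable X) {T : Set Ω}
    (hT : MeasurableSet T) (hW : Integrable W μ) {p q : 𝒳 → ℝ}
    (hp : IsRegression μ X (T.indicator fun _ => 1) p)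
    (hq : IsRegression (μ.restrict T) X W q) :
    IsRegression μ X (T.indicator W) (fun x => q x * p x) := by
  -- Nothing is known about `q` off `T`, so the product with the indicator of `T` must be formed
  -- before integrability in the population can be claimed.
  have hqi : Integrable (fun ω => q (X ω) * T.indicator (fun _ => (1 : ℝ)) ω) μ := by
    have := (integrable_indicator_iff hT).2 hq.integrable_comp
    refine this.congr (Eventually.of_forall fun ω => ?_)
    by_cases h : ω ∈ T <;> simp [h]
  have h1 := hp.mul ((integrable_const (1 : ℝ)).indicator hT) hq.1 hqi
  refine isRegression_of_setIntegral_eq hX (hW.indicator hT) h1.1 h1.integrable_comp fun A hA => ?_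
  rw [h1.setIntegral_eq hX hqi hA, setIntegral_indicator hT]
  have h2 := hq.setIntegral_eq hX hW.restrict hA
  rw [Measure.restrict_restrict (hX hA)] at h2
  rw [← h2, ← setIntegral_indicator hT]
  refine integral_congr_ae (Eventually.of_forall fun ω => ?_)
  by_cases h : ω ∈ T <;> simp [h]

lemma IsRegression.ae_abs_le [IsFiniteMeasure μ] {F : 𝒳 → ℝ} (hW : Integrable W μ)
    (hf : IsRegression μ X W f) (hF : IsRegression μ X (fun ω => |W ω|) F) :
    ∀ᵐ ω ∂μ, |f (X ω)| ≤ F (X ω) := by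
  have hn : IsRegression μ X (fun ω => -W ω) (fun x => -f x) := by
    refine ⟨hf.1.neg, ?_⟩
    filter_upwards [hf.2, condExp_neg (μ := μ) W (m𝒳.comap X)] with ω h1 h2
    have h3 : (μ[fun ω => -W ω | m𝒳.comap X]) ω = -(μ[W | m𝒳.comap X]) ω := h2
    rw [h3, h1]
  filter_upwards [hf.ae_le hW hW.abs hF (Eventually.of_forall fun ω => le_abs_self _),
    hn.ae_le hW.neg hW.abs hF (Eventually.of_forall fun ω => neg_le_abs _)] with ω h1 h2
  exact abs_le'.2 ⟨h1, h2⟩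

lemma IsRegression.sub {V : Ω → ℝ} {g : 𝒳 → ℝ} (hW : Integrable W μ)
    (hV : Integrable V μ) (hf : IsRegression μ X W f) (hg : IsRegression μ X V g) :
    IsRegression μ X (fun ω => W ω - V ω) (fun x => f x - g x) := by
  refine ⟨hf.1.sub hg.1, ?_⟩
  filter_upwards [hf.2, hg.2, condExp_sub hW hV (m𝒳.comap X)] with ω h1 h2 h3
  have h4 : (μ[fun ω => W ω - V ω | m𝒳.comap X]) ω
    = (μ[W | m𝒳.comap X]) ω - (μ[V | m𝒳.comap X]) ω := h3
  rw [h4, h1, h2]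

lemma isRegression_const [IsFiniteMeasure μ] (hX : Measurable X) (a : ℝ) :
    IsRegression μ X (fun _ => a) (fun _ => a) :=
  ⟨measurable_const, by rw [condExp_const hX.comap_le]⟩

lemma integral_withDensity_ofReal {g : Ω → ℝ} (hg : Measurable g) (hg0 : ∀ ω, 0 ≤ g ω)
    (F : Ω → ℝ) : ∫ ω, F ω ∂(μ.withDensity fun ω => ENNReal.ofReal (g ω)) = ∫ ω, g ω * F ω ∂μ := by
  rw [integral_withDensity_eq_integral_toReal_smul hg.ennreal_ofReal
    (Eventually.of_forall fun _ => ENNReal.ofReal_lt_top)]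
  simp [ENNReal.toReal_ofReal (hg0 _)]

lemma integrable_withDensity_ofReal {g : Ω → ℝ} (hg : Measurable g) (hg0 : ∀ ω, 0 ≤ g ω)
    (F : Ω → ℝ) : Integrable F (μ.withDensity fun ω => ENNReal.ofReal (g ω)) ↔
      Integrable (fun ω => g ω * F ω) μ := by
  rw [integrable_withDensity_iff_integrable_smul' hg.ennreal_ofReal
    (Eventually.of_forall fun _ => ENNReal.ofReal_lt_top)]
  simp [ENNReal.toReal_ofReal (hg0 _)]

lemma integrable_mul_of_near_one {g F : Ω → ℝ} (hg : Measurable g) {τ : ℝ}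
    (hgτ : ∀ ω, |g ω - 1| ≤ τ) (hF : Integrable F μ) : Integrable (fun ω => g ω * F ω) μ :=
  hF.bdd_mul hg.aestronglyMeasurable (c := 1 + τ) (Eventually.of_forall fun ω => by
    rw [Real.norm_eq_abs]
    calc |g ω| = |(g ω - 1) + 1| := by ring_nf
      _ ≤ |g ω - 1| + |1| := abs_add_le _ _
      _ ≤ 1 + τ := by rw [abs_one]; linarith [hgτ ω])

lemma isFiniteMeasure_withDensity_near_one [IsFiniteMeasure μ] {g : Ω → ℝ} (hg : Measurable g)
    {τ : ℝ} (hgτ : ∀ ω, |g ω - 1| ≤ τ) :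
    IsFiniteMeasure (μ.withDensity fun ω => ENNReal.ofReal (g ω)) :=
  isFiniteMeasure_withDensity_ofReal (by
    simpa using (integrable_mul_of_near_one hg hgτ (integrable_const (1 : ℝ) : Integrable _ μ)).2)

/-- Regression functions depend in a Lipschitz way on the density of the underlying measure. -/
lemma IsRegression.abs_sub_le_of_withDensity [IsFiniteMeasure μ] (hX : Measurable X)
    (hW : Integrable W μ) {g : Ω → ℝ} (hg : Measurable g) {τ : ℝ} (hτ : τ ≤ 1 / 2)
    (hgτ : ∀ ω, |g ω - 1| ≤ τ) {f' F : 𝒳 → ℝ} (hf : IsRegression μ X W f)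
    (hF : IsRegression μ X (fun ω => |W ω|) F)
    (hf' : IsRegression (μ.withDensity fun ω => ENNReal.ofReal (g ω)) X W f') :
    ∀ᵐ ω ∂μ, |f' (X ω) - f (X ω)| ≤ 4 * τ * F (X ω) := by
  have hg0 : ∀ ω, 0 ≤ g ω := fun ω => by linarith [(abs_le.1 (hgτ ω)).1]
  have hfin := isFiniteMeasure_withDensity_near_one (μ := μ) hg hgτ
  have hgi : Integrable g μ := by
    simpa using integrable_mul_of_near_one hg hgτ (integrable_const (1 : ℝ) : Integrable _ μ)
  have hgW := integrable_mul_of_near_one hg hgτ hW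
  have hf'i := (integrable_withDensity_ofReal hg hg0 _).1 hf'.integrable_comp
  obtain ⟨G, hGm, hG⟩ := exists_isRegression μ X g
  have hG : IsRegression μ X g G := ⟨hGm, hG.eventuallyEq⟩
  -- Bayes' formula: `f' E[g | X] = E[g W | X]`. The left side is computed here, and `h2` identifies
  -- it with the right side.
  have h1 : IsRegression μ X (fun ω => f' (X ω) * g ω) (fun x => f' x * G x) :=
    hG.mul hgi hf'.1 (by simpa [mul_comm] using hf'i)
  have h2 : IsRegression μ X (fun ω => g ω * W ω) (fun x => f' x * G x) := by
    refine isRegression_of_setIntegral_eq hX hgW h1.1 h1.integrable_comp fun A hA => ?_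
    rw [h1.setIntegral_eq hX (by simpa [mul_comm] using hf'i) hA]
    have h3 := hf'.setIntegral_eq hX ((integrable_withDensity_ofReal hg hg0 _).2 hgW) hA
    rw [restrict_withDensity (hX hA), integral_withDensity_ofReal hg hg0,
      integral_withDensity_ofReal hg hg0] at h3
    simpa [mul_comm] using h3
  have h3 := h2.sub hgW hW hf
  have hD : Integrable (fun ω => g ω * W ω - W ω) μ := hgW.sub hW
  obtain ⟨D, hDm, hD'⟩ := exists_isRegression μ X (fun ω => |g ω * W ω - W ω|)
  have hD' : IsRegression μ X (fun ω => |g ω * W ω - W ω|) D := ⟨hDm, hD'.eventuallyEq⟩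
  have h4 := h3.ae_abs_le hD hD'
  have h5 := hD'.ae_le hD.abs (hW.abs.const_mul τ) (hF.mul hW.abs (w := fun _ => τ)
    measurable_const (hW.abs.const_mul τ)) (Eventually.of_forall fun ω => by
      have : g ω * W ω - W ω = (g ω - 1) * W ω := by ring
      simp only [this, abs_mul]
      exact mul_le_mul_of_nonneg_right (hgτ ω) (abs_nonneg _))
  have h6 := hG.ae_le hgi (integrable_const (1 + τ)) (isRegression_const hX _)
    (Eventually.of_forall fun ω => by simp only; linarith [(abs_le.1 (hgτ ω)).2])
  have h7 := (isRegression_const hX (1 - τ)).ae_le (integrable_const _) hgi hG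
    (Eventually.of_forall fun ω => by simp only; linarith [(abs_le.1 (hgτ ω)).1])
  filter_upwards [h4, h5, h6, h7, hf.ae_abs_le hW hF] with ω h4 h5 h6 h7 h8
  -- The first term on the right is a regression of `(g - 1) W`. Both terms are at most `τ F`, and
  -- `G ≥ 1/2`, which gives the constant 4.
  have e1 : G (X ω) * (f' (X ω) - f (X ω))
      = (f' (X ω) * G (X ω) - f (X ω)) + (1 - G (X ω)) * f (X ω) := by ring
  have e2 : |(1 - G (X ω)) * f (X ω)| ≤ τ * F (X ω) := by
    rw [abs_mul]
    exact mul_le_mul (abs_le.2 ⟨by linarith, by linarith⟩) h8 (abs_nonneg _) (by linarith)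
  have e3 : G (X ω) * |f' (X ω) - f (X ω)| ≤ 2 * (τ * F (X ω)) := by
    rw [← abs_of_nonneg (show 0 ≤ G (X ω) by linarith), ← abs_mul, e1]
    exact (abs_add_le _ _).trans (by linarith)
  have e4 := mul_le_mul_of_nonneg_right (show 1 / 2 ≤ G (X ω) by linarith)
    (abs_nonneg (f' (X ω) - f (X ω)))
  linarith

end Regression

lemma measurable_ind : Measurable ind := measurable_of_countable _

lemma ind_nonneg (b : Bool) : 0 ≤ ind b := by cases b <;> simp [ind]

lemma ind_le_one (b : Bool) : ind b ≤ 1 := by cases b <;> simp [ind]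

lemma abs_ind_le_one (b : Bool) : |ind b| ≤ 1 := by
  rw [abs_of_nonneg (ind_nonneg b)]
  exact ind_le_one b

/-! ### Images of measures, and domination of the covariate law by its law in an arm -/

section Transfer

variable {Ω 𝒳 : Type*} [MeasurableSpace Ω] [m𝒳 : MeasurableSpace 𝒳] {μ : Measure Ω}
  {X : Ω → 𝒳} {W : Ω → ℝ} {f : 𝒳 → ℝ}

lemma IsRegression.of_map {Ω' : Type*} [MeasurableSpace Ω'] [IsFiniteMeasure μ] {T : Ω → Ω'}
    {X' : Ω' → 𝒳} {W' : Ω' → ℝ} (hT : Measurable T) (hX' : Measurable X')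
    (hW' : Integrable W' (μ.map T)) (h : IsRegression μ (fun ω => X' (T ω)) (fun ω => W' (T ω)) f) :
    IsRegression (μ.map T) X' W' f := by
  have hfX : Measurable fun ω => f (X' ω) := h.1.comp hX'
  refine isRegression_of_setIntegral_eq hX' hW' h.1
    ((integrable_map_measure hfX.aestronglyMeasurable hT.aemeasurable).2 h.integrable_comp)
    fun A hA => ?_
  rw [setIntegral_map (hX' hA) hfX.aestronglyMeasurable hT.aemeasurable,
    setIntegral_map (hX' hA) hW'.aestronglyMeasurable hT.aemeasurable]
  exact h.setIntegral_eq (hX'.comp hT)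
    ((integrable_map_measure hW'.aestronglyMeasurable hT.aemeasurable).1 hW') hA

/-- Under positivity, the law of the covariates is dominated by a multiple of their law in a
subgroup. -/
lemma map_le_smul_map_restrict [IsFiniteMeasure μ] (hX : Measurable X) {S : Set Ω}
    (hS : MeasurableSet S) {r : 𝒳 → ℝ} (hr : IsRegression μ X (S.indicator fun _ => 1) r) {ε : ℝ}
    (hε : 0 < ε) (hrε : ∀ᵐ ω ∂μ, ε ≤ r (X ω)) :
    μ.map X ≤ ENNReal.ofReal ε⁻¹ • (μ.restrict S).map X := by
  refine Measure.le_iff.2 fun A hA => ?_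
  rw [Measure.smul_apply, Measure.map_apply hX hA, Measure.map_apply hX hA,
    Measure.restrict_apply (hX hA), smul_eq_mul]
  -- The integral of `r(X)` over `X⁻¹ A` is the mass of `X⁻¹ A ∩ S`, and `r ≥ ε`.
  have h1 : ε * μ.real (X ⁻¹' A) ≤ μ.real (X ⁻¹' A ∩ S) := by
    calc ε * μ.real (X ⁻¹' A) = ∫ _ in X ⁻¹' A, ε ∂μ := by simp [mul_comm]
      _ ≤ ∫ ω in X ⁻¹' A, r (X ω) ∂μ := by
        refine integral_mono_ae (integrable_const _) hr.integrable_comp.integrableOn ?_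
        exact ae_restrict_of_ae hrε
      _ = ∫ ω in X ⁻¹' A, S.indicator (fun _ => (1 : ℝ)) ω ∂μ :=
        hr.setIntegral_eq hX ((integrable_const _).indicator hS) hA
      _ = μ.real (X ⁻¹' A ∩ S) := by rw [setIntegral_indicator hS]; simp
  have h2 : μ.real (X ⁻¹' A) ≤ ε⁻¹ * μ.real (X ⁻¹' A ∩ S) := by
    rw [inv_mul_eq_div, le_div_iff₀ hε]
    linarith
  calc μ (X ⁻¹' A) = ENNReal.ofReal (μ.real (X ⁻¹' A)) := by simp [Measure.real]
    _ ≤ ENNReal.ofReal (ε⁻¹ * μ.real (X ⁻¹' A ∩ S)) := ENNReal.ofReal_le_ofReal h2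
    _ = _ := by rw [ENNReal.ofReal_mul (by positivity)]; simp [Measure.real]

/-- A set of covariates that is null in the arm `S` is null in the population, by the domination
above. This is how uniqueness of regressions and error bounds, available only within an arm, become
usable everywhere. -/
lemma ae_of_ae_restrict [IsFiniteMeasure μ] (hX : Measurable X) {S : Set Ω}
    (hS : MeasurableSet S) {r : 𝒳 → ℝ} (hr : IsRegression μ X (S.indicator fun _ => 1) r) {ε : ℝ}
    (hε : 0 < ε) (hrε : ∀ᵐ ω ∂μ, ε ≤ r (X ω)) {p : 𝒳 → Prop} (hp : MeasurableSet {x | p x})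
    (h : ∀ᵐ ω ∂(μ.restrict S), p (X ω)) : ∀ᵐ ω ∂μ, p (X ω) := by
  rw [← ae_map_iff hX.aemeasurable hp] at h ⊢
  exact (Measure.absolutelyContinuous_of_le_smul
    (map_le_smul_map_restrict hX hS hr hε hrε)).ae_le h

lemma memLp_of_memLp_restrict [IsFiniteMeasure μ] (hX : Measurable X) {S : Set Ω}
    (hS : MeasurableSet S) {r : 𝒳 → ℝ} (hr : IsRegression μ X (S.indicator fun _ => 1) r) {ε : ℝ}
    (hε : 0 < ε) (hrε : ∀ᵐ ω ∂μ, ε ≤ r (X ω)) (hf : Measurable f) {q : ℝ≥0∞}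
    (h : MemLp (fun ω => f (X ω)) q (μ.restrict S)) : MemLp (fun ω => f (X ω)) q μ := by
  have h1 : MemLp f q ((μ.restrict S).map X) :=
    (memLp_map_measure_iff hf.aestronglyMeasurable hX.aemeasurable).2 h
  exact (memLp_map_measure_iff hf.aestronglyMeasurable hX.aemeasurable).1
    (h1.of_measure_le_smul ENNReal.ofReal_ne_top (map_le_smul_map_restrict hX hS hr hε hrε))

end Transfer

/-! ### Ignorability: both arms share the population's regressions -/

section Ignorability

variable {Ω 𝒳 : Type*} [MeasurableSpace Ω] [StandardBorelSpace Ω] [m𝒳 : MeasurableSpace 𝒳]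
  {P : Measure Ω} [IsProbabilityMeasure P] {X : Ω → 𝒳} {Z : Ω → Bool} {𝒰 : Type*}
  [MeasurableSpace 𝒰] {U : Ω → 𝒰} {e : 𝒳 → ℝ}

/-- Under ignorability, the law of `(X, U)` among the treated has density `e₁(X)` with respect to
its law in the population. -/
lemma map_restrict_treated (hX : Measurable X) (hZ : Measurable Z) (hU : Measurable U)
    (hign : CondIndepFun (m𝒳.comap X) hX.comap_le Z U P)
    (he : IsRegression P X (fun ω => ind (Z ω)) e) (he0 : ∀ᵐ ω ∂P, 0 ≤ e (X ω)) :
    (P.restrict {ω | Z ω = true}).map (fun ω => (X ω, U ω)) =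
      (P.withDensity fun ω => ENNReal.ofReal (e (X ω))).map (fun ω => (X ω, U ω)) := by
  have hV : Measurable fun ω => (X ω, U ω) := hX.prodMk hU
  have hS : MeasurableSet {ω | Z ω = true} := hZ (measurableSet_singleton true)
  refine Measure.ext_prod fun {A B} hA hB => ?_
  have hUB : MeasurableSet (U ⁻¹' B) := hU hB
  have hpre : (fun ω => (X ω, U ω)) ⁻¹' (A ×ˢ B) = X ⁻¹' A ∩ U ⁻¹' B := by
    ext ω; simp
  rw [Measure.map_apply hV (hA.prod hB), Measure.map_apply hV (hA.prod hB), hpre,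
    Measure.restrict_apply ((hX hA).inter hUB), withDensity_apply _ ((hX hA).inter hUB)]
  have hone : Integrable ((U ⁻¹' B).indicator fun _ => (1 : ℝ)) P :=
    (integrable_const _).indicator hUB
  obtain ⟨u, hu, hu'⟩ := exists_isRegression P X ((U ⁻¹' B).indicator fun _ => (1 : ℝ))
  have hu : IsRegression P X ((U ⁻¹' B).indicator fun _ => (1 : ℝ)) u := ⟨hu, hu'.eventuallyEq⟩
  have h1 : ∫ ω in X ⁻¹' A, e (X ω) * u (X ω) ∂P = P.real (X ⁻¹' A ∩ U ⁻¹' B ∩ {ω | Z ω = true}) := by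
    -- Conditional independence on events: `P(Z = 1, U ∈ B | X) = e₁(X) P(U ∈ B | X)`.
    have hr : IsRegression P X (({ω | Z ω = true} ∩ U ⁻¹' B).indicator fun _ => (1 : ℝ))
        (fun x => e x * u x) := by
      refine ⟨he.1.mul hu.1, ?_⟩
      have h2 := (condIndepFun_iff_condExp_inter_preimage_eq_mul hZ hU).1 hign {true} B
        (measurableSet_singleton true) hB
      have h3 : (fun ω => ind (Z ω)) = (Z ⁻¹' {true}).indicator fun _ => (1 : ℝ) := by
        ext ω; cases h : Z ω <;> simp [ind, h]
      have h4 := he.2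
      rw [h3] at h4
      filter_upwards [h2, h4, hu.2] with ω h2 h4 h5
      rw [h4, h5]
      exact h2.symm
    rw [hr.setIntegral_eq hX ((integrable_const _).indicator (hS.inter hUB)) hA,
      setIntegral_indicator (hS.inter hUB)]
    simp only [integral_const, smul_eq_mul, mul_one, measureReal_restrict_apply_univ]
    congr 1
    ext ω; simp; tauto
  have hei : Integrable (fun ω => e (X ω)) P := he.integrable_comp
  have heu : Integrable (fun ω => e (X ω) * (U ⁻¹' B).indicator (fun _ => (1 : ℝ)) ω) P := by
    refine (hei.indicator hUB).congr (Eventually.of_forall fun ω => ?_)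
    by_cases h : ω ∈ U ⁻¹' B <;> simp [h]
  rw [(hu.mul hone he.1 heu).setIntegral_eq hX heu hA] at h1
  have h6 : ∫ ω in X ⁻¹' A, e (X ω) * (U ⁻¹' B).indicator (fun _ => (1 : ℝ)) ω ∂P
      = ∫ ω in X ⁻¹' A ∩ U ⁻¹' B, e (X ω) ∂P := by
    rw [← setIntegral_indicator hUB]
    refine integral_congr_ae (Eventually.of_forall fun ω => ?_)
    by_cases h : ω ∈ U ⁻¹' B <;> simp [h]
  rw [h6] at h1
  rw [← ofReal_integral_eq_lintegral_ofReal hei.integrableOn (ae_restrict_of_ae he0), h1]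
  simp [Measure.real]

/-- Under ignorability, regressions of functions of `U` given `X` can be computed among the
treated. -/
lemma isRegression_restrict_treated (hX : Measurable X) (hZ : Measurable Z) (hU : Measurable U)
    (hign : CondIndepFun (m𝒳.comap X) hX.comap_le Z U P)
    (he : IsRegression P X (fun ω => ind (Z ω)) e) (he0 : ∀ᵐ ω ∂P, 0 ≤ e (X ω))
    (he1 : ∀ᵐ ω ∂P, e (X ω) ≤ 1) {G : 𝒰 → ℝ} (hG : Measurable G)
    (hGi : Integrable (fun ω => G (U ω)) P) {f : 𝒳 → ℝ}
    (hf : IsRegression P X (fun ω => G (U ω)) f) :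
    IsRegression (P.restrict {ω | Z ω = true}) X (fun ω => G (U ω)) f := by
  have hV : Measurable fun ω => (X ω, U ω) := hX.prodMk hU
  have heX : Measurable fun ω => e (X ω) := he.1.comp hX
  -- `E[Z F(X, U)] = E[e₁(X) F(X, U)]`. With `F = 1_A f` and `F = 1_A G` the claim becomes `E[e₁ 1_A
  -- f] = E[e₁ 1_A G]`, which is the population regression tested against the bounded weight `e₁
  -- 1_A`.
  have key : ∀ F : 𝒳 × 𝒰 → ℝ, Measurable F →
      ∫ ω in {ω | Z ω = true}, F (X ω, U ω) ∂P = ∫ ω, e (X ω) * F (X ω, U ω) ∂P := fun F hF => by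
    have h1 := integral_map (μ := P.restrict {ω | Z ω = true}) hV.aemeasurable
      (f := F) hF.aestronglyMeasurable
    rw [← h1, map_restrict_treated hX hZ hU hign he he0,
      integral_map hV.aemeasurable hF.aestronglyMeasurable,
      integral_withDensity_eq_integral_toReal_smul heX.ennreal_ofReal
        (Eventually.of_forall fun _ => ENNReal.ofReal_lt_top)]
    refine integral_congr_ae ?_
    filter_upwards [he0] with ω h
    simp [ENNReal.toReal_ofReal h]
  refine isRegression_of_setIntegral_eq hX hGi.restrict hf.1 hf.integrable_comp.restrict
    fun A hA => ?_
  have hwm : Measurable fun x => e x * A.indicator (fun _ => (1 : ℝ)) x :=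
    he.1.mul (measurable_const.indicator hA)
  have hwb : ∀ᵐ ω ∂P, ‖e (X ω) * A.indicator (fun _ => (1 : ℝ)) (X ω)‖ ≤ 1 := by
    filter_upwards [he0, he1] with ω h0 h1
    by_cases h : X ω ∈ A <;> simp [h, abs_of_nonneg h0, h1]
  have hwi : Integrable (fun ω => e (X ω) * A.indicator (fun _ => (1 : ℝ)) (X ω) * G (U ω)) P :=
    hGi.bdd_mul (hwm.comp hX).aestronglyMeasurable hwb
  have e1 := key (fun v => (Prod.fst ⁻¹' A).indicator (fun v => f v.1) v)
    ((hf.1.comp measurable_fst).indicator (measurable_fst hA))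
  have e2 := key (fun v => (Prod.fst ⁻¹' A).indicator (fun v => G v.2) v)
    ((hG.comp measurable_snd).indicator (measurable_fst hA))
  rw [← integral_indicator (hX hA), ← integral_indicator (hX hA)]
  have e3 := (hf.mul hGi hwm hwi).integral_eq hX
  refine Eq.trans (Eq.trans ?_ (e1.trans ?_)) (Eq.trans e3 (Eq.trans ?_ (e2.symm.trans ?_)))
  all_goals
    refine integral_congr_ae (Eventually.of_forall fun ω => ?_)
    by_cases h : X ω ∈ A <;> simp [Set.indicator, h]

/-- The untreated arm is the complement of the treated one, so its set integrals are those of the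
population minus those of the treated, and the identity holds for both. -/
lemma isRegression_restrict_control (hX : Measurable X) (hZ : Measurable Z) (hU : Measurable U)
    (hign : CondIndepFun (m𝒳.comap X) hX.comap_le Z U P)
    (he : IsRegression P X (fun ω => ind (Z ω)) e) (he0 : ∀ᵐ ω ∂P, 0 ≤ e (X ω))
    (he1 : ∀ᵐ ω ∂P, e (X ω) ≤ 1) {G : 𝒰 → ℝ} (hG : Measurable G)
    (hGi : Integrable (fun ω => G (U ω)) P) {f : 𝒳 → ℝ}
    (hf : IsRegression P X (fun ω => G (U ω)) f) :
    IsRegression (P.restrict {ω | Z ω = false}) X (fun ω => G (U ω)) f := by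
  have hS : MeasurableSet {ω | Z ω = true} := hZ (measurableSet_singleton true)
  have hc : {ω | Z ω = false} = {ω | Z ω = true}ᶜ := by ext ω; simp
  refine isRegression_of_setIntegral_eq hX hGi.restrict hf.1 hf.integrable_comp.restrict
    fun A hA => ?_
  have h1 := (isRegression_restrict_treated hX hZ hU hign he he0 he1 hG hGi hf).setIntegral_eq hX
    hGi.restrict hA
  have h2 := hf.setIntegral_eq hX hGi hA
  have h3 : ∀ F : Ω → ℝ, Integrable F P →
      ∫ ω in X ⁻¹' A, F ω ∂(P.restrict {ω | Z ω = false})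
        = ∫ ω in X ⁻¹' A, F ω ∂P - ∫ ω in X ⁻¹' A, F ω ∂(P.restrict {ω | Z ω = true}) := by
    intro F hF
    have hF' : Integrable F (P.restrict (X ⁻¹' A)) := hF.restrict
    rw [Measure.restrict_comm (hX hA), Measure.restrict_comm (hX hA) (t := {ω | Z ω = true}), hc,
      ← integral_add_compl hS hF']
    ring
  rw [h3 _ hf.integrable_comp, h3 _ hGi, h1, h2]

end Ignorability

/-- The indicator that the treatment received is `c`. -/
def strat {𝒳 : Type*} (c : Bool) (o : Obs 𝒳) : ℝ := ind (o.2.2.1 == c)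

lemma abs_strat_le_one {𝒳 : Type*} (c : Bool) (o : Obs 𝒳) : |strat c o| ≤ 1 := abs_ind_le_one _

/-- The outcome. -/
def outcome {𝒳 : Type*} (o : Obs 𝒳) : ℝ := o.2.2.2

lemma integrable_ind {Ω : Type*} [MeasurableSpace Ω] {S : Ω → Bool} (hS : Measurable S) {μ : Measure Ω} [IsFiniteMeasure μ] :
    Integrable (fun ω => ind (S ω)) μ :=
  Integrable.of_bound (measurable_ind.comp hS).aestronglyMeasurable 1
    (Eventually.of_forall fun _ => abs_ind_le_one _)

/-! ### The law of the observed data and its nuisance functions -/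

section Observed

variable {𝒳 : Type*} [MeasurableSpace 𝒳]

/-- The observations of treated individuals. -/
def treated (𝒳 : Type*) : Set (Obs 𝒳) := {o | o.2.1 = true}

/-- The observations of untreated individuals. -/
def control (𝒳 : Type*) : Set (Obs 𝒳) := {o | o.2.1 = false}

lemma measurableSet_treated : MeasurableSet (treated 𝒳) :=
  measurable_snd.fst (measurableSet_singleton true)

lemma measurableSet_control : MeasurableSet (control 𝒳) :=
  measurable_snd.fst (measurableSet_singleton false)

lemma measurable_strat (c : Bool) : Measurable (strat (𝒳 := 𝒳) c) :=
  (measurable_of_countable fun s : Bool => ind (s == c)).comp measurable_snd.snd.fst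

lemma measurable_outcome : Measurable (outcome (𝒳 := 𝒳)) := measurable_snd.snd.snd

/-- The nuisance functions `η` are those of the law `ρ` of the observed data, which has
square integrable outcomes and outcome regressions, and satisfies positivity. -/
structure Identified (ρ : Measure (Obs 𝒳)) (c : Bool) (η : Nuisance 𝒳) (ε : ℝ) : Prop where
  eps_pos : 0 < ε
  e_mem : ∀ᵐ o ∂ρ, ε ≤ η.e o.1 ∧ η.e o.1 ≤ 1 - ε
  pi_mem : ∀ᵐ o ∂ρ, 0 ≤ η.pi o.1 ∧ η.pi o.1 ≤ 1
  y_sq : MemLp outcome 2 ρ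
  mu1_meas : Measurable η.mu1
  mu1_sq : MemLp (fun o => η.mu1 o.1) 2 ρ
  mu0_sq : MemLp (fun o => η.mu0 o.1) 2 ρ
  reg_e : IsRegression ρ Prod.fst (fun o => ind o.2.1) η.e
  reg_pi : IsRegression (ρ.restrict (treated 𝒳)) Prod.fst (strat c) η.pi
  reg_mu1 : IsRegression (ρ.restrict (treated 𝒳)) Prod.fst (fun o => strat c o * outcome o)
    (fun x => η.pi x * η.mu1 x)
  reg_mu0 : IsRegression (ρ.restrict (control 𝒳)) Prod.fst outcome η.mu0

end Observed

/-! ### From the full data to the observed data -/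

section FullData

variable {Ω 𝒳 : Type*} [MeasurableSpace Ω] [m𝒳 : MeasurableSpace 𝒳]
  {X : Ω → 𝒳} {Z C : Ω → Bool} {Y1 Y0 : Ω → ℝ}

lemma measurable_observe (hX : Measurable X) (hZ : Measurable Z) (hC : Measurable C)
    (hY1 : Measurable Y1) (hY0 : Measurable Y0) : Measurable (observe X Z C Y1 Y0) :=
  hX.prodMk (hZ.prodMk (((measurable_of_countable fun p : Bool × Bool => p.1 && p.2).comp
    (hZ.prodMk hC)).prodMk (Measurable.ite (hZ (measurableSet_singleton true)) hY1 hY0)))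


variable {P : Measure Ω} {c : Bool} {η : Nuisance 𝒳}

lemma isRegression_control_indicator [IsProbabilityMeasure P] (hX : Measurable X) (hZ : Measurable Z) {e : 𝒳 → ℝ}
    (he : IsRegression P X (fun ω => ind (Z ω)) e) :
    IsRegression P X ({ω | Z ω = false}.indicator fun _ => 1) (fun x => 1 - e x) := by
  convert (isRegression_const hX 1).sub (integrable_const 1) (integrable_ind hZ) he using 1
  ext ω; cases h : Z ω <;> simp [ind, h]

lemma memLp_observed (hZ : Measurable Z)
    (hY1 : Measurable Y1) (hY0 : Measurable Y0) (hY1_sq : MemLp Y1 2 P) (hY0_sq : MemLp Y0 2 P) :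
    MemLp (fun ω => if Z ω then Y1 ω else Y0 ω) 2 P := by
  refine MemLp.of_le (hY1_sq.norm.add hY0_sq.norm)
    (Measurable.ite (hZ (measurableSet_singleton true)) hY1 hY0).aestronglyMeasurable
    (Eventually.of_forall fun ω => ?_)
  have h1 := norm_nonneg (Y1 ω)
  have h0 := norm_nonneg (Y0 ω)
  rw [Pi.add_apply, Real.norm_of_nonneg (add_nonneg h1 h0)]
  split <;> simp

variable [IsProbabilityMeasure P]

/-- The regression of the observed outcome among the untreated has a square integrable version. -/
lemma memLp_mu0 (hX : Measurable X) (hZ : Measurable Z)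
    (hY1 : Measurable Y1) (hY0 : Measurable Y0) (hY1_sq : MemLp Y1 2 P) (hY0_sq : MemLp Y0 2 P)
    (hη : IsTrueNuisance P c X Z C Y1 Y0 η) {ε : ℝ} (hε : 0 < ε)
    (hpos : ∀ᵐ ω ∂P, ε ≤ η.e (X ω) ∧ η.e (X ω) ≤ 1 - ε) :
    MemLp (fun ω => η.mu0 (X ω)) 2 P := by
  have hS : MeasurableSet {ω | Z ω = false} := hZ (measurableSet_singleton false)
  have hY := memLp_observed hZ hY1 hY0 hY1_sq hY0_sq
  have hr := (isRegression_cond_iff hX (hY.integrable (by norm_num)).restrict).1 hη.mu0_eq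
  refine memLp_of_memLp_restrict hX hS (isRegression_control_indicator hX hZ hη.e_eq) hε ?_ hr.1
    (((hY.restrict _).condExp (by norm_num)).ae_eq hr.2.symm)
  filter_upwards [hpos] with ω h using by linarith [h.2]

/-- `π_c(X) μ_{1c}(X)` is the regression of `I(C = c) Y₁`. -/
lemma isRegression_stratum_mul (hX : Measurable X) (hC : Measurable C) (hY1i : Integrable Y1 P)
    (hη : IsTrueNuisance P c X Z C Y1 Y0 η) :
    IsRegression P X (fun ω => ind (C ω == c) * Y1 ω) (fun x => η.pi x * η.mu1 x) := by
  have hind : ∀ F : Ω → ℝ, {ω | C ω = c}.indicator F = fun ω => ind (C ω == c) * F ω := fun F => by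
    ext ω; by_cases h : C ω = c <;> simp [ind, h]
  have h1 : IsRegression P X ({ω | C ω = c}.indicator fun _ => (1 : ℝ)) η.pi := by
    rw [hind]; simpa using hη.pi_eq
  have hT : MeasurableSet {ω | C ω = c} := hC (measurableSet_singleton c)
  have h2 := h1.mul_restrict hX hT hY1i
    ((isRegression_cond_iff hX hY1i.restrict).1 hη.mu1_eq)
  rw [hind] at h2
  simpa [mul_comm] using h2

/-- Ignorability moves the counterfactual regressions to the treated arm, where `S = C` and `Y =
Y₁`, and they are then pushed forward along `observe`. The mean `μ₁` is recorded only through `π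
μ₁`, the regression of `I(S = c) Y`, so that no conditioning on a stratum of small probability
remains. -/
lemma identified_of_trueNuisance [StandardBorelSpace Ω] (hX : Measurable X) (hZ : Measurable Z)
    (hC : Measurable C) (hY1 : Measurable Y1) (hY0 : Measurable Y0) (hY1_sq : MemLp Y1 2 P)
    (hY0_sq : MemLp Y0 2 P)
    (hign : CondIndepFun (MeasurableSpace.comap X inferInstance) hX.comap_le
      Z (fun ω => (C ω, Y1 ω, Y0 ω)) P)
    (hη : IsTrueNuisance P c X Z C Y1 Y0 η) {ε : ℝ} (hε : 0 < ε)
    (hpos : ∀ᵐ ω ∂P, ε ≤ η.e (X ω) ∧ η.e (X ω) ≤ 1 - ε) {B : ℝ}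
    (hbdd : ∀ᵐ ω ∂P, |η.mu1 (X ω) - η.mu0 (X ω)| ≤ B) :
    Identified (P.map (observe X Z C Y1 Y0)) c η ε := by
  have hU : Measurable fun ω => (C ω, Y1 ω, Y0 ω) := hC.prodMk (hY1.prodMk hY0)
  have hO := measurable_observe hX hZ hC hY1 hY0
  have hYm : Measurable fun ω => if Z ω then Y1 ω else Y0 ω :=
    Measurable.ite (hZ (measurableSet_singleton true)) hY1 hY0
  have hY := memLp_observed hZ hY1 hY0 hY1_sq hY0_sq
  have hY1i := hY1_sq.integrable (by norm_num : (1 : ℝ≥0∞) ≤ 2)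
  have hYi := hY.integrable (by norm_num : (1 : ℝ≥0∞) ≤ 2)
  have he0 : ∀ᵐ ω ∂P, 0 ≤ η.e (X ω) := hpos.mono fun ω h => hε.le.trans h.1
  have he1 : ∀ᵐ ω ∂P, η.e (X ω) ≤ 1 := hpos.mono fun ω h => by linarith [h.2]
  have hmu0 := memLp_mu0 hX hZ hY1 hY0 hY1_sq hY0_sq hη hε hpos
  have hmu0r := (isRegression_cond_iff hX hYi.restrict).1 hη.mu0_eq
  have hmu1r := (isRegression_cond_iff hX hY1i.restrict).1 hη.mu1_eq
  have hCm : Measurable fun ω => C ω == c := (measurable_of_countable fun b : Bool => b == c).comp hC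
  have hCi : Integrable (fun ω => ind (C ω == c)) P := integrable_ind hCm
  -- The stratum `C = c` may be arbitrarily rare at some covariates, so square integrability of `Y₁`
  -- alone does not control `μ₁` in the population. The bounded contrast does, through `μ₀`.
  have hmu1 : MemLp (fun ω => η.mu1 (X ω)) 2 P := by
    refine MemLp.of_le (hmu0.norm.add (memLp_const B))
      (hmu1r.1.comp hX).aestronglyMeasurable ?_
    filter_upwards [hbdd] with ω h
    refine le_trans ?_ (le_abs_self _)
    have : η.mu1 (X ω) = η.mu0 (X ω) + (η.mu1 (X ω) - η.mu0 (X ω)) := by ring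
    rw [this]
    exact (norm_add_le _ _).trans (add_le_add le_rfl h)
  have hpiP : IsRegression P X (fun ω => ind (C ω == c)) η.pi := hη.pi_eq
  have hpi1 := isRegression_restrict_treated hX hZ hU hign hη.e_eq he0 he1
    (G := fun u => ind (u.1 == c))
    ((measurable_of_countable fun b : Bool => ind (b == c)).comp measurable_fst) hCi hpiP
  have hprod := isRegression_stratum_mul hX hC hY1i hη
  have hCY : Integrable (fun ω => ind (C ω == c) * Y1 ω) P :=
    hY1i.bdd_mul (c := 1) (measurable_ind.comp hCm).aestronglyMeasurable
      (Eventually.of_forall fun ω => abs_ind_le_one _)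
  have hmu1T := isRegression_restrict_treated hX hZ hU hign hη.e_eq he0 he1
    (G := fun u => ind (u.1 == c) * u.2.1)
    (((measurable_of_countable fun b : Bool => ind (b == c)).comp measurable_fst).mul
      measurable_snd.fst) hCY hprod
  have hpre1 : observe X Z C Y1 Y0 ⁻¹' treated 𝒳 = {ω | Z ω = true} := rfl
  have hpre0 : observe X Z C Y1 Y0 ⁻¹' control 𝒳 = {ω | Z ω = false} := rfl
  have hon : ∀ᵐ ω ∂(P.restrict {ω | Z ω = true}), Z ω = true :=
    ae_restrict_mem (hZ (measurableSet_singleton true))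
  have hYo : MemLp outcome 2 (P.map (observe X Z C Y1 Y0)) :=
    (memLp_map_measure_iff measurable_outcome.aestronglyMeasurable hO.aemeasurable).2 hY
  have hYoi := hYo.integrable (by norm_num : (1 : ℝ≥0∞) ≤ 2)
  have hfin : IsProbabilityMeasure (P.map (observe X Z C Y1 Y0)) :=
    Measure.isProbabilityMeasure_map hO.aemeasurable
  have hstr : Integrable (strat c) (P.map (observe X Z C Y1 Y0)) :=
    Integrable.of_bound (measurable_strat c).aestronglyMeasurable 1
      (Eventually.of_forall fun o => abs_strat_le_one c o)
  have hstrY : Integrable (fun o => strat c o * outcome o) (P.map (observe X Z C Y1 Y0)) :=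
    hYoi.bdd_mul (c := 1) (measurable_strat c).aestronglyMeasurable
      (Eventually.of_forall fun o => abs_strat_le_one c o)
  refine ⟨hε, ?_, ?_, hYo, hmu1r.1, ?_, ?_, ?_, ?_, ?_, ?_⟩
  · rw [ae_map_iff hO.aemeasurable]
    · exact hpos
    · exact (measurableSet_le measurable_const (hη.e_eq.1.comp measurable_fst)).inter
        (measurableSet_le (hη.e_eq.1.comp measurable_fst) measurable_const)
  · rw [ae_map_iff hO.aemeasurable]
    · filter_upwards [(isRegression_const hX 0).ae_le (integrable_const 0) hCi hpiP
        (Eventually.of_forall fun ω => ind_nonneg _),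
        hpiP.ae_le hCi (integrable_const 1) (isRegression_const hX 1)
        (Eventually.of_forall fun ω => ind_le_one _)] with ω h1 h2 using ⟨h1, h2⟩
    · exact (measurableSet_le measurable_const (hη.pi_eq.1.comp measurable_fst)).inter
        (measurableSet_le (hη.pi_eq.1.comp measurable_fst) measurable_const)
  · exact (memLp_map_measure_iff (hmu1r.1.comp measurable_fst).aestronglyMeasurable
      hO.aemeasurable).2 hmu1
  · exact (memLp_map_measure_iff (hmu0r.1.comp measurable_fst).aestronglyMeasurable
      hO.aemeasurable).2 hmu0
  · exact IsRegression.of_map hO measurable_fst (integrable_ind measurable_snd.fst) hη.e_eq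
  · have hi := hstr.restrict (s := treated 𝒳)
    rw [Measure.restrict_map hO measurableSet_treated] at hi ⊢
    refine IsRegression.of_map hO measurable_fst hi (hpi1.congr ?_)
    filter_upwards [hon] with ω h
    simp [observe, strat, h]
  · have hi := hstrY.restrict (s := treated 𝒳)
    rw [Measure.restrict_map hO measurableSet_treated] at hi ⊢
    refine IsRegression.of_map hO measurable_fst hi (hmu1T.congr ?_)
    filter_upwards [hon] with ω h
    simp [observe, strat, outcome, h]
  · have hi := hYoi.restrict (s := control 𝒳)
    rw [Measure.restrict_map hO measurableSet_control] at hi ⊢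
    exact IsRegression.of_map hO measurable_fst hi hmu0r

/-- Under principal ignorability, the ratio of `E[π_c(X) (μ_{1c}(X) - μ₀(X))]` and `E[π_c(X)]` is
the principal causal effect. -/
lemma delta_eq_of_principalIgnorability [StandardBorelSpace Ω] (hX : Measurable X)
    (hZ : Measurable Z) (hC : Measurable C) (hY1 : Measurable Y1) (hY0 : Measurable Y0)
    (hY1_sq : MemLp Y1 2 P) (hY0_sq : MemLp Y0 2 P)
    (hign : CondIndepFun (MeasurableSpace.comap X inferInstance) hX.comap_le
      Z (fun ω => (C ω, Y1 ω, Y0 ω)) P)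
    (hη : IsTrueNuisance P c X Z C Y1 Y0 η) {ε : ℝ} (hε : 0 < ε)
    (hpos : ∀ᵐ ω ∂P, ε ≤ η.e (X ω) ∧ η.e (X ω) ≤ 1 - ε)
    (hPI : PrincipalIgnorability P X C Y0) :
    delta P c C Y1 Y0 =
      (∫ ω, η.pi (X ω) * (η.mu1 (X ω) - η.mu0 (X ω)) ∂P) / ∫ ω, η.pi (X ω) ∂P := by
  have hU : Measurable fun ω => (C ω, Y1 ω, Y0 ω) := hC.prodMk (hY1.prodMk hY0)
  have hY1i := hY1_sq.integrable (by norm_num : (1 : ℝ≥0∞) ≤ 2)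
  have hY0i := hY0_sq.integrable (by norm_num : (1 : ℝ≥0∞) ≤ 2)
  have hYi := (memLp_observed hZ hY1 hY0 hY1_sq hY0_sq).integrable (by norm_num : (1 : ℝ≥0∞) ≤ 2)
  have hT : ∀ b, MeasurableSet {ω | C ω = b} := fun b => hC (measurableSet_singleton b)
  have he0 : ∀ᵐ ω ∂P, 0 ≤ η.e (X ω) := hpos.mono fun ω h => hε.le.trans h.1
  have he1 : ∀ᵐ ω ∂P, η.e (X ω) ≤ 1 := hpos.mono fun ω h => by linarith [h.2]
  obtain ⟨g, hgt, hgf⟩ := hPI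
  have hg : ∀ b, IsRegression (P.restrict {ω | C ω = b}) X Y0 g := by
    intro b
    cases b
    · exact (isRegression_cond_iff hX hY0i.restrict).1 hgf
    · exact (isRegression_cond_iff hX hY0i.restrict).1 hgt
  have hcompl : {ω | C ω = false} = {ω | C ω = true}ᶜ := by ext ω; simp
  have hgi : Integrable (fun ω => g (X ω)) P := by
    rw [← integrableOn_univ, ← Set.union_compl_self {ω | C ω = true}, ← hcompl]
    exact IntegrableOn.union (μ := P) (hg true).integrable_comp (hg false).integrable_comp
  -- Adding the set integrals over the two strata turns the common stratum regression into the
  -- population regression of `Y₀`.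
  have hgP : IsRegression P X Y0 g := by
    refine isRegression_of_setIntegral_eq hX hY0i (hg true).1 hgi fun A hA => ?_
    have h1 := (hg true).setIntegral_eq hX hY0i.restrict hA
    have h2 := (hg false).setIntegral_eq hX hY0i.restrict hA
    rw [Measure.restrict_comm (hX hA), hcompl] at h2
    rw [Measure.restrict_comm (hX hA)] at h1
    rw [← integral_add_compl (hT true) hgi.restrict, ← integral_add_compl (hT true) hY0i.restrict,
      h1, h2]
  have hg0 := isRegression_restrict_control hX hZ hU hign hη.e_eq he0 he1
    (G := fun u => u.2.2) measurable_snd.snd hY0i hgP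
  have hmu0r := (isRegression_cond_iff hX hYi.restrict).1 hη.mu0_eq
  have hmu0r' : IsRegression (P.restrict {ω | Z ω = false}) X Y0 η.mu0 := by
    refine hmu0r.congr ?_
    filter_upwards [ae_restrict_mem (hZ (measurableSet_singleton false))] with ω h
    have h' : Z ω = false := h
    simp [h']
  -- By ignorability `g` is also the regression in the untreated arm, where it is unique; positivity
  -- extends the equality with `μ₀` to the population.
  have hgmu : ∀ᵐ ω ∂P, g (X ω) = η.mu0 (X ω) :=
    ae_of_ae_restrict hX (hZ (measurableSet_singleton false))
      (isRegression_control_indicator hX hZ hη.e_eq) hε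
      (hpos.mono fun ω h => by linarith [h.2]) (measurableSet_eq_fun hgP.1 hmu0r.1)
      (hg0.ae_eq hmu0r')
  have hCi : Integrable (fun ω => ind (C ω == c)) P :=
    integrable_ind ((measurable_of_countable fun b : Bool => b == c).comp hC)
  have hind : ∀ F : Ω → ℝ, {ω | C ω = c}.indicator F = fun ω => F ω * ind (C ω == c) := fun F => by
    ext ω; by_cases h : C ω = c <;> simp [ind, h]
  have hpiP : IsRegression P X (fun ω => ind (C ω == c)) η.pi := hη.pi_eq
  have hgci : Integrable (fun ω => g (X ω) * ind (C ω == c)) P := by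
    rw [← hind]
    exact hgi.indicator (hT c)
  have h0r := hpiP.mul hCi hgP.1 hgci
  have h1r := isRegression_stratum_mul hX hC hY1i hη
  have h0 : ∫ ω, g (X ω) * η.pi (X ω) ∂P = ∫ ω in {ω | C ω = c}, Y0 ω ∂P := by
    rw [h0r.integral_eq hX, ← (hg c).integral_eq hX, ← integral_indicator (hT c), hind]
  have h1 : ∫ ω, η.pi (X ω) * η.mu1 (X ω) ∂P = ∫ ω in {ω | C ω = c}, Y1 ω ∂P := by
    rw [h1r.integral_eq hX, ← integral_indicator (hT c), hind]
    simp_rw [mul_comm]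
  have h2 : ∫ ω, η.pi (X ω) ∂P = P.real {ω | C ω = c} := by
    rw [hpiP.integral_eq hX]
    have := hind fun _ => 1
    simp only [one_mul] at this
    rw [← this, integral_indicator (hT c)]
    simp
  have h3 : ∫ ω, η.pi (X ω) * (η.mu1 (X ω) - η.mu0 (X ω)) ∂P
      = ∫ ω in {ω | C ω = c}, Y1 ω ∂P - ∫ ω in {ω | C ω = c}, Y0 ω ∂P := by
    rw [← h0, ← h1, ← integral_sub h1r.integrable_comp h0r.integrable_comp]
    refine integral_congr_ae ?_
    filter_upwards [hgmu] with ω h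
    rw [h]; ring
  rw [h3, h2, delta, ProbabilityTheory.cond, integral_smul_measure,
    integral_sub hY1i.restrict hY0i.restrict, smul_eq_mul, ENNReal.toReal_inv, div_eq_inv_mul,
    Measure.real]

end FullData

/-! ### Algebra and measurability of the estimating functions -/

section Scores

variable {𝒳 : Type*}

lemma phiPi_apply (c : Bool) (η : Nuisance 𝒳) (o : Obs 𝒳) :
    phiPi c η o = ind o.2.1 / η.e o.1 * (strat c o - η.pi o.1) + η.pi o.1 := rfl

/-- The terms `μ₁ I(S = c)` cancel. What remains is the inverse-weighted estimating function for the
single outcome `I(S = c) Y` with regression `π μ₁`, so it can be treated like `phiPi`. -/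
lemma phiNu1_apply (c : Bool) (η : Nuisance 𝒳) (o : Obs 𝒳) :
    phiNu1 c η o = ind o.2.1 / η.e o.1 * (strat c o * outcome o - η.pi o.1 * η.mu1 o.1)
      + η.pi o.1 * η.mu1 o.1 := by
  change ind o.2.1 / η.e o.1 * strat c o * (outcome o - η.mu1 o.1)
    + ind o.2.1 / η.e o.1 * η.mu1 o.1 * (strat c o - η.pi o.1) + η.pi o.1 * η.mu1 o.1 = _
  ring

lemma phiNu0_apply (c : Bool) (η : Nuisance 𝒳) (o : Obs 𝒳) :
    phiNu0 c η o = (1 - ind o.2.1) / (1 - η.e o.1) * η.pi o.1 * (outcome o - η.mu0 o.1)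
      + ind o.2.1 / η.e o.1 * η.mu0 o.1 * (strat c o - η.pi o.1) + η.pi o.1 * η.mu0 o.1 := rfl

/-- The linear combinations of the estimating functions of `ν_{1c} - ν_{0c}^PI` and `π_c`. -/
noncomputable def score (c : Bool) (a b : ℝ) (η : Nuisance 𝒳) (o : Obs 𝒳) : ℝ :=
  a * (phiNu1 c η o - phiNu0 c η o) + b * phiPi c η o

lemma treated_indicator (F : Obs 𝒳 → ℝ) (o : Obs 𝒳) :
    (treated 𝒳).indicator F o = ind o.2.1 * F o := by
  by_cases h : o.2.1 = true
  · simp [treated, Set.indicator, h, ind]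
  · simp [treated, Set.indicator, h, ind]

lemma control_indicator (F : Obs 𝒳 → ℝ) (o : Obs 𝒳) :
    (control 𝒳).indicator F o = (1 - ind o.2.1) * F o := by
  by_cases h : o.2.1 = true
  · simp [control, Set.indicator, h, ind]
  · simp [control, Set.indicator, h, ind]

lemma phiDelta_eq_score (c : Bool) (η : Nuisance 𝒳) (piBar Δ : ℝ) :
    phiDelta c η piBar Δ = score c piBar⁻¹ (-Δ * piBar⁻¹) η := by
  ext o; simp only [phiDelta, score]; ring

/-- Measurability is joint in the training data `𝒯` and the observation because Fubini's theorem is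
applied to this pair later. A one-point `𝒯` covers fixed nuisances. -/
lemma measurable_score [MeasurableSpace 𝒳] {𝒯 : Type*} [MeasurableSpace 𝒯] (c : Bool) (a b : ℝ)
    {η : 𝒯 → Nuisance 𝒳} (he : Measurable fun p : 𝒯 × 𝒳 => (η p.1).e p.2)
    (hpi : Measurable fun p : 𝒯 × 𝒳 => (η p.1).pi p.2)
    (hmu1 : Measurable fun p : 𝒯 × 𝒳 => (η p.1).mu1 p.2)
    (hmu0 : Measurable fun p : 𝒯 × 𝒳 => (η p.1).mu0 p.2) :
    Measurable fun p : 𝒯 × Obs 𝒳 => score c a b (η p.1) p.2 := by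
  have hx : Measurable fun p : 𝒯 × Obs 𝒳 => (p.1, p.2.1) :=
    measurable_fst.prodMk measurable_snd.fst
  have he' := he.comp hx
  have hpi' := hpi.comp hx
  have hmu1' := hmu1.comp hx
  have hmu0' := hmu0.comp hx
  have hz : Measurable fun p : 𝒯 × Obs 𝒳 => ind p.2.2.1 :=
    measurable_ind.comp measurable_snd.snd.fst
  have hs : Measurable fun p : 𝒯 × Obs 𝒳 => strat c p.2 := (measurable_strat c).comp measurable_snd
  have hy : Measurable fun p : 𝒯 × Obs 𝒳 => outcome p.2 := measurable_outcome.comp measurable_snd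
  simp only [Function.comp_def] at he' hpi' hmu1' hmu0'
  simp only [score, phiNu1_apply, phiNu0_apply, phiPi_apply]
  fun_prop

end Scores

/-! ### Orthogonality of residuals and of centred weights -/

section Expansion

variable {𝒳 : Type*} [MeasurableSpace 𝒳] {ρ : Measure (Obs 𝒳)} [IsProbabilityMeasure ρ]
  {g : Obs 𝒳 → ℝ} {τ : ℝ}

/-- A residual of a regression is orthogonal to every function of the covariates; here the
regression is taken under the tilted law in the arm `S`. The tilt is written as a factor `g`, so
that all terms of the expansion are integrals against `ρ`. -/
lemma integral_residual_eq_zero (hg : Measurable g) (hg0 : ∀ o, 0 ≤ g o) (hgτ : ∀ o, |g o - 1| ≤ τ)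
    {S : Set (Obs 𝒳)} (hS : MeasurableSet S) {W : Obs 𝒳 → ℝ} {f w : 𝒳 → ℝ} (hW : Integrable W ρ)
    (hf : IsRegression ((ρ.restrict S).withDensity fun o => ENNReal.ofReal (g o)) Prod.fst W f)
    (hw : Measurable w) (hwW : Integrable (fun o => w o.1 * W o) ρ) :
    Integrable (fun o => g o * S.indicator (fun o => w o.1 * (W o - f o.1)) o) ρ ∧
      ∫ o, g o * S.indicator (fun o => w o.1 * (W o - f o.1)) o ∂ρ = 0 := by
  have hfin := isFiniteMeasure_withDensity_near_one (μ := ρ.restrict S) hg hgτ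
  have hi : ∀ F : Obs 𝒳 → ℝ, Integrable F ρ →
      Integrable F ((ρ.restrict S).withDensity fun o => ENNReal.ofReal (g o)) := fun F hF =>
    (integrable_withDensity_ofReal hg hg0 F).2 (integrable_mul_of_near_one hg hgτ hF.restrict)
  have h1 := hf.mul (hi _ hW) hw (hi _ hwW)
  have h2 : Integrable (fun o => w o.1 * (W o - f o.1))
      ((ρ.restrict S).withDensity fun o => ENNReal.ofReal (g o)) := by
    simp only [mul_sub]
    exact (hi _ hwW).sub h1.integrable_comp
  have h3 : ∫ o, w o.1 * (W o - f o.1)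
      ∂((ρ.restrict S).withDensity fun o => ENNReal.ofReal (g o)) = 0 := by
    simp only [mul_sub]
    rw [integral_sub (hi _ hwW) h1.integrable_comp, h1.integral_eq measurable_fst, sub_self]
  rw [integral_withDensity_ofReal hg hg0, ← integral_indicator hS] at h3
  have h4 := (integrable_indicator_iff hS).2 ((integrable_withDensity_ofReal hg hg0 _).1 h2)
  have h5 : (fun o => g o * S.indicator (fun o => w o.1 * (W o - f o.1)) o)
      = S.indicator fun o => g o * (w o.1 * (W o - f o.1)) := by
    ext o; by_cases h : o ∈ S <;> simp [h]
  rw [h5]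
  exact ⟨h4, h3⟩

/-- Given the covariates the weight `1_S / r - 1` has mean zero, so the integral vanishes when `g`
is replaced by 1. Only `g - 1`, of size `τ`, contributes, multiplied by `H`, also of size `τ`. -/
lemma abs_integral_weight_sub_one_le (hg : Measurable g) (hgτ : ∀ o, |g o - 1| ≤ τ)
    {S : Set (Obs 𝒳)} (hS : MeasurableSet S) {r H G : 𝒳 → ℝ} {ε : ℝ}
    (hr : IsRegression ρ Prod.fst (S.indicator fun _ => 1) r) (hε : 0 < ε)
    (hrε : ∀ᵐ o ∂ρ, ε ≤ r o.1) (hH : Measurable H) (hG : Integrable (fun o => G o.1) ρ)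
    (hHG : ∀ᵐ o ∂ρ, |H o.1| ≤ τ * G o.1) :
    Integrable (fun o => g o * ((S.indicator (fun _ => 1) o / r o.1 - 1) * H o.1)) ρ ∧
      |∫ o, g o * ((S.indicator (fun _ => 1) o / r o.1 - 1) * H o.1) ∂ρ|
        ≤ (ε⁻¹ + 1) * (∫ o, G o.1 ∂ρ) * τ ^ 2 := by
  have hHi : Integrable (fun o : Obs 𝒳 => H o.1) ρ :=
    (hG.const_mul τ).mono' (hH.comp measurable_fst).aestronglyMeasurable hHG
  have hSm : Measurable (S.indicator fun _ => (1 : ℝ)) := measurable_const.indicator hS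
  have hSb : ∀ o, 0 ≤ S.indicator (fun _ => (1 : ℝ)) o ∧ S.indicator (fun _ => (1 : ℝ)) o ≤ 1 :=
    fun o => by by_cases h : o ∈ S <;> simp [h]
  have hSi : Integrable (S.indicator fun _ => (1 : ℝ)) ρ := (integrable_const _).indicator hS
  have hwb : ∀ᵐ o ∂ρ, ‖S.indicator (fun _ => (1 : ℝ)) o / r o.1 - 1‖ ≤ ε⁻¹ + 1 := by
    filter_upwards [hrε] with o h
    have h1 : 0 < r o.1 := hε.trans_le h
    refine (norm_sub_le _ _).trans (add_le_add ?_ (by simp))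
    rw [Real.norm_of_nonneg (div_nonneg (hSb o).1 h1.le), div_eq_mul_inv]
    calc _ ≤ 1 * ε⁻¹ := mul_le_mul (hSb o).2 (inv_anti₀ hε h) (inv_nonneg.2 h1.le) zero_le_one
      _ = ε⁻¹ := one_mul _
  have hrm : Measurable fun o : Obs 𝒳 => r o.1 := hr.1.comp measurable_fst
  have hwm : Measurable fun o : Obs 𝒳 => S.indicator (fun _ => (1 : ℝ)) o / r o.1 - 1 :=
    (hSm.div hrm).sub_const 1
  have hwH : Integrable (fun o => (S.indicator (fun _ => (1 : ℝ)) o / r o.1 - 1) * H o.1) ρ :=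
    hHi.bdd_mul hwm.aestronglyMeasurable hwb
  have hzero : ∫ o, (S.indicator (fun _ => (1 : ℝ)) o / r o.1 - 1) * H o.1 ∂ρ = 0 := by
    have hHr : Integrable (fun o => H o.1 / r o.1 * S.indicator (fun _ => (1 : ℝ)) o) ρ := by
      refine (hwH.add hHi).congr (Eventually.of_forall fun o => ?_)
      simp only [Pi.add_apply]; ring
    have h1 := (hr.mul hSi (w := fun x => H x / r x) (hH.div hr.1) hHr).integral_eq measurable_fst
    have h2 : ∫ o : Obs 𝒳, H o.1 / r o.1 * r o.1 ∂ρ = ∫ o : Obs 𝒳, H o.1 ∂ρ :=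
      integral_congr_ae (hrε.mono fun o h => div_mul_cancel₀ _ (hε.trans_le h).ne')
    have h3 : ∀ o : Obs 𝒳, (S.indicator (fun _ => (1 : ℝ)) o / r o.1 - 1) * H o.1
        = H o.1 / r o.1 * S.indicator (fun _ => (1 : ℝ)) o - H o.1 := fun o => by ring
    simp_rw [h3]
    rw [integral_sub hHr hHi, ← h1, h2, sub_self]
  have hgi := integrable_mul_of_near_one hg hgτ hwH
  refine ⟨hgi, ?_⟩
  have h4 : ∫ o, g o * ((S.indicator (fun _ => (1 : ℝ)) o / r o.1 - 1) * H o.1) ∂ρ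
      = ∫ o, (g o * ((S.indicator (fun _ => (1 : ℝ)) o / r o.1 - 1) * H o.1)
        - (S.indicator (fun _ => (1 : ℝ)) o / r o.1 - 1) * H o.1) ∂ρ := by
    rw [integral_sub hgi hwH, hzero, sub_zero]
  rw [h4, ← Real.norm_eq_abs]
  calc _ ≤ ∫ o, τ * ((ε⁻¹ + 1) * (τ * G o.1)) ∂ρ := by
        refine norm_integral_le_of_norm_le (((hG.const_mul τ).const_mul _).const_mul τ) ?_
        filter_upwards [hwb, hHG] with o h1 h2
        have h5 : g o * ((S.indicator (fun _ => (1 : ℝ)) o / r o.1 - 1) * H o.1)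
            - (S.indicator (fun _ => (1 : ℝ)) o / r o.1 - 1) * H o.1
            = (g o - 1) * ((S.indicator (fun _ => (1 : ℝ)) o / r o.1 - 1) * H o.1) := by ring
        rw [h5, norm_mul, norm_mul]
        exact mul_le_mul (hgτ o) (mul_le_mul h1 h2 (norm_nonneg _) (by positivity))
          (by positivity) ((abs_nonneg _).trans (hgτ o))
    _ = _ := by rw [integral_const_mul, integral_const_mul, integral_const_mul]; ring

end Expansion

/-! ### Second-order expansion of the functional -/

section InfluenceFunction

variable {𝒳 : Type*} [m𝒳 : MeasurableSpace 𝒳] {ρ : Measure (Obs 𝒳)} {c : Bool} {η : Nuisance 𝒳}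
  {ε : ℝ}

lemma Identified.reg_treated (hI : Identified ρ c η ε) :
    IsRegression ρ Prod.fst ((treated 𝒳).indicator fun _ => 1) η.e := by
  convert hI.reg_e using 1
  ext o; simp [treated_indicator]

lemma Identified.reg_control [IsProbabilityMeasure ρ] (hI : Identified ρ c η ε) :
    IsRegression ρ Prod.fst ((control 𝒳).indicator fun _ => 1) (fun x => 1 - η.e x) := by
  convert (isRegression_const measurable_fst 1).sub (integrable_const 1)
    (integrable_ind measurable_snd.fst) hI.reg_e using 1
  ext o; simp [control_indicator]

lemma Identified.one_sub_e_ge (hI : Identified ρ c η ε) : ∀ᵐ o ∂ρ, ε ≤ 1 - η.e o.1 :=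
  hI.e_mem.mono fun o h => by linarith [h.2]

lemma integrable_strat [IsFiniteMeasure ρ] : Integrable (strat c) ρ :=
  Integrable.of_bound (measurable_strat c).aestronglyMeasurable 1
    (Eventually.of_forall fun o => abs_strat_le_one c o)

lemma integrable_strat_mul {W : Obs 𝒳 → ℝ} (hW : Integrable W ρ) :
    Integrable (fun o => strat c o * W o) ρ :=
  hW.bdd_mul (c := 1) (measurable_strat c).aestronglyMeasurable
    (Eventually.of_forall fun o => abs_strat_le_one c o)

/-- The functional `Δ_c^PI` expressed through regressions in the treatment arms. -/
lemma deltaPI_eq_div [IsFiniteMeasure ρ] (c : Bool) (hY : Integrable outcome ρ) :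
    ∃ p q m0 : 𝒳 → ℝ, IsRegression (ρ.restrict (treated 𝒳)) Prod.fst (strat c) p ∧
      IsRegression (ρ.restrict (treated 𝒳)) Prod.fst (fun o => strat c o * outcome o) q ∧
      IsRegression (ρ.restrict (control 𝒳)) Prod.fst outcome m0 ∧
      deltaPI c ρ = (∫ o, (q o.1 - p o.1 * m0 o.1) ∂ρ) / ∫ o, p o.1 ∂ρ := by
  obtain ⟨p, hp, hp'⟩ := exists_isRegression (ProbabilityTheory.cond ρ (treated 𝒳)) Prod.fst
    (strat c)
  obtain ⟨m1, hm1, hm1'⟩ := exists_isRegression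
    (ProbabilityTheory.cond ρ {o | o.2.1 = true ∧ o.2.2.1 = c}) Prod.fst (outcome (𝒳 := 𝒳))
  obtain ⟨m0, hm0, hm0'⟩ := exists_isRegression (ProbabilityTheory.cond ρ (control 𝒳)) Prod.fst
    (outcome (𝒳 := 𝒳))
  have hpr := (isRegression_cond_iff measurable_fst integrable_strat.restrict).1
    ⟨hp, hp'.eventuallyEq⟩
  have hm0r := (isRegression_cond_iff measurable_fst hY.restrict).1 ⟨hm0, hm0'.eventuallyEq⟩
  have hm1r := (isRegression_cond_iff measurable_fst hY.restrict).1 ⟨hm1, hm1'.eventuallyEq⟩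
  have hT : MeasurableSet {o : Obs 𝒳 | o.2.2.1 = c} :=
    measurable_snd.snd.fst (measurableSet_singleton c)
  have hset : {o : Obs 𝒳 | o.2.1 = true ∧ o.2.2.1 = c}
      = {o : Obs 𝒳 | o.2.2.1 = c} ∩ treated 𝒳 := by ext o; simp [treated, and_comm]
  rw [hset, ← Measure.restrict_restrict hT] at hm1r
  have hind : ∀ F : Obs 𝒳 → ℝ, {o : Obs 𝒳 | o.2.2.1 = c}.indicator F
      = fun o => strat c o * F o := fun F => by
    ext o; by_cases h : o.2.2.1 = c <;> simp [strat, ind, h]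
  have hpr' : IsRegression (ρ.restrict (treated 𝒳)) Prod.fst
      ({o : Obs 𝒳 | o.2.2.1 = c}.indicator fun _ => (1 : ℝ)) p := by
    rw [hind]; simpa using hpr
  -- The product `p m₁` is the regression of `I(S = c) Y` among the treated: multiplying by the
  -- conditional probability of the stratum undoes the conditioning on it.
  have hq := hpr'.mul_restrict measurable_fst hT hY.restrict hm1r
  rw [hind] at hq
  refine ⟨p, _, m0, hpr, hq, hm0r, ?_⟩
  have e1 : condExp (m𝒳.comap Prod.fst) (ProbabilityTheory.cond ρ {o | o.2.1 = true})
    (fun o => ind (o.2.2.1 == c)) = fun o => p o.1 := hp'.symm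
  have e2 : condExp (m𝒳.comap Prod.fst)
    (ProbabilityTheory.cond ρ {o | o.2.1 = true ∧ o.2.2.1 = c}) (fun o => o.2.2.2)
    = fun o => m1 o.1 := hm1'.symm
  have e3 : condExp (m𝒳.comap Prod.fst) (ProbabilityTheory.cond ρ {o | o.2.1 = false})
    (fun o => o.2.2.2) = fun o => m0 o.1 := hm0'.symm
  simp only [deltaPI, e1, e2, e3]
  congr 2
  ext o; ring

lemma inv_bounds {r : ℝ} (hε : 0 < ε) (h : ε ≤ r) : 0 < r⁻¹ ∧ r⁻¹ ≤ ε⁻¹ :=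
  ⟨inv_pos.2 (hε.trans_le h), inv_anti₀ hε h⟩

lemma Identified.score_measurable (hI : Identified ρ c η ε) (a b : ℝ) :
    Measurable (score c a b η) := by
  have h : Measurable fun p : Unit × Obs 𝒳 => score c a b η p.2 := by
    refine measurable_score c a b (η := fun _ : Unit => η) ?_ ?_ ?_ ?_
    · exact hI.reg_e.1.comp measurable_snd
    · exact hI.reg_pi.1.comp measurable_snd
    · exact hI.mu1_meas.comp measurable_snd
    · exact hI.reg_mu0.1.comp measurable_snd
  have h2 : Measurable fun o : Obs 𝒳 => ((), o) := measurable_prodMk_left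
  have h3 := h.comp h2
  exact h3

lemma Identified.memLp_score [IsProbabilityMeasure ρ] (hI : Identified ρ c η ε) (a b : ℝ) :
    MemLp (score c a b η) 2 ρ := by
  have hε := hI.eps_pos
  have hdom : MemLp (fun o : Obs 𝒳 =>
      |a| * ((2 * ε⁻¹ * |outcome o| + (ε⁻¹ + 1) * |η.mu1 o.1|) + (2 * ε⁻¹ + 1) * |η.mu0 o.1|)
        + |b| * (ε⁻¹ + 1)) 2 ρ :=
    ((((hI.y_sq.abs.const_mul _).add (hI.mu1_sq.abs.const_mul _)).add
      (hI.mu0_sq.abs.const_mul _)).const_mul _).add (memLp_const _)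
  refine hdom.of_le (hI.score_measurable a b).aestronglyMeasurable ?_
  filter_upwards [hI.e_mem, hI.pi_mem] with o he hpi
  refine le_trans ?_ (le_abs_self _)
  have hs := abs_strat_le_one c o
  have hz0 := ind_nonneg o.2.1
  have hz1 := ind_le_one o.2.1
  obtain ⟨i1, i2⟩ := inv_bounds hε he.1
  obtain ⟨j1, j2⟩ := inv_bounds (r := 1 - η.e o.1) hε (by linarith [he.2])
  have hw : |ind o.2.1 / η.e o.1| ≤ ε⁻¹ := by
    rw [div_eq_mul_inv, abs_of_nonneg (mul_nonneg hz0 i1.le)]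
    exact (mul_le_mul hz1 i2 i1.le zero_le_one).trans_eq (one_mul _)
  have hw0 : |(1 - ind o.2.1) / (1 - η.e o.1)| ≤ ε⁻¹ := by
    rw [div_eq_mul_inv, abs_of_nonneg (mul_nonneg (by linarith) j1.le)]
    exact (mul_le_mul (by linarith) j2 j1.le zero_le_one).trans_eq (one_mul _)
  have hp : |η.pi o.1| ≤ 1 := abs_le.2 ⟨by linarith [hpi.1], hpi.2⟩
  have hst : |strat c o - η.pi o.1| ≤ 1 := by
    have h0 : 0 ≤ strat c o := ind_nonneg _
    have h1 : strat c o ≤ 1 := ind_le_one _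
    exact abs_le.2 ⟨by linarith [hpi.2], by linarith [hpi.1]⟩
  have t1 : |phiPi c η o| ≤ ε⁻¹ + 1 := by
    rw [phiPi_apply]
    refine (abs_add_le _ _).trans (add_le_add ?_ hp)
    rw [abs_mul]
    exact (mul_le_mul hw hst (abs_nonneg _) (inv_pos.2 hε).le).trans_eq (mul_one _)
  have hpm : |η.pi o.1 * η.mu1 o.1| ≤ |η.mu1 o.1| := by
    rw [abs_mul]; exact mul_le_of_le_one_left (abs_nonneg _) hp
  have hpm0 : |η.pi o.1 * η.mu0 o.1| ≤ |η.mu0 o.1| := by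
    rw [abs_mul]; exact mul_le_of_le_one_left (abs_nonneg _) hp
  have t2 : |phiNu1 c η o| ≤ ε⁻¹ * |outcome o| + (ε⁻¹ + 1) * |η.mu1 o.1| := by
    rw [phiNu1_apply]
    have h1 : |strat c o * outcome o - η.pi o.1 * η.mu1 o.1| ≤ |outcome o| + |η.mu1 o.1| := by
      refine (abs_sub _ _).trans (add_le_add ?_ hpm)
      rw [abs_mul]; exact mul_le_of_le_one_left (abs_nonneg _) hs
    calc _ ≤ ε⁻¹ * (|outcome o| + |η.mu1 o.1|) + |η.mu1 o.1| := by
          refine (abs_add_le _ _).trans (add_le_add ?_ hpm)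
          rw [abs_mul]
          exact mul_le_mul hw h1 (abs_nonneg _) (inv_pos.2 hε).le
      _ = _ := by ring
  have t3 : |phiNu0 c η o| ≤ ε⁻¹ * |outcome o| + (2 * ε⁻¹ + 1) * |η.mu0 o.1| := by
    rw [phiNu0_apply]
    calc _ ≤ ε⁻¹ * 1 * (|outcome o| + |η.mu0 o.1|) + ε⁻¹ * |η.mu0 o.1| * 1 + |η.mu0 o.1| := by
          refine (abs_add_le _ _).trans (add_le_add ((abs_add_le _ _).trans (add_le_add ?_ ?_)) hpm0)
          · rw [abs_mul, abs_mul]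
            have hεi := (inv_pos.2 hε).le
            exact mul_le_mul (mul_le_mul hw0 hp (abs_nonneg _) hεi) (abs_sub _ _) (abs_nonneg _)
              (by positivity)
          · rw [abs_mul, abs_mul]
            have hεi := (inv_pos.2 hε).le
            exact mul_le_mul (mul_le_mul_of_nonneg_right hw (abs_nonneg _)) hst (abs_nonneg _)
              (by positivity)
      _ = _ := by ring
  rw [score, Real.norm_eq_abs]
  refine (abs_add_le _ _).trans (add_le_add ?_ ?_)
  · rw [abs_mul]
    refine mul_le_mul_of_nonneg_left ((abs_sub _ _).trans ?_) (abs_nonneg _)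
    linarith
  · rw [abs_mul]
    exact mul_le_mul_of_nonneg_left t1 (abs_nonneg _)

/-- Expansion of the numerator and the denominator of `Δ_c^PI` along densities `g` near 1: the
estimating functions of the base law have the perturbed functionals as means, up to second
order. -/
lemma Identified.exists_expansion [IsProbabilityMeasure ρ] (hI : Identified ρ c η ε) :
    ∃ K : ℝ, ∀ (g : Obs 𝒳 → ℝ) (τ : ℝ), Measurable g → τ ≤ 1 / 2 → (∀ o, |g o - 1| ≤ τ) →
      ∀ p q m0 : 𝒳 → ℝ,
        IsRegression ((ρ.restrict (treated 𝒳)).withDensity fun o => ENNReal.ofReal (g o))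
          Prod.fst (strat c) p →
        IsRegression ((ρ.restrict (treated 𝒳)).withDensity fun o => ENNReal.ofReal (g o))
          Prod.fst (fun o => strat c o * outcome o) q →
        IsRegression ((ρ.restrict (control 𝒳)).withDensity fun o => ENNReal.ofReal (g o))
          Prod.fst outcome m0 →
        |∫ o, g o * score c 0 1 η o ∂ρ - ∫ o, g o * p o.1 ∂ρ| ≤ K * τ ^ 2 ∧
        |∫ o, g o * score c 1 0 η o ∂ρ - ∫ o, g o * (q o.1 - p o.1 * m0 o.1) ∂ρ| ≤ K * τ ^ 2 := by
  have hε := hI.eps_pos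
  have hYi : Integrable outcome ρ := hI.y_sq.integrable (by norm_num)
  have hsi : Integrable (strat c) ρ := integrable_strat
  have hsY : Integrable (fun o => strat c o * outcome o) ρ := integrable_strat_mul hYi
  obtain ⟨F1, hF1, hF1'⟩ := exists_isRegression (ρ.restrict (treated 𝒳)) Prod.fst
    (fun o => |strat c o * outcome o|)
  have hF1r : IsRegression (ρ.restrict (treated 𝒳)) Prod.fst _ F1 := ⟨hF1, hF1'.eventuallyEq⟩
  obtain ⟨F0, hF0, hF0'⟩ := exists_isRegression (ρ.restrict (control 𝒳)) Prod.fst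
    (fun o => |outcome o|)
  have hF0r : IsRegression (ρ.restrict (control 𝒳)) Prod.fst _ F0 := ⟨hF0, hF0'.eventuallyEq⟩
  obtain ⟨Fs, hFs, hFs'⟩ := exists_isRegression (ρ.restrict (treated 𝒳)) Prod.fst
    (fun o => |strat c o|)
  have hFsr : IsRegression (ρ.restrict (treated 𝒳)) Prod.fst _ Fs := ⟨hFs, hFs'.eventuallyEq⟩
  have he_ge : ∀ᵐ o ∂ρ, ε ≤ η.e o.1 := hI.e_mem.mono fun o h => h.1
  have hF1i : Integrable (fun o : Obs 𝒳 => F1 o.1) ρ := memLp_one_iff_integrable.1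
    (memLp_of_memLp_restrict measurable_fst measurableSet_treated hI.reg_treated hε he_ge hF1
      (memLp_one_iff_integrable.2 hF1r.integrable_comp))
  have hF0i : Integrable (fun o : Obs 𝒳 => F0 o.1) ρ := memLp_one_iff_integrable.1
    (memLp_of_memLp_restrict measurable_fst measurableSet_control hI.reg_control hε
      hI.one_sub_e_ge hF0 (memLp_one_iff_integrable.2 hF0r.integrable_comp))
  have hmu0i : Integrable (fun o : Obs 𝒳 => η.mu0 o.1) ρ := hI.mu0_sq.integrable (by norm_num)
  -- The summands are the bounds of `B1` to `B5` below with `τ²` removed. In the last, `24 = 3/2 · 4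
  -- · 4` comes from `g ≤ 3/2` and two Lipschitz constants 4.
  refine ⟨(ε⁻¹ + 1) * ∫ _ : Obs 𝒳, (4 : ℝ) ∂ρ + (ε⁻¹ + 1) * ∫ o, 4 * F1 o.1 ∂ρ
    + (ε⁻¹ + 1) * ∫ o, 4 * F0 o.1 ∂ρ + (ε⁻¹ + 1) * ∫ o, 4 * |η.mu0 o.1| ∂ρ
    + ∫ o, 24 * F0 o.1 ∂ρ, ?_⟩
  intro g τ hg hτ hgτ p q m0 hp hq hm0
  have hg0 : ∀ o, 0 ≤ g o := fun o => by linarith [(abs_le.1 (hgτ o)).1]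
  have hτ0 : 0 ≤ τ := by
    obtain ⟨o⟩ := ρ.nonempty_of_neZero
    exact (abs_nonneg _).trans (hgτ o)
  have hem := hI.reg_e.1
  have hpm := hI.reg_pi.1
  have hm0m := hI.reg_mu0.1
  -- First-order bounds for the changes of the three regressions, obtained in an arm and extended to
  -- the population.
  have dp : ∀ᵐ o ∂ρ, |p o.1 - η.pi o.1| ≤ τ * 4 := by
    refine ae_of_ae_restrict (p := fun x => |p x - η.pi x| ≤ τ * 4) measurable_fst
      measurableSet_treated hI.reg_treated hε he_ge
      (measurableSet_le (hp.1.sub hpm).abs measurable_const) ?_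
    filter_upwards [hI.reg_pi.abs_sub_le_of_withDensity measurable_fst hsi.restrict hg hτ hgτ
      hFsr hp, hFsr.ae_le hsi.abs.restrict (integrable_const 1)
      (isRegression_const measurable_fst 1)
      (Eventually.of_forall fun o => abs_strat_le_one c o)] with o h1 h2
    nlinarith
  have dq : ∀ᵐ o ∂ρ, |q o.1 - η.pi o.1 * η.mu1 o.1| ≤ τ * (4 * F1 o.1) := by
    refine ae_of_ae_restrict (p := fun x => |q x - η.pi x * η.mu1 x| ≤ τ * (4 * F1 x))
      measurable_fst measurableSet_treated hI.reg_treated hε he_ge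
      (measurableSet_le (hq.1.sub hI.reg_mu1.1).abs ((hF1.const_mul _).const_mul _)) ?_
    filter_upwards [hI.reg_mu1.abs_sub_le_of_withDensity measurable_fst hsY.restrict hg hτ hgτ
      hF1r hq] with o h1
    linarith
  have dm : ∀ᵐ o ∂ρ, |m0 o.1 - η.mu0 o.1| ≤ τ * (4 * F0 o.1) := by
    refine ae_of_ae_restrict (p := fun x => |m0 x - η.mu0 x| ≤ τ * (4 * F0 x))
      measurable_fst measurableSet_control hI.reg_control hε hI.one_sub_e_ge
      (measurableSet_le (hm0.1.sub hm0m).abs ((hF0.const_mul _).const_mul _)) ?_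
    filter_upwards [hI.reg_mu0.abs_sub_le_of_withDensity measurable_fst hYi.restrict hg hτ hgτ
      hF0r hm0] with o h1
    linarith
  have he_inv : ∀ᵐ o ∂ρ, ‖(η.e o.1)⁻¹‖ ≤ ε⁻¹ := by
    filter_upwards [he_ge] with o h
    rw [Real.norm_of_nonneg (inv_bounds hε h).1.le]
    exact (inv_bounds hε h).2
  have hf_inv : ∀ᵐ o ∂ρ, ‖η.pi o.1 * (1 - η.e o.1)⁻¹‖ ≤ ε⁻¹ := by
    filter_upwards [hI.one_sub_e_ge, hI.pi_mem] with o h hpi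
    rw [Real.norm_of_nonneg (mul_nonneg hpi.1 (inv_bounds hε h).1.le)]
    exact (mul_le_mul hpi.2 (inv_bounds hε h).2 (inv_bounds hε h).1.le zero_le_one).trans_eq
      (one_mul _)
  have hem' : Measurable fun o : Obs 𝒳 => (η.e o.1)⁻¹ := (hem.comp measurable_fst).inv
  have hfm' : Measurable fun o : Obs 𝒳 => η.pi o.1 * (1 - η.e o.1)⁻¹ :=
    (hpm.comp measurable_fst).mul ((hem.comp measurable_fst).const_sub 1).inv
  have hmu0s : Integrable (fun o => η.mu0 o.1 * (η.e o.1)⁻¹ * strat c o) ρ := by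
    refine ((integrable_strat_mul (c := c) hmu0i).bdd_mul hem'.aestronglyMeasurable he_inv).congr
      (Eventually.of_forall fun o => ?_)
    simp only; ring
  -- `A1` to `A4` are residuals of the perturbed regressions and integrate to zero, `B1` to `B4` are
  -- centred weights against first-order changes, and `B5` is a product of two changes.
  obtain ⟨A1i, A1⟩ := integral_residual_eq_zero hg hg0 hgτ measurableSet_treated hsi hp
    (w := fun x => (η.e x)⁻¹) hem.inv (hsi.bdd_mul hem'.aestronglyMeasurable he_inv)
  obtain ⟨A2i, A2⟩ := integral_residual_eq_zero hg hg0 hgτ measurableSet_treated hsY hq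
    (w := fun x => (η.e x)⁻¹) hem.inv (hsY.bdd_mul hem'.aestronglyMeasurable he_inv)
  obtain ⟨A3i, A3⟩ := integral_residual_eq_zero hg hg0 hgτ measurableSet_control hYi hm0
    (w := fun x => η.pi x * (1 - η.e x)⁻¹) (hpm.mul (hem.const_sub 1).inv)
    (hYi.bdd_mul hfm'.aestronglyMeasurable hf_inv)
  obtain ⟨A4i, A4⟩ := integral_residual_eq_zero hg hg0 hgτ measurableSet_treated hsi hp
    (w := fun x => η.mu0 x * (η.e x)⁻¹) (hm0m.mul hem.inv) hmu0s
  obtain ⟨B1i, B1⟩ := abs_integral_weight_sub_one_le hg hgτ measurableSet_treated hI.reg_treated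
    hε he_ge (H := fun x => p x - η.pi x) (G := fun _ => 4) (hp.1.sub hpm) (integrable_const _) dp
  obtain ⟨B2i, B2⟩ := abs_integral_weight_sub_one_le hg hgτ measurableSet_treated hI.reg_treated
    hε he_ge (H := fun x => q x - η.pi x * η.mu1 x) (G := fun x => 4 * F1 x)
    (hq.1.sub hI.reg_mu1.1) (hF1i.const_mul 4) dq
  obtain ⟨B3i, B3⟩ := abs_integral_weight_sub_one_le hg hgτ measurableSet_control hI.reg_control
    hε hI.one_sub_e_ge (H := fun x => η.pi x * (m0 x - η.mu0 x)) (G := fun x => 4 * F0 x)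
    (hpm.mul (hm0.1.sub hm0m)) (hF0i.const_mul 4) (by
      filter_upwards [dm, hI.pi_mem] with o h hpi
      rw [abs_mul, abs_of_nonneg hpi.1]
      exact (mul_le_of_le_one_left (abs_nonneg _) hpi.2).trans h)
  obtain ⟨B4i, B4⟩ := abs_integral_weight_sub_one_le hg hgτ measurableSet_treated hI.reg_treated
    hε he_ge (H := fun x => η.mu0 x * (p x - η.pi x)) (G := fun x => 4 * |η.mu0 x|)
    (hm0m.mul (hp.1.sub hpm)) (hmu0i.abs.const_mul 4) (by
      filter_upwards [dp] with o h
      rw [abs_mul]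
      calc _ ≤ |η.mu0 o.1| * (τ * 4) := mul_le_mul_of_nonneg_left h (abs_nonneg _)
        _ = _ := by ring)
  have dB5 : ∀ᵐ o ∂ρ, ‖g o * ((p o.1 - η.pi o.1) * (m0 o.1 - η.mu0 o.1))‖
      ≤ τ ^ 2 * (24 * F0 o.1) := by
    filter_upwards [dp, dm] with o h1 h2
    rw [norm_mul, norm_mul]
    have h3 : ‖g o‖ ≤ 3 / 2 := by
      rw [Real.norm_of_nonneg (hg0 o)]
      linarith [(abs_le.1 (hgτ o)).2]
    calc _ ≤ 3 / 2 * (τ * 4 * (τ * (4 * F0 o.1))) :=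
          mul_le_mul h3 (mul_le_mul h1 h2 (abs_nonneg _) (by positivity)) (by positivity)
            (by norm_num)
      _ = _ := by ring
  have B5i : Integrable (fun o => g o * ((p o.1 - η.pi o.1) * (m0 o.1 - η.mu0 o.1))) ρ :=
    ((hF0i.const_mul 24).const_mul (τ ^ 2)).mono'
      (hg.mul (((hp.1.sub hpm).comp measurable_fst).mul
        ((hm0.1.sub hm0m).comp measurable_fst))).aestronglyMeasurable dB5
  have B5 : |∫ o, g o * ((p o.1 - η.pi o.1) * (m0 o.1 - η.mu0 o.1)) ∂ρ|
      ≤ (∫ o, 24 * F0 o.1 ∂ρ) * τ ^ 2 := by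
    have := norm_integral_le_of_norm_le ((hF0i.const_mul 24).const_mul (τ ^ 2)) dB5
    rwa [integral_const_mul, mul_comm] at this
  have sc : ∀ a b, Integrable (fun o => g o * score c a b η o) ρ := fun a b =>
    integrable_mul_of_near_one hg hgτ ((hI.memLp_score a b).integrable (by norm_num))
  have key : ∀ F G R : Obs 𝒳 → ℝ, Integrable F ρ → Integrable R ρ → (∀ o, F o - G o = R o) →
      ∫ o, F o ∂ρ - ∫ o, G o ∂ρ = ∫ o, R o ∂ρ := fun F G R hF hR h => by
    have hG : G = fun o => F o - R o := by ext o; rw [← h o]; ring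
    rw [hG, integral_sub hF hR]
    ring
  simp only [treated_indicator, control_indicator, mul_one] at *
  have hτ2 := sq_nonneg τ
  have nB1 := (abs_nonneg _).trans B1
  have nB2 := (abs_nonneg _).trans B2
  have nB3 := (abs_nonneg _).trans B3
  have nB4 := (abs_nonneg _).trans B4
  have nB5 := (abs_nonneg _).trans B5
  constructor
  -- The identity is `Z/e (S - π) + π - p = Z/e (S - p) + (Z/e - 1)(p - π)`, with `S` standing for
  -- `strat c`.
  · rw [key _ _ _ (sc 0 1) (A1i.add B1i) (fun o => by
      simp only [score, phiPi_apply, Pi.add_apply, div_eq_mul_inv]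
      ring)]
    rw [integral_add' A1i B1i, A1, zero_add]
    linarith
  -- The part for `ν₁` splits as the denominator did. In the part for `ν₀`, what the residuals and
  -- centred weights leave over is `π m₀ + p μ₀ - π μ₀ - p m₀ = -(p - π)(m₀ - μ₀)`, which is `-B5`
  -- up to the factor `g`.
  · rw [key _ _ _ (sc 1 0) ((A2i.add B2i).sub ((A3i.add A4i).add ((B3i.add B4i).sub B5i)))
      (fun o => by
        simp only [score, phiNu1_apply, phiNu0_apply, Pi.add_apply, Pi.sub_apply, div_eq_mul_inv]
        ring)]
    rw [integral_sub' (A2i.add B2i) ((A3i.add A4i).add ((B3i.add B4i).sub B5i)),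
      integral_add' A2i B2i, integral_add' (A3i.add A4i) ((B3i.add B4i).sub B5i),
      integral_add' A3i A4i, integral_sub' (B3i.add B4i) B5i, integral_add' B3i B4i, A2, A3, A4]
    have b2 := abs_le.1 B2
    have b3 := abs_le.1 B3
    have b4 := abs_le.1 B4
    have b5 := abs_le.1 B5
    rw [abs_le]
    constructor <;> linarith

end InfluenceFunction

/-! ### Path derivatives and the influence function -/

lemma hasDerivAt_of_abs_sub_le_sq {N : ℝ → ℝ} {a b K δ : ℝ} (hδ : 0 < δ)
    (h : ∀ t, |t| ≤ δ → |N t - (a + t * b)| ≤ K * t ^ 2) : N 0 = a ∧ HasDerivAt N b 0 := by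
  have h0 : N 0 = a := by
    have := h 0 (by simpa using hδ.le)
    simp only [zero_mul, add_zero, ne_eq, OfNat.ofNat_ne_zero, not_false_eq_true, zero_pow,
      mul_zero] at this
    linarith [abs_nonpos_iff.1 this]
  refine ⟨h0, ?_⟩
  rw [hasDerivAt_iff_isLittleO, Asymptotics.isLittleO_iff]
  intro r hr
  have hK : 0 < |K| + 1 := by positivity
  have hpos : 0 < min δ (r / (|K| + 1)) := lt_min hδ (div_pos hr hK)
  filter_upwards [Metric.closedBall_mem_nhds (0 : ℝ) hpos] with t ht
  rw [Metric.mem_closedBall, Real.dist_eq, sub_zero] at ht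
  have h1 := h t (ht.trans (min_le_left _ _))
  have h2 : |t| * (|K| + 1) ≤ r := (le_div_iff₀ hK).1 (ht.trans (min_le_right _ _))
  rw [h0, sub_zero, smul_eq_mul, Real.norm_eq_abs, Real.norm_eq_abs]
  calc |N t - a - t * b| = |N t - (a + t * b)| := by ring_nf
    _ ≤ K * t ^ 2 := h1
    _ ≤ (|K| + 1) * t ^ 2 := mul_le_mul_of_nonneg_right (by linarith [le_abs_self K]) (sq_nonneg t)
    _ = |t| * (|K| + 1) * |t| := by rw [← sq_abs]; ring
    _ ≤ r * |t| := mul_le_mul_of_nonneg_right h2 (abs_nonneg t)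

lemma integral_score_linear {𝒳 : Type*} [MeasurableSpace 𝒳] {ρ : Measure (Obs 𝒳)} {c : Bool}
    {η : Nuisance 𝒳} (a b : ℝ) {s : Obs 𝒳 → ℝ}
    (h1 : Integrable (fun o => score c 1 0 η o * s o) ρ)
    (h2 : Integrable (fun o => score c 0 1 η o * s o) ρ) :
    ∫ o, score c a b η o * s o ∂ρ
      = a * ∫ o, score c 1 0 η o * s o ∂ρ + b * ∫ o, score c 0 1 η o * s o ∂ρ := by
  rw [← integral_const_mul, ← integral_const_mul, ← integral_add (h1.const_mul a) (h2.const_mul b)]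
  refine integral_congr_ae (Eventually.of_forall fun o => ?_)
  simp only [score]; ring

section InfluenceFunction

variable {𝒳 : Type*} [MeasurableSpace 𝒳] {ρ : Measure (Obs 𝒳)} {c : Bool} {η : Nuisance 𝒳}
  {ε : ℝ} [IsProbabilityMeasure ρ]

/-- The means of the estimating functions at the true nuisance functions. -/
lemma Identified.integral_score (hI : Identified ρ c η ε) :
    ∫ o, score c 0 1 η o ∂ρ = ∫ o, η.pi o.1 ∂ρ ∧
      ∫ o, score c 1 0 η o ∂ρ = ∫ o, (η.pi o.1 * η.mu1 o.1 - η.pi o.1 * η.mu0 o.1) ∂ρ := by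
  obtain ⟨K, hK⟩ := hI.exists_expansion
  -- With no perturbation, `g = 1` and `τ = 0`, the error `K τ²` vanishes and the expansion is an
  -- equality.
  obtain ⟨h1, h2⟩ := hK (fun _ => 1) 0 measurable_const (by norm_num) (by simp) η.pi
    (fun x => η.pi x * η.mu1 x) η.mu0 (by simpa using hI.reg_pi) (by simpa using hI.reg_mu1)
    (by simpa using hI.reg_mu0)
  simp only [one_mul, ne_eq, OfNat.ofNat_ne_zero, not_false_eq_true, zero_pow, mul_zero] at h1 h2
  exact ⟨sub_eq_zero.1 (abs_nonpos_iff.1 h1), sub_eq_zero.1 (abs_nonpos_iff.1 h2)⟩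

/-- The identified functional at a law with nuisance functions `η`. -/
lemma Identified.deltaPI_eq (hI : Identified ρ c η ε) :
    deltaPI c ρ = (∫ o, score c 1 0 η o ∂ρ) / ∫ o, score c 0 1 η o ∂ρ := by
  obtain ⟨K, hK⟩ := hI.exists_expansion
  obtain ⟨p, q, m0, hp, hq, hm0, h⟩ := deltaPI_eq_div c (hI.y_sq.integrable (by norm_num))
  obtain ⟨h1, h2⟩ := hK (fun _ => 1) 0 measurable_const (by norm_num) (by simp) p q m0
    (by simpa using hp) (by simpa using hq) (by simpa using hm0)
  simp only [one_mul, ne_eq, OfNat.ofNat_ne_zero, not_false_eq_true, zero_pow, mul_zero] at h1 h2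
  rw [h, sub_eq_zero.1 (abs_nonpos_iff.1 h1), sub_eq_zero.1 (abs_nonpos_iff.1 h2)]

/-- The path derivatives of the identified functional. -/
lemma Identified.hasDerivAt_deltaPI (hI : Identified ρ c η ε)
    (hpi : ∫ o, score c 0 1 η o ∂ρ ≠ 0) {s : Obs 𝒳 → ℝ} (hs : Measurable s) {B : ℝ}
    (hB : ∀ o, |s o| ≤ B) :
    HasDerivAt (fun t : ℝ => deltaPI c (ρ.withDensity fun o => ENNReal.ofReal (1 + t * s o)))
      (((∫ o, score c 1 0 η o * s o ∂ρ) * (∫ o, score c 0 1 η o ∂ρ)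
        - (∫ o, score c 1 0 η o ∂ρ) * ∫ o, score c 0 1 η o * s o ∂ρ)
        / (∫ o, score c 0 1 η o ∂ρ) ^ 2) 0 := by
  obtain ⟨K, hK⟩ := hI.exists_expansion
  have hB0 : 0 ≤ B := by
    obtain ⟨o⟩ := ρ.nonempty_of_neZero
    exact (abs_nonneg _).trans (hB o)
  -- Within this radius `|t| B ≤ 1/2`, as the expansion requires; `B + 1` covers the case `B = 0`.
  have hδ : 0 < (2 * (B + 1))⁻¹ := by positivity
  have hYi : Integrable outcome ρ := hI.y_sq.integrable (by norm_num)
  have hsc : ∀ a b, Integrable (score c a b η) ρ := fun a b =>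
    (hI.memLp_score a b).integrable (by norm_num)
  have hscs : ∀ a b, Integrable (fun o => score c a b η o * s o) ρ := fun a b =>
    (hsc a b).mul_bdd hs.aestronglyMeasurable (Eventually.of_forall hB)
  -- The regressions at the tilted laws are chosen separately for each `t`, so their numerators and
  -- denominators are too. No regularity in `t` is needed: the quadratic error bounds alone yield
  -- the derivatives. Outside the radius the values are irrelevant.
  have main : ∀ t : ℝ, ∃ n d : ℝ, |t| ≤ (2 * (B + 1))⁻¹ →
      deltaPI c (ρ.withDensity fun o => ENNReal.ofReal (1 + t * s o)) = n / d ∧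
      |n - (∫ o, score c 1 0 η o ∂ρ + t * ∫ o, score c 1 0 η o * s o ∂ρ)| ≤ K * B ^ 2 * t ^ 2 ∧
      |d - (∫ o, score c 0 1 η o ∂ρ + t * ∫ o, score c 0 1 η o * s o ∂ρ)| ≤ K * B ^ 2 * t ^ 2 := by
    intro t
    by_cases ht : |t| ≤ (2 * (B + 1))⁻¹
    swap
    · exact ⟨0, 0, fun h => absurd h ht⟩
    have hg : Measurable fun o => 1 + t * s o := (hs.const_mul t).const_add 1
    have hgτ : ∀ o, |1 + t * s o - 1| ≤ |t| * B := fun o => by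
      rw [add_sub_cancel_left, abs_mul]
      exact mul_le_mul_of_nonneg_left (hB o) (abs_nonneg t)
    have hτ : |t| * B ≤ 1 / 2 := by
      calc |t| * B ≤ (2 * (B + 1))⁻¹ * (B + 1) :=
            mul_le_mul ht (by linarith) hB0 hδ.le
        _ = 1 / 2 := by field_simp
    have hg0 : ∀ o, 0 ≤ 1 + t * s o := fun o => by linarith [(abs_le.1 (hgτ o)).1]
    have hfin := isFiniteMeasure_withDensity_near_one (μ := ρ) hg hgτ
    obtain ⟨p, q, m0, hp, hq, hm0, h⟩ := deltaPI_eq_div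
      (ρ := ρ.withDensity fun o => ENNReal.ofReal (1 + t * s o)) c
      ((integrable_withDensity_ofReal hg hg0 _).2 (integrable_mul_of_near_one hg hgτ hYi))
    rw [restrict_withDensity measurableSet_treated] at hp hq
    rw [restrict_withDensity measurableSet_control] at hm0
    obtain ⟨h1, h2⟩ := hK _ _ hg hτ hgτ p q m0 hp hq hm0
    have hlin : ∀ a b, ∫ o, (1 + t * s o) * score c a b η o ∂ρ
        = ∫ o, score c a b η o ∂ρ + t * ∫ o, score c a b η o * s o ∂ρ := fun a b => by
      rw [← integral_const_mul, ← integral_add (hsc a b) ((hscs a b).const_mul t)]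
      refine integral_congr_ae (Eventually.of_forall fun o => ?_)
      simp only; ring
    have hsq : K * (|t| * B) ^ 2 = K * B ^ 2 * t ^ 2 := by rw [mul_pow, sq_abs]; ring
    rw [integral_withDensity_ofReal hg hg0, integral_withDensity_ofReal hg hg0] at h
    rw [hlin, hsq, abs_sub_comm] at h1 h2
    exact ⟨_, _, fun _ => ⟨h, h2, h1⟩⟩
  choose N D hND using main
  obtain ⟨hN0, hN⟩ := hasDerivAt_of_abs_sub_le_sq hδ fun t ht => (hND t ht).2.1
  obtain ⟨hD0, hD⟩ := hasDerivAt_of_abs_sub_le_sq hδ fun t ht => (hND t ht).2.2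
  have hdiv := hN.div hD (by rwa [hD0])
  rw [hN0, hD0] at hdiv
  refine hdiv.congr_of_eventuallyEq ?_
  filter_upwards [Metric.closedBall_mem_nhds (0 : ℝ) hδ] with t ht
  rw [Metric.mem_closedBall, Real.dist_eq, sub_zero] at ht
  exact (hND t ht).1

/-- The influence function of the identified functional. -/
lemma Identified.isInfluenceFunction (hI : Identified ρ c η ε)
    (hpi : ∫ o, η.pi o.1 ∂ρ ≠ 0) :
    IsInfluenceFunction (deltaPI c) ρ (phiDelta c η (∫ o, η.pi o.1 ∂ρ) (deltaPI c ρ)) := by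
  obtain ⟨e1, e2⟩ := hI.integral_score
  rw [phiDelta_eq_score, hI.deltaPI_eq, ← e1]
  rw [← e1] at hpi
  have hsc : ∀ a b, Integrable (score c a b η) ρ := fun a b =>
    (hI.memLp_score a b).integrable (by norm_num)
  refine ⟨hI.memLp_score _ _, ?_, ?_⟩
  · have := integral_score_linear (∫ o, score c 0 1 η o ∂ρ)⁻¹
      (-((∫ o, score c 1 0 η o ∂ρ) / ∫ o, score c 0 1 η o ∂ρ) * (∫ o, score c 0 1 η o ∂ρ)⁻¹)
      (s := fun _ => 1) (by simpa using hsc 1 0) (by simpa using hsc 0 1)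
    simp only [mul_one] at this
    rw [this]
    field_simp
    ring
  · rintro s hs ⟨B, hB⟩ -
    have hscs : ∀ a b, Integrable (fun o => score c a b η o * s o) ρ := fun a b =>
      (hsc a b).mul_bdd hs.aestronglyMeasurable (Eventually.of_forall hB)
    convert hI.hasDerivAt_deltaPI hpi hs hB using 1
    rw [integral_score_linear _ _ (hscs 1 0) (hscs 0 1)]
    field_simp
    ring

end InfluenceFunction

lemma abs_mul_le_mul {x y u v : ℝ} (hx : |x| ≤ u) (hy : |y| ≤ v) : |x * y| ≤ u * v := by
  rw [abs_mul]
  exact mul_le_mul hx hy (abs_nonneg y) ((abs_nonneg x).trans hx)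

lemma abs_add_le_add {x y u v : ℝ} (hx : |x| ≤ u) (hy : |y| ≤ v) : |x + y| ≤ u + v :=
  (abs_add_le x y).trans (add_le_add hx hy)

lemma abs_sub_le_add {x y u v : ℝ} (hx : |x| ≤ u) (hy : |y| ≤ v) : |x - y| ≤ u + v :=
  (abs_sub x y).trans (add_le_add hx hy)

/-! ### Estimated nuisances: bias and mean square continuity -/

section Estimates

variable {𝒳 : Type*} [MeasurableSpace 𝒳] {ρ : Measure (Obs 𝒳)} {c : Bool} {η ξ : Nuisance 𝒳}
  {ε M B : ℝ}

/-- Nuisance estimates `ξ` of `η` whose inverse propensity scores are bounded by `M`. -/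
structure BoundedEstimate (ρ : Measure (Obs 𝒳)) (η ξ : Nuisance 𝒳) (M : ℝ) : Prop where
  M_pos : 0 < M
  e_meas : Measurable ξ.e
  pi_meas : Measurable ξ.pi
  mu1_meas : Measurable ξ.mu1
  mu0_meas : Measurable ξ.mu0
  e_mem : ∀ᵐ o ∂ρ, M⁻¹ ≤ ξ.e o.1 ∧ M⁻¹ ≤ 1 - ξ.e o.1
  pi_mem : ∀ᵐ o ∂ρ, 0 ≤ ξ.pi o.1 ∧ ξ.pi o.1 ≤ 1
  mu1_sq : MemLp (fun o => ξ.mu1 o.1 - η.mu1 o.1) 2 ρ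
  mu0_sq : MemLp (fun o => ξ.mu0 o.1 - η.mu0 o.1) 2 ρ

/-- The second order bias of the estimating function of `ν_{1c} - ν_{0c}^PI`. -/
noncomputable def bias (η ξ : Nuisance 𝒳) (x : 𝒳) : ℝ :=
  (η.e x - ξ.e x) / ξ.e x * (ξ.pi x * (η.mu1 x - ξ.mu1 x)
      + (η.mu1 x - η.mu0 x) * (η.pi x - ξ.pi x) + (η.mu0 x - ξ.mu0 x) * (η.pi x - ξ.pi x))
    + (η.e x - ξ.e x) / (1 - ξ.e x) * ξ.pi x * (η.mu0 x - ξ.mu0 x)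
    - (ξ.pi x - η.pi x) * (η.mu0 x - ξ.mu0 x)

lemma integral_indicator_residual_eq_zero [IsProbabilityMeasure ρ]
    {S : Set (Obs 𝒳)} (hS : MeasurableSet S) {W : Obs 𝒳 → ℝ} {f w : 𝒳 → ℝ} (hW : Integrable W ρ)
    (hf : IsRegression (ρ.restrict S) Prod.fst W f)
    (hw : Measurable w) (hwW : Integrable (fun o => w o.1 * W o) ρ) :
    Integrable (fun o => S.indicator (fun o => w o.1 * (W o - f o.1)) o) ρ ∧
      ∫ o, S.indicator (fun o => w o.1 * (W o - f o.1)) o ∂ρ = 0 := by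
  have := integral_residual_eq_zero (τ := 0) (g := fun _ => 1) measurable_const (by simp) (by simp)
    hS hW (by simpa using hf) hw hwW
  simpa only [one_mul] using this

/-- Any weight that depends on the covariates, even an estimated one, is orthogonal to the true
residuals. So `S`, `S Y`, `Y` and `Z` may be replaced in the estimated score by their true
regressions, and what remains is an identity between functions of the covariates. -/
lemma BoundedEstimate.integral_score_sub [IsProbabilityMeasure ρ] (hI : Identified ρ c η ε)
    (hξ : BoundedEstimate ρ η ξ M) (a b : ℝ) :
    ∫ o, score c a b ξ o ∂ρ - ∫ o, score c a b η o ∂ρ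
      = ∫ o, (a * bias η ξ o.1
        + b * ((η.e o.1 - ξ.e o.1) / ξ.e o.1 * (η.pi o.1 - ξ.pi o.1))) ∂ρ := by
  have hM := hξ.M_pos
  have he := hI.reg_e.1
  have hp := hI.reg_pi.1
  have h1 := hI.mu1_meas
  have h0 := hI.reg_mu0.1
  have he' := hξ.e_meas
  have hp' := hξ.pi_meas
  have h1' := hξ.mu1_meas
  have h0' := hξ.mu0_meas
  have one_le : (1 : ℝ≥0∞) ≤ 2 := by norm_num
  have hYi : Integrable outcome ρ := hI.y_sq.integrable one_le
  have hsi : Integrable (strat c) ρ := integrable_strat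
  have hsY : Integrable (fun o => strat c o * outcome o) ρ := integrable_strat_mul hYi
  have hm1i : Integrable (fun o : Obs 𝒳 => η.mu1 o.1) ρ := hI.mu1_sq.integrable one_le
  have hm0i : Integrable (fun o : Obs 𝒳 => η.mu0 o.1) ρ := hI.mu0_sq.integrable one_le
  have hd1i : Integrable (fun o : Obs 𝒳 => ξ.mu1 o.1 - η.mu1 o.1) ρ := hξ.mu1_sq.integrable one_le
  have hd0i : Integrable (fun o : Obs 𝒳 => ξ.mu0 o.1 - η.mu0 o.1) ρ := hξ.mu0_sq.integrable one_le
  have hm1i' : Integrable (fun o : Obs 𝒳 => ξ.mu1 o.1) ρ :=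
    (hd1i.add hm1i).congr (Eventually.of_forall fun o => by simp)
  have hm0i' : Integrable (fun o : Obs 𝒳 => ξ.mu0 o.1) ρ :=
    (hd0i.add hm0i).congr (Eventually.of_forall fun o => by simp)
  have bi : ∀ᵐ o ∂ρ, ‖(ξ.e o.1)⁻¹‖ ≤ M := by
    filter_upwards [hξ.e_mem] with o h
    obtain ⟨i1, i2⟩ := inv_bounds (inv_pos.2 hM) h.1
    rwa [Real.norm_of_nonneg i1.le, ← inv_inv M]
  have bj : ∀ᵐ o ∂ρ, ‖(1 - ξ.e o.1)⁻¹‖ ≤ M := by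
    filter_upwards [hξ.e_mem] with o h
    obtain ⟨i1, i2⟩ := inv_bounds (inv_pos.2 hM) h.2
    rwa [Real.norm_of_nonneg i1.le, ← inv_inv M]
  have be : ∀ᵐ o ∂ρ, ‖η.e o.1‖ ≤ 1 := by
    filter_upwards [hI.e_mem] with o h
    have hε := hI.eps_pos
    rw [Real.norm_of_nonneg (by linarith [h.1])]
    linarith [h.2]
  have bp : ∀ᵐ o ∂ρ, ‖η.pi o.1‖ ≤ 1 := by
    filter_upwards [hI.pi_mem] with o h
    rw [Real.norm_of_nonneg h.1]
    exact h.2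
  have bp' : ∀ᵐ o ∂ρ, ‖ξ.pi o.1‖ ≤ 1 := by
    filter_upwards [hξ.pi_mem] with o h
    rw [Real.norm_of_nonneg h.1]
    exact h.2
  have bdd : ∀ {u : 𝒳 → ℝ} {K : ℝ} {F : Obs 𝒳 → ℝ}, Measurable u → (∀ᵐ o ∂ρ, ‖u o.1‖ ≤ K) →
      Integrable F ρ → Integrable (fun o => u o.1 * F o) ρ := fun hu hK hF =>
    hF.bdd_mul (hu.comp measurable_fst).aestronglyMeasurable hK
  obtain ⟨A1i, A1⟩ := integral_indicator_residual_eq_zero measurableSet_treated hsi hI.reg_pi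
    (w := fun x => (ξ.e x)⁻¹) he'.inv (bdd he'.inv bi hsi)
  obtain ⟨A2i, A2⟩ := integral_indicator_residual_eq_zero measurableSet_treated hsY hI.reg_mu1
    (w := fun x => (ξ.e x)⁻¹) he'.inv (bdd he'.inv bi hsY)
  obtain ⟨A3i, A3⟩ := integral_indicator_residual_eq_zero measurableSet_control hYi hI.reg_mu0
    (w := fun x => (1 - ξ.e x)⁻¹ * ξ.pi x) ((he'.const_sub 1).inv.mul hp')
    (by simpa only [mul_assoc] using bdd (u := fun x => (1 - ξ.e x)⁻¹) (he'.const_sub 1).inv bj (bdd hp' bp' hYi))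
  obtain ⟨A4i, A4⟩ := integral_indicator_residual_eq_zero measurableSet_treated hsi hI.reg_pi
    (w := fun x => (ξ.e x)⁻¹ * ξ.mu0 x) (he'.inv.mul h0')
    (by simpa only [mul_assoc, mul_comm (strat c _)] using
      bdd (u := fun x => (ξ.e x)⁻¹) he'.inv bi (integrable_strat_mul (c := c) hm0i'))
  have hq : Integrable (fun o : Obs 𝒳 => η.pi o.1 * η.mu1 o.1) ρ := bdd hp bp hm1i
  have hq0 : Integrable (fun o : Obs 𝒳 => η.pi o.1 * η.mu0 o.1) ρ := bdd hp bp hm0i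
  have hq' : Integrable (fun o : Obs 𝒳 => ξ.pi o.1 * ξ.mu1 o.1) ρ := bdd hp' bp' hm1i'
  have hq0' : Integrable (fun o : Obs 𝒳 => ξ.pi o.1 * ξ.mu0 o.1) ρ := bdd hp' bp' hm0i'
  have hd0 : Integrable (fun o : Obs 𝒳 => ξ.pi o.1 * (η.mu0 o.1 - ξ.mu0 o.1)) ρ :=
    bdd hp' bp' (hm0i.sub hm0i')
  have hdp : Integrable (fun o : Obs 𝒳 => η.pi o.1 * ξ.mu0 o.1 - ξ.pi o.1 * ξ.mu0 o.1) ρ :=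
    (bdd hp bp hm0i').sub hq0'
  have hpi : Integrable (fun o : Obs 𝒳 => η.pi o.1) ρ := by
    simpa using bdd hp bp (integrable_const (1 : ℝ) : Integrable (fun _ => (1 : ℝ)) ρ)
  have hpi' : Integrable (fun o : Obs 𝒳 => ξ.pi o.1) ρ := by
    simpa using bdd hp' bp' (integrable_const (1 : ℝ) : Integrable (fun _ => (1 : ℝ)) ρ)
  have hj : Integrable (fun o : Obs 𝒳 => (1 - ξ.e o.1)⁻¹ * (ξ.pi o.1 * (η.mu0 o.1 - ξ.mu0 o.1))) ρ :=
    bdd (he'.const_sub 1).inv bj hd0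
  -- `V` is the coefficient of `Z` once the outcome residuals have been removed. `A5` then replaces
  -- `Z` by the true `e₁`, and `R` is the resulting function of the covariates.
  let V : 𝒳 → ℝ := fun x => a * ((ξ.e x)⁻¹ * (η.pi x * η.mu1 x - ξ.pi x * ξ.mu1 x)
    + (1 - ξ.e x)⁻¹ * (ξ.pi x * (η.mu0 x - ξ.mu0 x))
    - (ξ.e x)⁻¹ * (η.pi x * ξ.mu0 x - ξ.pi x * ξ.mu0 x)) + b * ((ξ.e x)⁻¹ * (η.pi x - ξ.pi x))
  have hVm : Measurable V := by fun_prop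
  have hVi : Integrable (fun o : Obs 𝒳 => V o.1) ρ :=
    ((((bdd he'.inv bi (hq.sub hq')).add hj).sub (bdd he'.inv bi hdp)).const_mul a).add
      ((bdd he'.inv bi (hpi.sub hpi')).const_mul b)
  obtain ⟨A5i, A5⟩ := integral_indicator_residual_eq_zero (ρ := ρ) MeasurableSet.univ
    (integrable_ind measurable_snd.fst) (by simpa using hI.reg_e) (w := V) hVm (by
      have := hVi.bdd_mul (c := 1) (measurable_ind.comp measurable_snd.fst).aestronglyMeasurable
        (Eventually.of_forall fun o : Obs 𝒳 => abs_ind_le_one o.2.1)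
      simpa only [mul_comm, Function.comp_def] using this)
  simp only [treated_indicator, control_indicator, Set.indicator_univ] at A1i A1 A2i A2 A3i A3 A4i A4 A5i A5
  let R : 𝒳 → ℝ := fun x => η.e x * V x + (a * (ξ.pi x * ξ.mu1 x
    - (1 - ξ.e x)⁻¹ * (ξ.pi x * (η.mu0 x - ξ.mu0 x)) - ξ.pi x * ξ.mu0 x) + b * ξ.pi x)
  have hRi : Integrable (fun o : Obs 𝒳 => R o.1) ρ :=
    (bdd he be hVi).add ((((hq'.sub hj).sub hq0').const_mul a).add (hpi'.const_mul b))
  have hscore : ∫ o, score c a b ξ o ∂ρ = ∫ o, R o.1 ∂ρ := by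
    have e1 : ∀ o, score c a b ξ o = a * (ind o.2.1 * ((ξ.e o.1)⁻¹ *
          (strat c o * outcome o - η.pi o.1 * η.mu1 o.1)))
        - a * ((1 - ind o.2.1) * ((1 - ξ.e o.1)⁻¹ * ξ.pi o.1 * (outcome o - η.mu0 o.1)))
        - a * (ind o.2.1 * ((ξ.e o.1)⁻¹ * ξ.mu0 o.1 * (strat c o - η.pi o.1)))
        + b * (ind o.2.1 * ((ξ.e o.1)⁻¹ * (strat c o - η.pi o.1)))
        + V o.1 * (ind o.2.1 - η.e o.1) + R o.1 := fun o => by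
      simp only [score, phiNu1_apply, phiNu0_apply, phiPi_apply, V, R, div_eq_mul_inv]
      ring
    have j1 := (A2i.const_mul a).sub (A3i.const_mul a)
    have j2 := j1.sub (A4i.const_mul a)
    have j3 := j2.add (A1i.const_mul b)
    have j4 := j3.add A5i
    rw [integral_congr_ae (Eventually.of_forall e1)]
    refine (integral_add' j4 hRi).trans ?_
    rw [integral_add' j3 A5i, integral_add' j2 (A1i.const_mul b), integral_sub' j1 (A4i.const_mul a),
      integral_sub' (A2i.const_mul a) (A3i.const_mul a), integral_const_mul,
      integral_const_mul, integral_const_mul, integral_const_mul, A1, A2, A3, A4, A5]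
    simp
  obtain ⟨e1, e2⟩ := hI.integral_score
  have hsc : ∀ a b, Integrable (score c a b η) ρ := fun a b =>
    (hI.memLp_score a b).integrable one_le
  have hqq : Integrable (fun o : Obs 𝒳 => η.pi o.1 * η.mu1 o.1 - η.pi o.1 * η.mu0 o.1) ρ :=
    hq.sub hq0
  have htrue : ∫ o, score c a b η o ∂ρ
      = ∫ o, (a * (η.pi o.1 * η.mu1 o.1 - η.pi o.1 * η.mu0 o.1) + b * η.pi o.1) ∂ρ := by
    have := integral_score_linear (ρ := ρ) (c := c) (η := η) a b (s := fun _ => 1)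
      (by simpa using hsc 1 0) (by simpa using hsc 0 1)
    simp only [mul_one] at this
    rw [this, e1, e2, integral_add (hqq.const_mul a) (hpi.const_mul b),
      integral_const_mul, integral_const_mul]
  have hT : Integrable (fun o : Obs 𝒳 =>
      a * (η.pi o.1 * η.mu1 o.1 - η.pi o.1 * η.mu0 o.1) + b * η.pi o.1) ρ :=
    (hqq.const_mul a).add (hpi.const_mul b)
  rw [hscore, htrue, ← integral_sub hRi hT]
  refine integral_congr_ae ?_
  filter_upwards [hξ.e_mem] with o h
  have n1 : ξ.e o.1 ≠ 0 := ((inv_pos.2 hM).trans_le h.1).ne'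
  have n2 : 1 - ξ.e o.1 ≠ 0 := ((inv_pos.2 hM).trans_le h.2).ne'
  simp only [R, V, bias]
  field_simp
  ring

/-- `M` bounds the inverse weights, `ξ.pi ≤ 1`, and the triple product of errors loses a factor by
`|ξ.pi - η.pi| ≤ 1`. The bound `B` on the contrast is needed for `(e - ẽ)(μ₁ - μ₀)(π - π̃)`, which
is then controlled by a product of two errors. -/
lemma BoundedEstimate.abs_bias_le (hI : Identified ρ c η ε)
    (hξ : BoundedEstimate ρ η ξ M) (hB : ∀ᵐ o ∂ρ, |η.mu1 o.1 - η.mu0 o.1| ≤ B) (a b : ℝ) :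
    ∀ᵐ o ∂ρ, |a * bias η ξ o.1
        + b * ((η.e o.1 - ξ.e o.1) / ξ.e o.1 * (η.pi o.1 - ξ.pi o.1))|
      ≤ (|a| * (2 * M + M * |B| + 1) + |b| * M) *
        (|ξ.e o.1 - η.e o.1| * |ξ.pi o.1 - η.pi o.1|
          + |ξ.e o.1 - η.e o.1| * |ξ.mu1 o.1 - η.mu1 o.1|
          + |ξ.e o.1 - η.e o.1| * |ξ.mu0 o.1 - η.mu0 o.1|
          + |ξ.pi o.1 - η.pi o.1| * |ξ.mu0 o.1 - η.mu0 o.1|) := by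
  have hM := hξ.M_pos
  filter_upwards [hξ.e_mem, hI.pi_mem, hB, hξ.pi_mem] with o h hpi hB hpi'
  obtain ⟨i1, i2⟩ := inv_bounds (inv_pos.2 hM) h.1
  obtain ⟨j1, j2⟩ := inv_bounds (inv_pos.2 hM) h.2
  rw [inv_inv] at i2 j2
  have de := abs_nonneg (ξ.e o.1 - η.e o.1)
  have dp := abs_nonneg (ξ.pi o.1 - η.pi o.1)
  have d1 := abs_nonneg (ξ.mu1 o.1 - η.mu1 o.1)
  have d0 := abs_nonneg (ξ.mu0 o.1 - η.mu0 o.1)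
  have hBn := abs_nonneg B
  have hE : |(η.e o.1 - ξ.e o.1) / ξ.e o.1| ≤ M * |ξ.e o.1 - η.e o.1| := by
    rw [div_eq_inv_mul, abs_mul, abs_of_nonneg i1.le, abs_sub_comm]
    exact mul_le_mul_of_nonneg_right i2 de
  have hF : |(η.e o.1 - ξ.e o.1) / (1 - ξ.e o.1)| ≤ M * |ξ.e o.1 - η.e o.1| := by
    rw [div_eq_inv_mul, abs_mul, abs_of_nonneg j1.le, abs_sub_comm]
    exact mul_le_mul_of_nonneg_right j2 de
  have hp' : |ξ.pi o.1| ≤ 1 := abs_le.2 ⟨by linarith [hpi'.1], hpi'.2⟩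
  have hpp : |η.pi o.1 - ξ.pi o.1| ≤ 1 :=
    abs_le.2 ⟨by linarith [hpi'.2, hpi.1], by linarith [hpi'.1, hpi.2]⟩
  have hdp : |η.pi o.1 - ξ.pi o.1| ≤ |ξ.pi o.1 - η.pi o.1| := (abs_sub_comm _ _).le
  have hd1 : |η.mu1 o.1 - ξ.mu1 o.1| ≤ |ξ.mu1 o.1 - η.mu1 o.1| := (abs_sub_comm _ _).le
  have hd0 : |η.mu0 o.1 - ξ.mu0 o.1| ≤ |ξ.mu0 o.1 - η.mu0 o.1| := (abs_sub_comm _ _).le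
  have t0 := abs_mul_le_mul hE (abs_add_le_add (abs_add_le_add (abs_mul_le_mul hp' hd1)
    (abs_mul_le_mul (hB.trans (le_abs_self B)) hdp)) (abs_mul_le_mul hd0 hpp))
  have t1 := abs_mul_le_mul (abs_mul_le_mul hF hp') hd0
  have t2 := abs_mul_le_mul (le_refl |ξ.pi o.1 - η.pi o.1|) hd0
  have t3 : |bias η ξ o.1| ≤ _ := abs_sub_le_add (abs_add_le_add t0 t1) t2
  have t4 := abs_add_le_add (abs_mul_le_mul (le_refl |a|) t3)
    (abs_mul_le_mul (le_refl |b|) (abs_mul_le_mul hE hdp))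
  refine t4.trans ?_
  have ha := abs_nonneg a
  have hb := abs_nonneg b
  generalize |ξ.e o.1 - η.e o.1| = E at *
  generalize |ξ.pi o.1 - η.pi o.1| = Q at *
  generalize |ξ.mu1 o.1 - η.mu1 o.1| = D1 at *
  generalize |ξ.mu0 o.1 - η.mu0 o.1| = D0 at *
  have x1 := mul_nonneg de dp
  have x2 := mul_nonneg de d1
  have x3 := mul_nonneg de d0
  have x4 := mul_nonneg dp d0
  have main : M * E * (1 * D1 + |B| * Q + D0 * 1) + M * E * 1 * D0 + Q * D0
      ≤ (2 * M + M * |B| + 1) * (E * Q + E * D1 + E * D0 + Q * D0) := by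
    have y := mul_nonneg hM.le hBn
    linarith [mul_nonneg hM.le x1, mul_nonneg hM.le x2, mul_nonneg hM.le x3, mul_nonneg hM.le x4,
      mul_nonneg y x2, mul_nonneg y x3, mul_nonneg y x4]
  have main2 : M * E * Q ≤ M * (E * Q + E * D1 + E * D0 + Q * D0) := by
    linarith [mul_nonneg hM.le x2, mul_nonneg hM.le x3, mul_nonneg hM.le x4]
  linarith [mul_le_mul_of_nonneg_left main ha, mul_le_mul_of_nonneg_left main2 hb]

/-- The Cauchy–Schwarz inequality, in the form of Hölder's with exponents 2, 2 and 1. -/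
lemma lintegral_mul_le_l2err {f g f' g' : 𝒳 → ℝ} (hf : Measurable f) (hg : Measurable g)
    (hf' : Measurable f') (hg' : Measurable g') :
    ∫⁻ o, ENNReal.ofReal (|f o.1 - g o.1| * |f' o.1 - g' o.1|) ∂ρ
      ≤ l2err (ρ.map Prod.fst) f g * l2err (ρ.map Prod.fst) f' g' := by
  have hm : Measurable fun x => f x - g x := hf.sub hg
  have hm' : Measurable fun x => f' x - g' x := hf'.sub hg'
  have h := eLpNorm_smul_le_mul_eLpNorm (p := 2) (q := 2) (r := 1) (μ := ρ.map Prod.fst)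
    hm'.aestronglyMeasurable hm.aestronglyMeasurable
  refine le_trans (le_of_eq ?_) h
  rw [eLpNorm_one_eq_lintegral_enorm, lintegral_map (by fun_prop) measurable_fst]
  refine lintegral_congr fun o => ?_
  rw [← abs_mul, ← Real.enorm_eq_ofReal_abs]
  rfl

/-- The bias of the estimating functions at estimated nuisance functions is a sum of products of
estimation errors. -/
lemma BoundedEstimate.enorm_integral_score_sub_le [IsProbabilityMeasure ρ]
    (hI : Identified ρ c η ε) (hξ : BoundedEstimate ρ η ξ M)
    (hB : ∀ᵐ o ∂ρ, |η.mu1 o.1 - η.mu0 o.1| ≤ B) (a b : ℝ) :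
    ENNReal.ofReal |∫ o, score c a b ξ o ∂ρ - ∫ o, score c a b η o ∂ρ|
      ≤ ENNReal.ofReal (|a| * (2 * M + M * |B| + 1) + |b| * M) *
        (l2err (ρ.map Prod.fst) ξ.e η.e * l2err (ρ.map Prod.fst) ξ.pi η.pi
          + l2err (ρ.map Prod.fst) ξ.e η.e * l2err (ρ.map Prod.fst) ξ.mu1 η.mu1
          + l2err (ρ.map Prod.fst) ξ.e η.e * l2err (ρ.map Prod.fst) ξ.mu0 η.mu0
          + l2err (ρ.map Prod.fst) ξ.pi η.pi * l2err (ρ.map Prod.fst) ξ.mu0 η.mu0) := by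
  have he := hI.reg_e.1
  have hp := hI.reg_pi.1
  have h1 := hI.mu1_meas
  have h0 := hI.reg_mu0.1
  have he' := hξ.e_meas
  have hp' := hξ.pi_meas
  have h1' := hξ.mu1_meas
  have h0' := hξ.mu0_meas
  have hK : 0 ≤ |a| * (2 * M + M * |B| + 1) + |b| * M := by
    have := hξ.M_pos
    positivity
  rw [hξ.integral_score_sub hI, ← Real.enorm_eq_ofReal_abs]
  refine (enorm_integral_le_lintegral_enorm _).trans ?_
  calc _ ≤ ∫⁻ o, ENNReal.ofReal (|a| * (2 * M + M * |B| + 1) + |b| * M) *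
        (ENNReal.ofReal (|ξ.e o.1 - η.e o.1| * |ξ.pi o.1 - η.pi o.1|)
          + ENNReal.ofReal (|ξ.e o.1 - η.e o.1| * |ξ.mu1 o.1 - η.mu1 o.1|)
          + ENNReal.ofReal (|ξ.e o.1 - η.e o.1| * |ξ.mu0 o.1 - η.mu0 o.1|)
          + ENNReal.ofReal (|ξ.pi o.1 - η.pi o.1| * |ξ.mu0 o.1 - η.mu0 o.1|)) ∂ρ := by
        refine lintegral_mono_ae ?_
        filter_upwards [hξ.abs_bias_le hI hB a b] with o h
        rw [Real.enorm_eq_ofReal_abs]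
        refine (ENNReal.ofReal_le_ofReal h).trans ?_
        generalize |a| * (2 * M + M * |B| + 1) + |b| * M = K at hK
        rw [ENNReal.ofReal_mul hK, ENNReal.ofReal_add (by positivity) (by positivity),
          ENNReal.ofReal_add (by positivity) (by positivity),
          ENNReal.ofReal_add (by positivity) (by positivity)]
    _ ≤ _ := by
        rw [lintegral_const_mul _ (by fun_prop), lintegral_add_left (by fun_prop),
          lintegral_add_left (by fun_prop), lintegral_add_left (by fun_prop)]
        gcongr <;> exact lintegral_mul_le_l2err ‹_› ‹_› ‹_› ‹_›

/-- The errors of `e` and `π` are multiplied by the unbounded envelope `|Y| + |μ₁| + |μ₀| + 1`, so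
their `L²` norms alone do not bound the difference of the scores; the truncation in
`Identified.exists_eLpNorm_score_sub_le` deals with this. -/
lemma BoundedEstimate.abs_score_sub_le (hI : Identified ρ c η ε) (hξ : BoundedEstimate ρ η ξ M)
    (a b : ℝ) : ∀ᵐ o ∂ρ, |score c a b ξ o - score c a b η o|
      ≤ (|a| + |b|) * (5 * ((M + 1) * (ε⁻¹ + 1))) *
        ((|ξ.e o.1 - η.e o.1| + |ξ.pi o.1 - η.pi o.1|) *
          (|outcome o| + |η.mu1 o.1| + |η.mu0 o.1| + 1)
          + |ξ.mu1 o.1 - η.mu1 o.1| + |ξ.mu0 o.1 - η.mu0 o.1|) := by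
  have hM := hξ.M_pos
  have hε := hI.eps_pos
  have hE0 := (inv_pos.2 hε).le
  filter_upwards [hξ.e_mem, hI.pi_mem, hI.e_mem, hξ.pi_mem] with o h hpi he hpi'
  obtain ⟨i1, i2⟩ := inv_bounds (inv_pos.2 hM) h.1
  obtain ⟨j1, j2⟩ := inv_bounds (inv_pos.2 hM) h.2
  rw [inv_inv] at i2 j2
  obtain ⟨k1, k2⟩ := inv_bounds hε he.1
  obtain ⟨l1, l2⟩ := inv_bounds (r := 1 - η.e o.1) hε (by linarith [he.2])
  have n1 : ξ.e o.1 ≠ 0 := ((inv_pos.2 hM).trans_le h.1).ne'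
  have n2 : 1 - ξ.e o.1 ≠ 0 := ((inv_pos.2 hM).trans_le h.2).ne'
  have n3 : η.e o.1 ≠ 0 := (hε.trans_le he.1).ne'
  have n4 : 1 - η.e o.1 ≠ 0 := by linarith [he.2]
  have z0 := ind_nonneg o.2.1
  have z1 := ind_le_one o.2.1
  have hs0 : 0 ≤ strat c o := ind_nonneg _
  have hs1 : strat c o ≤ 1 := ind_le_one _
  -- A single constant dominating `1`, `M`, `ε⁻¹` and `M ε⁻¹`.
  set L := (M + 1) * (ε⁻¹ + 1) with hL
  have hML : M ≤ L := by nlinarith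
  have hEL : ε⁻¹ ≤ L := by nlinarith
  have hMEL : M * ε⁻¹ ≤ L := by nlinarith
  have h1L : 1 ≤ L := by nlinarith
  have hz : |ind o.2.1| ≤ 1 := abs_ind_le_one _
  have hz' : |1 - ind o.2.1| ≤ 1 := abs_le.2 ⟨by linarith, by linarith⟩
  have de := abs_nonneg (ξ.e o.1 - η.e o.1)
  have hA' : |ind o.2.1 / ξ.e o.1| ≤ L := by
    rw [div_eq_mul_inv]
    exact (abs_mul_le_mul hz (abs_of_nonneg i1.le).le).trans (by linarith)
  have hA : |ind o.2.1 / η.e o.1| ≤ L := by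
    rw [div_eq_mul_inv]
    exact (abs_mul_le_mul hz (abs_of_nonneg k1.le).le).trans (by linarith)
  have hV' : |(1 - ind o.2.1) / (1 - ξ.e o.1)| ≤ L := by
    rw [div_eq_mul_inv]
    exact (abs_mul_le_mul hz' (abs_of_nonneg j1.le).le).trans (by linarith)
  have hV : |(1 - ind o.2.1) / (1 - η.e o.1)| ≤ L := by
    rw [div_eq_mul_inv]
    exact (abs_mul_le_mul hz' (abs_of_nonneg l1.le).le).trans (by linarith)
  have hdA : |ind o.2.1 / ξ.e o.1 - ind o.2.1 / η.e o.1| ≤ L * |ξ.e o.1 - η.e o.1| := by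
    have e1 : ind o.2.1 / ξ.e o.1 - ind o.2.1 / η.e o.1
        = ind o.2.1 * ((ξ.e o.1)⁻¹ * (η.e o.1)⁻¹) * (η.e o.1 - ξ.e o.1) := by
      field_simp
    rw [e1]
    refine (abs_mul_le_mul (abs_mul_le_mul hz (abs_mul_le_mul ((abs_of_nonneg i1.le).le.trans i2)
      ((abs_of_nonneg k1.le).le.trans k2))) (abs_sub_comm _ _).le).trans ?_
    rw [one_mul]
    exact mul_le_mul_of_nonneg_right hMEL de
  have hdV : |(1 - ind o.2.1) / (1 - ξ.e o.1) - (1 - ind o.2.1) / (1 - η.e o.1)|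
      ≤ L * |ξ.e o.1 - η.e o.1| := by
    have e1 : (1 - ind o.2.1) / (1 - ξ.e o.1) - (1 - ind o.2.1) / (1 - η.e o.1)
        = (1 - ind o.2.1) * ((1 - ξ.e o.1)⁻¹ * (1 - η.e o.1)⁻¹) * (ξ.e o.1 - η.e o.1) := by
      field_simp
      ring
    rw [e1]
    refine (abs_mul_le_mul (abs_mul_le_mul hz' (abs_mul_le_mul ((abs_of_nonneg j1.le).le.trans j2)
      ((abs_of_nonneg l1.le).le.trans l2))) le_rfl).trans ?_
    rw [one_mul]
    exact mul_le_mul_of_nonneg_right hMEL de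
  have hp : |η.pi o.1| ≤ 1 := abs_le.2 ⟨by linarith [hpi.1], hpi.2⟩
  have hp' : |ξ.pi o.1| ≤ 1 := abs_le.2 ⟨by linarith [hpi'.1], hpi'.2⟩
  have hs : |strat c o| ≤ 1 := abs_strat_le_one c o
  have hsp : |strat c o - ξ.pi o.1| ≤ 1 := abs_le.2 ⟨by linarith [hpi'.2], by linarith [hpi'.1]⟩
  have hdp : |η.pi o.1 - ξ.pi o.1| ≤ |ξ.pi o.1 - η.pi o.1| := (abs_sub_comm _ _).le
  simp only [score, phiNu1_apply, phiNu0_apply, phiPi_apply]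
  have dp := abs_nonneg (ξ.pi o.1 - η.pi o.1)
  have d1 := abs_nonneg (ξ.mu1 o.1 - η.mu1 o.1)
  have d0 := abs_nonneg (ξ.mu0 o.1 - η.mu0 o.1)
  have hy := abs_nonneg (outcome o)
  have hm1 := abs_nonneg (η.mu1 o.1)
  have hm0 := abs_nonneg (η.mu0 o.1)
  generalize ind o.2.1 / ξ.e o.1 = A' at *
  generalize ind o.2.1 / η.e o.1 = A at *
  generalize (1 - ind o.2.1) / (1 - ξ.e o.1) = V' at *
  generalize (1 - ind o.2.1) / (1 - η.e o.1) = V at *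
  generalize outcome o = y at *
  generalize strat c o = s at *
  clear_value L
  generalize η.pi o.1 = p at *
  generalize ξ.pi o.1 = p' at *
  generalize η.mu1 o.1 = m1 at *
  generalize ξ.mu1 o.1 = m1' at *
  generalize η.mu0 o.1 = m0 at *
  generalize ξ.mu0 o.1 = m0' at *
  generalize |ξ.e o.1 - η.e o.1| = d at *
  -- Telescoping: in each product of estimated factors one factor at a time is replaced by its true
  -- value. The true `μ₁` and `μ₀` stay in the envelope, and their estimates appear only through
  -- errors.
  have hq : |p' * (m1' - m1) + (p' - p) * m1| ≤ 1 * |m1' - m1| + |p' - p| * |m1| :=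
    abs_add_le_add (abs_mul_le_mul hp' le_rfl) (abs_mul_le_mul le_rfl le_rfl)
  have b1 := abs_add_le_add (abs_sub_le_add (abs_mul_le_mul hdA
    (abs_sub_le_add (abs_mul_le_mul hs (le_refl |y|)) (abs_mul_le_mul hp (le_refl |m1|))))
    (abs_mul_le_mul hA' hq)) hq
  have b0 := abs_add_le_add (abs_add_le_add (abs_add_le_add (abs_add_le_add (abs_add_le_add
    (abs_add_le_add (abs_add_le_add
      (abs_mul_le_mul (abs_mul_le_mul hV' hp') (abs_sub_comm m0 m0').le)
      (abs_mul_le_mul (abs_mul_le_mul hdV hp') (abs_sub y m0)))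
      (abs_mul_le_mul (abs_mul_le_mul hV (le_refl |p' - p|)) (abs_sub y m0)))
      (abs_mul_le_mul (abs_mul_le_mul hA' (le_refl |m0' - m0|)) hsp))
      (abs_mul_le_mul (abs_mul_le_mul hdA (le_refl |m0|)) hsp))
      (abs_mul_le_mul (abs_mul_le_mul hA (le_refl |m0|)) hdp))
      (abs_mul_le_mul hp' (le_refl |m0' - m0|)))
      (abs_mul_le_mul (le_refl |p' - p|) (le_refl |m0|))
  have bpi := abs_add_le_add (abs_add_le_add (abs_mul_le_mul hdA hsp) (abs_mul_le_mul hA hdp))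
    (le_refl |p' - p|)
  have tot := abs_add_le_add (abs_mul_le_mul (le_refl |a|) (abs_sub_le_add b1 b0))
    (abs_mul_le_mul (le_refl |b|) bpi)
  refine le_trans (le_of_eq ?_) (tot.trans ?_)
  · congr 1; ring
  have ha := abs_nonneg a
  have hb := abs_nonneg b
  generalize |p' - p| = q at *
  generalize |m1' - m1| = r1 at *
  generalize |m0' - m0| = r0 at *
  generalize |y| = Y at *
  generalize |m1| = n1 at *
  generalize |m0| = n0 at *
  have hL0 : 0 ≤ L := zero_le_one.trans h1L
  have fin1 : L * d * (1 * Y + 1 * n1) + L * (1 * r1 + q * n1) + (1 * r1 + q * n1)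
      + (L * 1 * r0 + L * d * 1 * (Y + n0) + L * q * (Y + n0) + L * r0 * 1 + L * d * n0 * 1
        + L * n0 * q + 1 * r0 + q * n0)
      ≤ 5 * L * ((d + q) * (Y + n1 + n0 + 1) + r1 + r0) := by
    have w1 := mul_le_mul_of_nonneg_right h1L d1
    have w2 := mul_le_mul_of_nonneg_right h1L d0
    have w3 := mul_le_mul_of_nonneg_right h1L (mul_nonneg dp hm1)
    have w4 := mul_le_mul_of_nonneg_right h1L (mul_nonneg dp hm0)
    linarith [mul_nonneg hL0 (mul_nonneg de hy), mul_nonneg hL0 (mul_nonneg de hm1),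
      mul_nonneg hL0 (mul_nonneg de hm0), mul_nonneg hL0 de, mul_nonneg hL0 (mul_nonneg dp hy),
      mul_nonneg hL0 (mul_nonneg dp hm1), mul_nonneg hL0 (mul_nonneg dp hm0), mul_nonneg hL0 dp,
      mul_nonneg hL0 d1, mul_nonneg hL0 d0]
  have fin2 : L * d * 1 + L * q + q ≤ 5 * L * ((d + q) * (Y + n1 + n0 + 1) + r1 + r0) := by
    have w1 := mul_le_mul_of_nonneg_right h1L dp
    linarith [mul_nonneg hL0 (mul_nonneg de hy), mul_nonneg hL0 (mul_nonneg de hm1),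
      mul_nonneg hL0 (mul_nonneg de hm0), mul_nonneg hL0 de, mul_nonneg hL0 (mul_nonneg dp hy),
      mul_nonneg hL0 (mul_nonneg dp hm1), mul_nonneg hL0 (mul_nonneg dp hm0), mul_nonneg hL0 dp,
      mul_nonneg hL0 d1, mul_nonneg hL0 d0]
  linarith [mul_le_mul_of_nonneg_left fin1 ha, mul_le_mul_of_nonneg_left fin2 hb]

lemma l2err_map_fst {f g : 𝒳 → ℝ} (hf : Measurable f) (hg : Measurable g) :
    l2err (ρ.map Prod.fst) f g = eLpNorm (fun o => f o.1 - g o.1) 2 ρ :=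
  eLpNorm_map_measure (hf.sub hg).aestronglyMeasurable measurable_fst.aemeasurable

lemma eLpNorm_mul_abs_le {α : Type*} [MeasurableSpace α] {μ : Measure α} {f : α → ℝ} {r s : ℝ}
    (hr : 0 ≤ r) (h : eLpNorm f 2 μ ≤ ENNReal.ofReal s) :
    eLpNorm (fun x => r * |f x|) 2 μ ≤ ENNReal.ofReal (r * s) := by
  have h1 := eLpNorm_const_smul r (fun x => ‖f x‖) 2 μ
  rw [eLpNorm_norm, Real.enorm_eq_ofReal hr] at h1
  rw [ENNReal.ofReal_mul hr]
  exact h1.le.trans (mul_le_mul_right h _)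

lemma eLpNorm_add_le_ofReal {α : Type*} [MeasurableSpace α] {μ : Measure α} {f g : α → ℝ} {s t : ℝ}
    (hf : Measurable f) (hg : Measurable g) (hs : 0 ≤ s) (ht : 0 ≤ t)
    (h : eLpNorm f 2 μ ≤ ENNReal.ofReal s) (h' : eLpNorm g 2 μ ≤ ENNReal.ofReal t) :
    eLpNorm (fun x => f x + g x) 2 μ ≤ ENNReal.ofReal (s + t) := by
  rw [ENNReal.ofReal_add hs ht]
  exact (eLpNorm_add_le hf.aestronglyMeasurable hg.aestronglyMeasurable one_le_two).trans
    (add_le_add h h')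

/-- The estimating functions are continuous in mean square with respect to the nuisances. -/
lemma Identified.exists_eLpNorm_score_sub_le [IsProbabilityMeasure ρ] (hI : Identified ρ c η ε)
    (M a b : ℝ) {κ : ℝ} (hκ : 0 < κ) : ∃ δ : ℝ, 0 < δ ∧ ∀ ξ, BoundedEstimate ρ η ξ M →
      l2err (ρ.map Prod.fst) ξ.e η.e ≤ ENNReal.ofReal δ →
      l2err (ρ.map Prod.fst) ξ.pi η.pi ≤ ENNReal.ofReal δ →
      l2err (ρ.map Prod.fst) ξ.mu1 η.mu1 ≤ ENNReal.ofReal δ →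
      l2err (ρ.map Prod.fst) ξ.mu0 η.mu0 ≤ ENNReal.ofReal δ →
      eLpNorm (fun o => score c a b ξ o - score c a b η o) 2 ρ ≤ ENNReal.ofReal κ := by
  rcases le_or_gt M 0 with hM | hM
  · exact ⟨1, one_pos, fun ξ hξ => absurd hξ.M_pos hM.not_gt⟩
  have hε := hI.eps_pos
  have he := hI.reg_e.1
  have hp := hI.reg_pi.1
  have h1 := hI.mu1_meas
  have h0 := hI.reg_mu0.1
  have hy := measurable_outcome (𝒳 := 𝒳)
  set L : ℝ := (|a| + |b|) * (5 * ((M + 1) * (ε⁻¹ + 1))) with hL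
  have hL0 : 0 ≤ L := by positivity
  let H : Obs 𝒳 → ℝ := fun o => |outcome o| + |η.mu1 o.1| + |η.mu0 o.1| + 1
  have hHm : Measurable H := by fun_prop
  have hH : MemLp H 2 ρ := ((hI.y_sq.abs.add hI.mu1_sq.abs).add hI.mu0_sq.abs).add (memLp_const 1)
  -- Truncation of the envelope `H`. Where `H < N` the errors are multiplied by at most `N`; where
  -- `H ≥ N` the errors of `e` and `π` are at most 1 each, leaving `2 H`, whose `L²` norm on that
  -- set is small.
  obtain ⟨N, hN0, hN⟩ := hH.eLpNorm_indicator_norm_ge_pos_le hHm.stronglyMeasurable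
    (ε := κ / (4 * (L + 1))) (by positivity)
  have hN' : eLpNorm ({x | N ≤ |H x|}.indicator H) 2 ρ
      ≤ ENNReal.ofReal (κ / (4 * (L + 1))) := hN
  have hHN : MeasurableSet {x | N ≤ |H x|} := measurableSet_le measurable_const hHm.abs
  have hden : 0 < 4 * (L + 1) * (N + 1) := by positivity
  -- With this `δ` the five contributions add up to `2 (N + 1) δ + 2 κ / (4 (L + 1)) = κ / (L + 1)`,
  -- and the prefactor is `L`.
  refine ⟨κ / (4 * (L + 1) * (N + 1)), by positivity, fun ξ hξ be bp b1 b0 => ?_⟩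
  have he' := hξ.e_meas
  have hp' := hξ.pi_meas
  have h1' := hξ.mu1_meas
  have h0' := hξ.mu0_meas
  rw [l2err_map_fst he' he] at be
  rw [l2err_map_fst hp' hp] at bp
  rw [l2err_map_fst h1' h1] at b1
  rw [l2err_map_fst h0' h0] at b0
  set δ := κ / (4 * (L + 1) * (N + 1)) with hδ
  have hδ0 : 0 ≤ δ := by positivity
  set G : Obs 𝒳 → ℝ := {x | N ≤ |H x|}.indicator H with hG
  have hGm : Measurable G := hHm.indicator hHN
  have c1 := eLpNorm_mul_abs_le hN0.le be
  have c2 := eLpNorm_mul_abs_le hN0.le bp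
  have c3 := eLpNorm_mul_abs_le zero_le_two hN'
  have c4 := eLpNorm_mul_abs_le zero_le_one b1
  have c5 := eLpNorm_mul_abs_le zero_le_one b0
  have d1 := eLpNorm_add_le_ofReal (by fun_prop) (by fun_prop) (by positivity) (by positivity) c1 c2
  have d2 := eLpNorm_add_le_ofReal (by fun_prop) (by fun_prop) (by positivity) (by positivity) d1 c3
  have d3 := eLpNorm_add_le_ofReal (by fun_prop) (by fun_prop) (by positivity) (by positivity) d2 c4
  have d4 := eLpNorm_add_le_ofReal (by fun_prop) (by fun_prop) (by positivity) (by positivity) d3 c5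
  refine (eLpNorm_mono_ae_real ?_).trans ((eLpNorm_mul_abs_le hL0 d4).trans
    (ENNReal.ofReal_le_ofReal ?_))
  · filter_upwards [hξ.abs_score_sub_le hI a b, hξ.e_mem, hI.e_mem, hξ.pi_mem, hI.pi_mem]
      with o k1 k2 k3 k4 k5
    have hMi := inv_pos.2 hM
    refine k1.trans (mul_le_mul_of_nonneg_left (le_trans ?_ (le_abs_self _)) hL0)
    have u1 : |ξ.e o.1 - η.e o.1| ≤ 1 := abs_le.2 ⟨by linarith [k2.1, k3.2], by linarith [k2.2, k3.1]⟩
    have u2 : |ξ.pi o.1 - η.pi o.1| ≤ 1 :=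
      abs_le.2 ⟨by linarith [k4.1, k5.2], by linarith [k4.2, k5.1]⟩
    have hHo : |outcome o| + |η.mu1 o.1| + |η.mu0 o.1| + 1 = H o := rfl
    have hH0 : 0 ≤ H o := by positivity
    rw [hHo, one_mul, one_mul]
    gcongr
    have v1 := abs_nonneg (ξ.e o.1 - η.e o.1)
    have v2 := abs_nonneg (ξ.pi o.1 - η.pi o.1)
    by_cases hN : N ≤ |H o|
    · have hGo : G o = H o := Set.indicator_of_mem (s := {x | N ≤ |H x|}) hN H
      rw [hGo, abs_of_nonneg hH0]
      have w1 := mul_le_mul_of_nonneg_right (add_le_add u1 u2) hH0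
      have w2 := mul_nonneg hN0.le v1
      have w3 := mul_nonneg hN0.le v2
      linarith
    · have hGo : G o = 0 := Set.indicator_of_notMem (s := {x | N ≤ |H x|}) hN H
      rw [hGo, abs_zero]
      rw [abs_of_nonneg hH0, not_le] at hN
      have w1 := mul_le_mul_of_nonneg_left hN.le (add_nonneg v1 v2)
      linarith
  · have e1 : N * δ + N * δ + 2 * (κ / (4 * (L + 1))) + 1 * δ + 1 * δ = κ / (L + 1) := by
      rw [hδ]
      field_simp
      ring
    rw [e1, mul_div_assoc', div_le_iff₀ (by positivity)]
    linarith

end Estimates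

/-! ### Chebyshev bounds with independent training data -/

section Chebyshev

variable {Ω 𝒪 𝒯 : Type*} [MeasurableSpace Ω] [MeasurableSpace 𝒪] [MeasurableSpace 𝒯]
  {Q : Measure Ω} [IsProbabilityMeasure Q] {ρ : Measure 𝒪} {O : ℕ → Ω → 𝒪}

/-- Half of the threshold `2 r` absorbs the mean of the sum, and Chebyshev's inequality handles the
fluctuation beyond `r`. -/
lemma measure_le_abs_sum_le (hO : ∀ i, Measurable (O i)) (hindep : iIndepFun O Q)
    (hlaw : ∀ i, Q.map (O i) = ρ) (I : Finset ℕ) {f : 𝒪 → ℝ} (hf : Measurable f)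
    (hf2 : MemLp f 2 ρ) {κ r : ℝ} (hκ0 : 0 ≤ κ) (hκ : eLpNorm f 2 ρ ≤ ENNReal.ofReal κ)
    (hr : 0 < r) (hm : I.card * |∫ o, f o ∂ρ| ≤ r) :
    Q {ω | 2 * r ≤ |∑ i ∈ I, f (O i ω)|} ≤ ENNReal.ofReal (I.card * κ ^ 2 / r ^ 2) := by
  have hprob : IsProbabilityMeasure ρ := hlaw 0 ▸ Measure.isProbabilityMeasure_map (hO 0).aemeasurable
  have hL : ∀ i, MemLp (fun ω => f (O i ω)) 2 Q := fun i => by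
    have := hf2
    rw [← hlaw i] at this
    exact this.comp_of_map (hO i).aemeasurable
  have hint : ∀ i, ∫ ω, f (O i ω) ∂Q = ∫ o, f o ∂ρ := fun i => by
    rw [← hlaw i, integral_map (hO i).aemeasurable hf.aestronglyMeasurable]
  have hsum : MemLp (∑ i ∈ I, fun ω => f (O i ω)) 2 Q := memLp_finsetSum' _ fun i _ => hL i
  have hvar1 : ∀ i, Var[fun ω => f (O i ω); Q] ≤ κ ^ 2 := fun i => by
    have h1 : Var[fun ω => f (O i ω); Q] = Var[f; ρ] := by
      rw [← hlaw i, variance_map hf.aemeasurable (hO i).aemeasurable]; rfl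
    rw [h1]
    refine (variance_le_expectation_sq hf.aestronglyMeasurable).trans ?_
    have h2 := hf2.eLpNorm_eq_integral_rpow_norm two_ne_zero ENNReal.ofNat_ne_top
    rw [h2, ENNReal.ofReal_le_ofReal_iff hκ0] at hκ
    have h3 : 0 ≤ ∫ o, f o ^ 2 ∂ρ := integral_nonneg fun o => sq_nonneg _
    simp only [ENNReal.toReal_ofNat, Real.rpow_ofNat, Real.norm_eq_abs, sq_abs] at hκ
    rw [show (2 : ℝ)⁻¹ = 1 / 2 by norm_num, ← Real.sqrt_eq_rpow] at hκ
    exact (Real.sqrt_le_left hκ0).1 hκ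
  have hvar : Var[∑ i ∈ I, fun ω => f (O i ω); Q] ≤ I.card * κ ^ 2 := by
    rw [IndepFun.variance_sum (fun i _ => hL i) (fun i _ j _ hij =>
      (hindep.indepFun hij).comp hf hf)]
    calc _ ≤ ∑ _i ∈ I, κ ^ 2 := Finset.sum_le_sum fun i _ => hvar1 i
      _ = _ := by simp
  have hmean : ∫ ω, (∑ i ∈ I, fun ω => f (O i ω)) ω ∂Q = I.card * ∫ o, f o ∂ρ := by
    simp only [Finset.sum_apply]
    rw [integral_finsetSum _ fun i _ => (hL i).integrable one_le_two]
    simp [hint]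
  calc Q {ω | 2 * r ≤ |∑ i ∈ I, f (O i ω)|}
      ≤ Q {ω | r ≤ |(∑ i ∈ I, fun ω => f (O i ω)) ω
          - ∫ ω, (∑ i ∈ I, fun ω => f (O i ω)) ω ∂Q|} := by
        refine measure_mono fun ω hω => ?_
        rw [Set.mem_ofPred_eq, hmean]
        simp only [Set.mem_ofPred_eq, Finset.sum_apply] at hω ⊢
        have h1 : |(I.card : ℝ) * ∫ o, f o ∂ρ| ≤ r := by rwa [abs_mul, Nat.abs_cast]
        linarith [abs_sub_abs_le_abs_sub (∑ i ∈ I, f (O i ω)) (I.card * ∫ o, f o ∂ρ)]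
    _ ≤ ENNReal.ofReal (Var[∑ i ∈ I, fun ω => f (O i ω); Q] / r ^ 2) :=
        meas_ge_le_variance_div_sq hsum hr
    _ ≤ _ := ENNReal.ofReal_le_ofReal (div_le_div_of_nonneg_right hvar (sq_nonneg r))

/-- Chebyshev's inequality for a sum of functions that depend on independent training data. -/
lemma measure_trained_le_abs_sum_le (hO : ∀ i, Measurable (O i)) (hindep : iIndepFun O Q)
    (hlaw : ∀ i, Q.map (O i) = ρ) {I : Finset ℕ} {T : Ω → 𝒯} (hT : Measurable T)
    (hTI : IndepFun T (fun ω (i : I) => O i ω) Q) {g : 𝒯 × 𝒪 → ℝ} (hg : Measurable g)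
    {G : Set 𝒯} (hG : MeasurableSet G) {κ r : ℝ} (hκ0 : 0 ≤ κ) (hr : 0 < r)
    (hκ : ∀ t ∈ G, eLpNorm (fun o => g (t, o)) 2 ρ ≤ ENNReal.ofReal κ)
    (hm : ∀ t ∈ G, I.card * |∫ o, g (t, o) ∂ρ| ≤ r) :
    Q {ω | T ω ∈ G ∧ 2 * r ≤ |∑ i ∈ I, g (T ω, O i ω)|}
      ≤ ENNReal.ofReal (I.card * κ ^ 2 / r ^ 2) := by
  have hU : Measurable fun ω (i : I) => O i ω := measurable_pi_lambda _ fun i => hO i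
  let A : Set (𝒯 × (I → 𝒪)) := {p | p.1 ∈ G ∧ 2 * r ≤ |∑ i : I, g (p.1, p.2 i)|}
  have hA : MeasurableSet A := by
    have h1 : Measurable fun p : 𝒯 × (I → 𝒪) => ∑ i : I, g (p.1, p.2 i) :=
      Finset.measurable_sum _ fun i _ =>
        hg.comp (measurable_fst.prodMk ((measurable_pi_apply i).comp measurable_snd))
    have h2 : MeasurableSet {p : 𝒯 × (I → 𝒪) | 2 * r ≤ |∑ i : I, g (p.1, p.2 i)|} :=
      measurableSet_le measurable_const h1.abs
    exact (measurable_fst hG).inter h2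
  have hsum : ∀ t ω, ∑ i : I, g (t, O i ω) = ∑ i ∈ I, g (t, O i ω) := fun t ω =>
    Finset.sum_coe_sort I fun i => g (t, O i ω)
  have hpre : {ω | T ω ∈ G ∧ 2 * r ≤ |∑ i ∈ I, g (T ω, O i ω)|}
      = (fun ω => (T ω, fun i : I => O i ω)) ⁻¹' A := by
    ext ω
    simp only [A, Set.mem_ofPred_eq, Set.mem_preimage, hsum]
  have hpT : IsProbabilityMeasure (Q.map T) := Measure.isProbabilityMeasure_map hT.aemeasurable
  rw [hpre, ← Measure.map_apply (hT.prodMk hU) hA,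
    (indepFun_iff_map_prod_eq_prod_map_map hT.aemeasurable hU.aemeasurable).1 hTI,
    Measure.prod_apply hA]
  -- By independence the joint law is a product, so the training data can be frozen at `t`. For `t`
  -- in `G` the bound for a fixed function applies; otherwise the section is empty.
  calc _ ≤ ∫⁻ _, ENNReal.ofReal (I.card * κ ^ 2 / r ^ 2) ∂(Q.map T) := by
        refine lintegral_mono fun t => ?_
        rw [Measure.map_apply hU (measurable_prodMk_left hA)]
        by_cases ht : t ∈ G
        · have hf : Measurable fun o => g (t, o) := hg.comp measurable_prodMk_left
          refine le_trans (measure_mono fun ω hω => ?_) (measure_le_abs_sum_le hO hindep hlaw I hf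
            ⟨hf.aestronglyMeasurable, (hκ t ht).trans_lt ENNReal.ofReal_lt_top⟩ hκ0 (hκ t ht) hr
            (hm t ht))
          simp only [A, Set.mem_preimage, Set.mem_ofPred_eq, hsum] at hω ⊢
          exact hω.2
        · have : (fun ω (i : I) => O i ω) ⁻¹' (Prod.mk t ⁻¹' A) = ∅ := by
            ext ω
            simp [A, ht]
          rw [this]
          simp
    _ = _ := by simp

end Chebyshev

/-! ### Measurability of error norms, and bounds on inverse weights -/

section GoodSet

variable {𝒯 𝒳 : Type*} [MeasurableSpace 𝒯] [MeasurableSpace 𝒳]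

lemma measurable_l2err {ν : Measure 𝒳} [SFinite ν] {f : 𝒯 × 𝒳 → ℝ} (hf : Measurable f)
    {g : 𝒳 → ℝ} (hg : Measurable g) : Measurable fun t => l2err ν (fun x => f (t, x)) g := by
  simp only [l2err, eLpNorm_eq_lintegral_rpow_enorm_toReal two_ne_zero ENNReal.ofNat_ne_top]
  refine Measurable.pow_const ?_ _
  refine Measurable.lintegral_prod_right' (f := fun p : 𝒯 × 𝒳 => ‖f p - g p.2‖ₑ ^ _) ?_
  exact ((hf.sub (hg.comp measurable_snd)).enorm).pow_const _

lemma measurableSet_ae_mem {ν : Measure 𝒳} [SFinite ν] {A : Set (𝒯 × 𝒳)} (hA : MeasurableSet A) :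
    MeasurableSet {t | ∀ᵐ x ∂ν, (t, x) ∈ A} :=
  measurable_measure_prodMk_left hA.compl (measurableSet_singleton 0)

/-- Since `invSup` counts `1 / f` as infinite where `f ≤ 0`, a finite bound also forces `f` to be
positive almost everywhere. -/
lemma ae_inv_le_of_invSup_le {ν : Measure 𝒳} {f : 𝒳 → ℝ} {M : ℝ} (hM : 0 < M)
    (h : invSup ν f ≤ ENNReal.ofReal M) : ∀ᵐ x ∂ν, M⁻¹ ≤ f x := by
  filter_upwards [ENNReal.ae_le_essSup fun x => (ENNReal.ofReal (f x))⁻¹] with x hx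
  have h1 : (ENNReal.ofReal (f x))⁻¹ ≤ ENNReal.ofReal M := hx.trans h
  rw [ENNReal.inv_le_iff_inv_le, ← ENNReal.ofReal_inv_of_pos hM] at h1
  exact (ENNReal.ofReal_le_ofReal_iff' .. |>.1 h1).resolve_right (inv_pos.2 hM).not_ge

end GoodSet

/-! ### Negligibility of nuisance estimation in each fold -/

section FoldSums

variable {𝒳 : Type*} [MeasurableSpace 𝒳] {ρ : Measure (Obs 𝒳)} {c : Bool} {η : Nuisance 𝒳}
  {ε B : ℝ}

/-- The nuisance estimates `ξ n` satisfy the consistency, boundedness and rate conditions. -/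
structure ConsistentEstimates {Ω : Type*} [MeasurableSpace Ω] (Q : Measure Ω) (ν : Measure 𝒳)
    (η : Nuisance 𝒳) (ξ : ℕ → Ω → Nuisance 𝒳) : Prop where
  pi_mem : ∀ n ω x, 0 ≤ (ξ n ω).pi x ∧ (ξ n ω).pi x ≤ 1
  e : IsLittleOP Q (fun n ω => l2err ν (ξ n ω).e η.e) (fun _ => 1)
  pi : IsLittleOP Q (fun n ω => l2err ν (ξ n ω).pi η.pi) (fun _ => 1)
  mu1 : IsLittleOP Q (fun n ω => l2err ν (ξ n ω).mu1 η.mu1) (fun _ => 1)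
  mu0 : IsLittleOP Q (fun n ω => l2err ν (ξ n ω).mu0 η.mu0) (fun _ => 1)
  inv1 : IsBigOP Q (fun n ω => invSup ν (ξ n ω).e) (fun _ => 1)
  inv0 : IsBigOP Q (fun n ω => invSup ν (fun x => 1 - (ξ n ω).e x)) (fun _ => 1)
  e_pi : IsLittleOP Q (fun n ω => l2err ν (ξ n ω).e η.e * l2err ν (ξ n ω).pi η.pi)
    (fun n => (n : ℝ) ^ (-(1 / 2) : ℝ))
  e_mu1 : IsLittleOP Q (fun n ω => l2err ν (ξ n ω).e η.e * l2err ν (ξ n ω).mu1 η.mu1)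
    (fun n => (n : ℝ) ^ (-(1 / 2) : ℝ))
  e_mu0 : IsLittleOP Q (fun n ω => l2err ν (ξ n ω).e η.e * l2err ν (ξ n ω).mu0 η.mu0)
    (fun n => (n : ℝ) ^ (-(1 / 2) : ℝ))
  pi_mu0 : IsLittleOP Q (fun n ω => l2err ν (ξ n ω).pi η.pi * l2err ν (ξ n ω).mu0 η.mu0)
    (fun n => (n : ℝ) ^ (-(1 / 2) : ℝ))

/-- The nuisance functions `ξ` have inverse propensity scores bounded by `M`, estimation errors
bounded by `δ` and products of estimation errors bounded by `τ`. -/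
structure IsAccurate (ρ : Measure (Obs 𝒳)) (η : Nuisance 𝒳) (M δ τ : ℝ) (ξ : Nuisance 𝒳) :
    Prop where
  mem : ∀ᵐ o ∂ρ, (M⁻¹ ≤ ξ.e o.1 ∧ M⁻¹ ≤ 1 - ξ.e o.1) ∧ 0 ≤ ξ.pi o.1 ∧ ξ.pi o.1 ≤ 1
  e : l2err (ρ.map Prod.fst) ξ.e η.e ≤ ENNReal.ofReal δ
  pi : l2err (ρ.map Prod.fst) ξ.pi η.pi ≤ ENNReal.ofReal δ
  mu1 : l2err (ρ.map Prod.fst) ξ.mu1 η.mu1 ≤ ENNReal.ofReal δ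
  mu0 : l2err (ρ.map Prod.fst) ξ.mu0 η.mu0 ≤ ENNReal.ofReal δ
  e_pi : l2err (ρ.map Prod.fst) ξ.e η.e * l2err (ρ.map Prod.fst) ξ.pi η.pi ≤ ENNReal.ofReal τ
  e_mu1 : l2err (ρ.map Prod.fst) ξ.e η.e * l2err (ρ.map Prod.fst) ξ.mu1 η.mu1 ≤ ENNReal.ofReal τ
  e_mu0 : l2err (ρ.map Prod.fst) ξ.e η.e * l2err (ρ.map Prod.fst) ξ.mu0 η.mu0 ≤ ENNReal.ofReal τ
  pi_mu0 : l2err (ρ.map Prod.fst) ξ.pi η.pi * l2err (ρ.map Prod.fst) ξ.mu0 η.mu0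
    ≤ ENNReal.ofReal τ

/-- Conditioning on the training data by Fubini's theorem requires the set of good training samples
to be measurable. -/
lemma measurableSet_isAccurate [IsProbabilityMeasure ρ] {𝒯 : Type*} [MeasurableSpace 𝒯]
    (hI : Identified ρ c η ε) {ξ : 𝒯 → Nuisance 𝒳}
    (he : Measurable fun p : 𝒯 × 𝒳 => (ξ p.1).e p.2)
    (hpi : Measurable fun p : 𝒯 × 𝒳 => (ξ p.1).pi p.2)
    (hmu1 : Measurable fun p : 𝒯 × 𝒳 => (ξ p.1).mu1 p.2)
    (hmu0 : Measurable fun p : 𝒯 × 𝒳 => (ξ p.1).mu0 p.2) (M δ τ : ℝ) :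
    MeasurableSet {t | IsAccurate ρ η M δ τ (ξ t)} := by
  have hx : Measurable fun p : 𝒯 × Obs 𝒳 => (p.1, p.2.1) :=
    measurable_fst.prodMk measurable_snd.fst
  have he' := he.comp hx
  have hpi' := hpi.comp hx
  have hA : MeasurableSet {p : 𝒯 × Obs 𝒳 | (M⁻¹ ≤ (ξ p.1).e p.2.1 ∧ M⁻¹ ≤ 1 - (ξ p.1).e p.2.1) ∧
      0 ≤ (ξ p.1).pi p.2.1 ∧ (ξ p.1).pi p.2.1 ≤ 1} :=
    ((measurableSet_le measurable_const he').inter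
      (measurableSet_le measurable_const (he'.const_sub 1))).inter
      ((measurableSet_le measurable_const hpi').inter (measurableSet_le hpi' measurable_const))
  have m0 := measurableSet_ae_mem (ν := ρ) hA
  have m1 := measurable_l2err (ν := ρ.map Prod.fst) he hI.reg_e.1
  have m2 := measurable_l2err (ν := ρ.map Prod.fst) hpi hI.reg_pi.1
  have m3 := measurable_l2err (ν := ρ.map Prod.fst) hmu1 hI.mu1_meas
  have m4 := measurable_l2err (ν := ρ.map Prod.fst) hmu0 hI.reg_mu0.1
  have le : ∀ {F : 𝒯 → ℝ≥0∞} {r : ℝ}, Measurable F → MeasurableSet {t | F t ≤ ENNReal.ofReal r} :=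
    fun hF => measurableSet_le hF measurable_const
  have hall := m0.inter ((le (r := δ) m1).inter ((le (r := δ) m2).inter ((le (r := δ) m3).inter
    ((le (r := δ) m4).inter ((le (r := τ) (m1.mul m2)).inter ((le (r := τ) (m1.mul m3)).inter
    ((le (r := τ) (m1.mul m4)).inter (le (r := τ) (m2.mul m4)))))))))
  convert hall using 1
  ext t
  exact ⟨fun h => ⟨h.mem, h.e, h.pi, h.mu1, h.mu0, h.e_pi, h.e_mu1, h.e_mu0, h.pi_mu0⟩,
    fun ⟨h1, h2, h3, h4, h5, h6, h7, h8, h9⟩ => ⟨h1, h2, h3, h4, h5, h6, h7, h8, h9⟩⟩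

lemma IsAccurate.boundedEstimate {M δ τ : ℝ} (hI : Identified ρ c η ε) {ξ : Nuisance 𝒳}
    (hM : 0 < M) (h : IsAccurate ρ η M δ τ ξ) (he : Measurable ξ.e) (hpi : Measurable ξ.pi)
    (hmu1 : Measurable ξ.mu1) (hmu0 : Measurable ξ.mu0) : BoundedEstimate ρ η ξ M where
  M_pos := hM
  e_meas := he
  pi_meas := hpi
  mu1_meas := hmu1
  mu0_meas := hmu0
  e_mem := h.mem.mono fun _ h => h.1
  pi_mem := h.mem.mono fun _ h => h.2
  mu1_sq := by
    have h1 := h.mu1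
    rw [l2err_map_fst hmu1 hI.mu1_meas] at h1
    exact ⟨((hmu1.sub hI.mu1_meas).comp measurable_fst).aestronglyMeasurable,
      h1.trans_lt ENNReal.ofReal_lt_top⟩
  mu0_sq := by
    have h1 := h.mu0
    rw [l2err_map_fst hmu0 hI.reg_mu0.1] at h1
    exact ⟨((hmu0.sub hI.reg_mu0.1).comp measurable_fst).aestronglyMeasurable,
      h1.trans_lt ENNReal.ofReal_lt_top⟩

lemma BoundedEstimate.score_measurable {ξ : Nuisance 𝒳} {M : ℝ} (hξ : BoundedEstimate ρ η ξ M)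
    (a b : ℝ) : Measurable (score c a b ξ) := by
  have h : Measurable fun p : Unit × Obs 𝒳 => score c a b ξ p.2 :=
    measurable_score c a b (η := fun _ : Unit => ξ) (hξ.e_meas.comp measurable_snd)
      (hξ.pi_meas.comp measurable_snd) (hξ.mu1_meas.comp measurable_snd)
      (hξ.mu0_meas.comp measurable_snd)
  have h2 : Measurable fun o : Obs 𝒳 => ((), o) := measurable_prodMk_left
  have h3 := h.comp h2
  exact h3

lemma IsAccurate.abs_integral_score_sub_le [IsProbabilityMeasure ρ] {M δ τ : ℝ}
    (hI : Identified ρ c η ε) (hB : ∀ᵐ o ∂ρ, |η.mu1 o.1 - η.mu0 o.1| ≤ B) {ξ : Nuisance 𝒳}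
    (hτ : 0 ≤ τ) (h : IsAccurate ρ η M δ τ ξ) (hξ : BoundedEstimate ρ η ξ M) (a b : ℝ)
    (hL : eLpNorm (fun o => score c a b ξ o - score c a b η o) 2 ρ ≠ ∞) :
    |∫ o, (score c a b ξ o - score c a b η o) ∂ρ|
      ≤ (|a| * (2 * M + M * |B| + 1) + |b| * M) * (4 * τ) := by
  have hM := hξ.M_pos
  have hη := (hI.memLp_score a b).integrable one_le_two
  have hd : Integrable (fun o => score c a b ξ o - score c a b η o) ρ :=
    MemLp.integrable (q := 2) one_le_two
      ⟨((hξ.score_measurable a b).sub (hI.score_measurable a b)).aestronglyMeasurable,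
        hL.lt_top⟩
  have hs : Integrable (score c a b ξ) ρ :=
    (hd.add hη).congr (Eventually.of_forall fun o => by simp)
  rw [integral_sub hs hη]
  refine (ENNReal.ofReal_le_ofReal_iff (by positivity)).1
    ((hξ.enorm_integral_score_sub_le hI hB a b).trans ?_)
  rw [ENNReal.ofReal_mul (by positivity), show 4 * τ = τ + τ + τ + τ by ring,
    ENNReal.ofReal_add (by positivity) hτ, ENNReal.ofReal_add (by positivity) hτ,
    ENNReal.ofReal_add hτ hτ]
  gcongr
  exacts [h.e_pi, h.e_mu1, h.e_mu0, h.pi_mu0]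

variable {Ω : Type*} [MeasurableSpace Ω] {Q : Measure Ω}

/-- Consistent estimates are accurate with high probability. -/
lemma ConsistentEstimates.exists_isAccurate {ξ : ℕ → Ω → Nuisance 𝒳}
    (h : ConsistentEstimates Q (ρ.map Prod.fst) η ξ) {θ : ℝ} (hθ : 0 < θ) :
    ∃ M : ℝ, 0 < M ∧ ∀ δ : ℝ, 0 < δ → ∀ τ : ℝ, 0 < τ → ∀ᶠ n : ℕ in atTop,
      Q {ω | ¬ IsAccurate ρ η M δ (τ * (n : ℝ) ^ (-(1 / 2) : ℝ)) (ξ n ω)}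
        ≤ ENNReal.ofReal (10 * θ) := by
  obtain ⟨M1, hM1⟩ := h.inv1 θ hθ
  obtain ⟨M0, hM0⟩ := h.inv0 θ hθ
  have hM : 0 < max 1 (max M1 M0) := zero_lt_one.trans_le (le_max_left _ _)
  -- `M` is fixed before `δ` and `τ`, because the tolerances required later depend on it. Ten bad
  -- events, each of probability at most `θ`, account for the bound `10 θ`.
  refine ⟨max 1 (max M1 M0), hM, fun δ hδ τ hτ => ?_⟩
  have hθ' : 0 < ENNReal.ofReal θ := ENNReal.ofReal_pos.2 hθ
  have ev : ∀ {R : ℕ → Ω → ℝ≥0∞} {r : ℕ → ℝ} {s : ℝ}, IsLittleOP Q R r → 0 < s →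
      ∀ᶠ n in atTop, Q {ω | ENNReal.ofReal (s * r n) < R n ω} ≤ ENNReal.ofReal θ :=
    fun hR hs => ENNReal.tendsto_nhds_zero.1 (hR _ hs) _ hθ'
  filter_upwards [hM1, hM0, ev h.e hδ, ev h.pi hδ, ev h.mu1 hδ, ev h.mu0 hδ, ev h.e_pi hτ,
    ev h.e_mu1 hτ, ev h.e_mu0 hτ, ev h.pi_mu0 hτ] with n a1 a2 a3 a4 a5 a6 a7 a8 a9 a10
  simp only [mul_one] at a1 a2 a3 a4 a5 a6
  have sub := fun (ω : Ω) (h1 : invSup (ρ.map Prod.fst) (ξ n ω).e ≤ ENNReal.ofReal M1)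
    (h0 : invSup (ρ.map Prod.fst) (fun x => 1 - (ξ n ω).e x) ≤ ENNReal.ofReal M0) =>
    And.intro (ae_inv_le_of_invSup_le hM (h1.trans (ENNReal.ofReal_le_ofReal
        ((le_max_left _ _).trans (le_max_right _ _)))))
      (ae_inv_le_of_invSup_le hM (h0.trans (ENNReal.ofReal_le_ofReal
        ((le_max_right _ _).trans (le_max_right _ _)))))
  calc _ ≤ Q ({ω | ENNReal.ofReal M1 < invSup (ρ.map Prod.fst) (ξ n ω).e} ∪
        ({ω | ENNReal.ofReal M0 < invSup (ρ.map Prod.fst) (fun x => 1 - (ξ n ω).e x)} ∪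
        ({ω | ENNReal.ofReal δ < l2err (ρ.map Prod.fst) (ξ n ω).e η.e} ∪
        ({ω | ENNReal.ofReal δ < l2err (ρ.map Prod.fst) (ξ n ω).pi η.pi} ∪
        ({ω | ENNReal.ofReal δ < l2err (ρ.map Prod.fst) (ξ n ω).mu1 η.mu1} ∪
        ({ω | ENNReal.ofReal δ < l2err (ρ.map Prod.fst) (ξ n ω).mu0 η.mu0} ∪
        ({ω | ENNReal.ofReal (τ * (n : ℝ) ^ (-(1 / 2) : ℝ)) < l2err (ρ.map Prod.fst) (ξ n ω).e η.e
            * l2err (ρ.map Prod.fst) (ξ n ω).pi η.pi} ∪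
        ({ω | ENNReal.ofReal (τ * (n : ℝ) ^ (-(1 / 2) : ℝ)) < l2err (ρ.map Prod.fst) (ξ n ω).e η.e
            * l2err (ρ.map Prod.fst) (ξ n ω).mu1 η.mu1} ∪
        ({ω | ENNReal.ofReal (τ * (n : ℝ) ^ (-(1 / 2) : ℝ)) < l2err (ρ.map Prod.fst) (ξ n ω).e η.e
            * l2err (ρ.map Prod.fst) (ξ n ω).mu0 η.mu0} ∪
        {ω | ENNReal.ofReal (τ * (n : ℝ) ^ (-(1 / 2) : ℝ)) < l2err (ρ.map Prod.fst) (ξ n ω).pi η.pi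
            * l2err (ρ.map Prod.fst) (ξ n ω).mu0 η.mu0}))))))))) := by
        refine measure_mono fun ω hω => ?_
        by_contra hc
        simp only [Set.mem_union, Set.mem_ofPred_eq, not_or, not_lt] at hc
        obtain ⟨c1, c2, c3, c4, c5, c6, c7, c8, c9, c10⟩ := hc
        obtain ⟨b1, b0⟩ := sub ω c1 c2
        refine hω ⟨?_, c3, c4, c5, c6, c7, c8, c9, c10⟩
        filter_upwards [ae_of_ae_map measurable_fst.aemeasurable b1,
          ae_of_ae_map measurable_fst.aemeasurable b0] with o d1 d0
        exact ⟨⟨d1, d0⟩, h.pi_mem n ω o.1⟩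
    _ ≤ ENNReal.ofReal θ + (ENNReal.ofReal θ + (ENNReal.ofReal θ + (ENNReal.ofReal θ
        + (ENNReal.ofReal θ + (ENNReal.ofReal θ + (ENNReal.ofReal θ + (ENNReal.ofReal θ
        + (ENNReal.ofReal θ + ENNReal.ofReal θ)))))))) := by
        refine (measure_union_le _ _).trans (add_le_add a1 ?_)
        refine (measure_union_le _ _).trans (add_le_add a2 ?_)
        refine (measure_union_le _ _).trans (add_le_add a3 ?_)
        refine (measure_union_le _ _).trans (add_le_add a4 ?_)
        refine (measure_union_le _ _).trans (add_le_add a5 ?_)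
        refine (measure_union_le _ _).trans (add_le_add a6 ?_)
        refine (measure_union_le _ _).trans (add_le_add a7 ?_)
        refine (measure_union_le _ _).trans (add_le_add a8 ?_)
        exact (measure_union_le _ _).trans (add_le_add a9 a10)
    _ = _ := by
        rw [ENNReal.ofReal_mul (by norm_num), ENNReal.ofReal_ofNat]
        ring

variable [IsProbabilityMeasure Q] {O : ℕ → Ω → Obs 𝒳} {K : ℕ}

/-- A bound on the effect of estimating the nuisance functions in one fold. -/
lemma measure_fold_sum_le (hO : ∀ i, Measurable (O i)) (hindep : iIndepFun O Q)
    (hlaw : ∀ i, Q.map (O i) = ρ) [IsProbabilityMeasure ρ] (hI : Identified ρ c η ε)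
    (hB : ∀ᵐ o ∂ρ, |η.mu1 o.1 - η.mu0 o.1| ≤ B) (S : CrossFit 𝒳 K) (k : Fin K) (n : ℕ)
    (a b : ℝ) {M δ τ r s : ℝ} (hM : 0 < M) (hτ : 0 ≤ τ) (hr : 0 < r) (hs : 0 ≤ s)
    (hcont : ∀ ξ, BoundedEstimate ρ η ξ M → IsAccurate ρ η M δ τ ξ →
      eLpNorm (fun o => score c a b ξ o - score c a b η o) 2 ρ ≤ ENNReal.ofReal s)
    (hmean : n * ((|a| * (2 * M + M * |B| + 1) + |b| * M) * (4 * τ)) ≤ r) :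
    Q {ω | 2 * r ≤ |∑ i ∈ Finset.range n with S.fold n i = k,
      (score c a b (S.estimate n k fun i => O i ω) (O i ω) - score c a b η (O i ω))|}
      ≤ Q {ω | ¬ IsAccurate ρ η M δ τ (S.estimate n k fun i => O i ω)}
        + ENNReal.ofReal (n * s ^ 2 / r ^ 2) := by
  have hcard : (({i ∈ Finset.range n | S.fold n i = k}.card : ℕ) : ℝ) ≤ n := by
    exact_mod_cast (Finset.card_filter_le _ _).trans_eq (Finset.card_range n)
  have hGm : MeasurableSet {t | IsAccurate ρ η M δ τ (S.learner n k t)} :=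
    measurableSet_isAccurate hI (S.measurable_e n k) (S.measurable_pi n k) (S.measurable_mu1 n k)
      (S.measurable_mu0 n k) M δ τ
  have hbe : ∀ t, IsAccurate ρ η M δ τ (S.learner n k t) →
      BoundedEstimate ρ η (S.learner n k t) M := fun t ht =>
    IsAccurate.boundedEstimate hI hM ht
      ((S.measurable_e n k).comp measurable_prodMk_left)
      ((S.measurable_pi n k).comp measurable_prodMk_left)
      ((S.measurable_mu1 n k).comp measurable_prodMk_left)
      ((S.measurable_mu0 n k).comp measurable_prodMk_left)
  have hT : Measurable fun ω (j : S.train n k) => O j ω := measurable_pi_lambda _ fun j => hO j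
  have hdisj : Disjoint (S.train n k) {i ∈ Finset.range n | S.fold n i = k} := by
    rw [Finset.disjoint_right]
    intro i hi
    rw [Finset.mem_filter, Finset.mem_range] at hi
    exact S.disjoint n k i hi.1 hi.2
  have hTI := hindep.indepFun_finset _ _ hdisj hO
  have hg : Measurable fun p : (S.train n k → Obs 𝒳) × Obs 𝒳 =>
      score c a b (S.learner n k p.1) p.2 - score c a b η p.2 :=
    (measurable_score c a b (S.measurable_e n k) (S.measurable_pi n k)
      (S.measurable_mu1 n k) (S.measurable_mu0 n k)).sub
      ((hI.score_measurable a b).comp measurable_snd)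
  have hk : ∀ t ∈ {t | IsAccurate ρ η M δ τ (S.learner n k t)},
      eLpNorm (fun o => score c a b (S.learner n k t) o - score c a b η o) 2 ρ
        ≤ ENNReal.ofReal s := fun t ht => hcont _ (hbe t ht) ht
  have hm : ∀ t ∈ {t | IsAccurate ρ η M δ τ (S.learner n k t)},
      ({i ∈ Finset.range n | S.fold n i = k}.card : ℝ)
        * |∫ o, (score c a b (S.learner n k t) o - score c a b η o) ∂ρ| ≤ r := fun t ht => by
    rw [Set.mem_ofPred_eq] at ht
    have h1 := IsAccurate.abs_integral_score_sub_le hI hB hτ ht (hbe t ht) a b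
      ((hcont _ (hbe t ht) ht).trans_lt ENNReal.ofReal_lt_top).ne
    exact (mul_le_mul hcard h1 (abs_nonneg _) (Nat.cast_nonneg n)).trans hmean
  have hmain := measure_trained_le_abs_sum_le hO hindep hlaw hT hTI hg hGm hs hr hk hm
  refine le_trans (measure_mono fun ω hω => ?_) ((measure_union_le _ _).trans
    (add_le_add le_rfl (hmain.trans (ENNReal.ofReal_le_ofReal ?_))))
  -- Either the estimates are inaccurate, or the training data lie in the good set and the
  -- conditional Chebyshev bound applies.
  · by_cases hc : IsAccurate ρ η M δ τ (S.estimate n k fun i => O i ω)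
    · exact Or.inr ⟨hc, hω⟩
    · exact Or.inl hc
  · gcongr

/-- Replacing the nuisance functions by cross-fitted estimates is negligible in every fold. -/
lemma tendsto_measure_fold_sum (hO : ∀ i, Measurable (O i)) (hindep : iIndepFun O Q)
    (hlaw : ∀ i, Q.map (O i) = ρ) [IsProbabilityMeasure ρ] (hI : Identified ρ c η ε)
    (hB : ∀ᵐ o ∂ρ, |η.mu1 o.1 - η.mu0 o.1| ≤ B) (S : CrossFit 𝒳 K) (k : Fin K)
    (h : ConsistentEstimates Q (ρ.map Prod.fst) η fun n ω => S.estimate n k fun i => O i ω)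
    (a b : ℝ) {κ : ℝ} (hκ : 0 < κ) :
    Tendsto (fun n : ℕ => Q {ω | κ * √n ≤ |∑ i ∈ Finset.range n with S.fold n i = k,
      (score c a b (S.estimate n k fun i => O i ω) (O i ω) - score c a b η (O i ω))|})
      atTop (𝓝 0) := by
  rw [ENNReal.tendsto_nhds_zero]
  intro e he
  obtain ⟨θ, hθ, hθe⟩ : ∃ θ : ℝ, 0 < θ ∧ ENNReal.ofReal (10 * θ) + ENNReal.ofReal θ ≤ e := by
    rcases eq_or_ne e ∞ with rfl | hne
    · exact ⟨1, one_pos, le_top⟩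
    · have h1 := ENNReal.toReal_pos he.ne' hne
      refine ⟨e.toReal / 11, by positivity, ?_⟩
      rw [← ENNReal.ofReal_add (by positivity) (by positivity),
        show 10 * (e.toReal / 11) + e.toReal / 11 = e.toReal by ring, ENNReal.ofReal_toReal hne]
  obtain ⟨M, hM, hacc⟩ := h.exists_isAccurate hθ
  -- With `s = κ √θ / 2` and `r = κ √n / 2` the Chebyshev bound `n s² / r²` is exactly `θ`.
  have hκ1 : 0 < κ * √θ / 2 := by positivity
  obtain ⟨δ, hδ, hcont⟩ := hI.exists_eLpNorm_score_sub_le M a b hκ1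
  obtain ⟨L, hL⟩ : ∃ L, L = |a| * (2 * M + M * |B| + 1) + |b| * M := ⟨_, rfl⟩
  have hL0 : 0 ≤ L := by rw [hL]; positivity
  -- The tolerance `κ / (8 (L + 1)) · n^{-1/2}` for the products of errors keeps the accumulated
  -- bias `n · L · 4 τ` below `r = κ √n / 2`.
  filter_upwards [hacc δ hδ (κ / (8 * (L + 1))) (by positivity), eventually_gt_atTop 0] with n hn hn0
  have hn1 : (0 : ℝ) < n := Nat.cast_pos.2 hn0
  have hsq : 0 < √(n : ℝ) := Real.sqrt_pos.2 hn1
  have h2 : (n : ℝ) * (n : ℝ) ^ (-(1 / 2) : ℝ) = √n := by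
    rw [Real.sqrt_eq_rpow, ← Real.rpow_one_add' hn1.le (by norm_num)]
    norm_num
  have hmain := measure_fold_sum_le hO hindep hlaw hI hB S k n a b
    (τ := κ / (8 * (L + 1)) * (n : ℝ) ^ (-(1 / 2) : ℝ)) (r := κ * √n / 2) hM (by positivity)
    (by positivity) hκ1.le (fun ξ hξ hA => hcont ξ hξ hA.e hA.pi hA.mu1 hA.mu0) (by
      rw [← hL]
      calc _ = L / (L + 1) * (κ / 2) * (n * (n : ℝ) ^ (-(1 / 2) : ℝ)) := by
            field_simp; ring
        _ ≤ 1 * (κ / 2) * √n := by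
            rw [h2]
            gcongr
            exact (div_le_one (by positivity)).2 (by linarith)
        _ = _ := by ring)
  rw [mul_div_cancel₀ _ two_ne_zero] at hmain
  refine hmain.trans ((add_le_add hn (ENNReal.ofReal_le_ofReal (le_of_eq ?_))).trans hθe)
  rw [div_pow, div_pow, mul_pow, mul_pow, Real.sq_sqrt hθ.le, Real.sq_sqrt hn1.le]
  field_simp

end FoldSums

/-! ### Convergence in measure and in distribution -/

section Convergence

variable {Ω : Type*} [MeasurableSpace Ω] {Q : Measure Ω}

lemma tendstoInMeasure_comp_of_continuousAt {f : ℕ → Ω → ℝ} {r : ℝ} {g : ℝ → ℝ}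
    (hf : TendstoInMeasure Q f atTop fun _ => r) (hg : ContinuousAt g r) :
    TendstoInMeasure Q (fun n ω => g (f n ω)) atTop fun _ => g r := by
  rw [tendstoInMeasure_iff_norm] at hf ⊢
  intro ε hε
  obtain ⟨δ, hδ, h⟩ := Metric.continuousAt_iff.1 hg ε hε
  refine tendsto_of_tendsto_of_tendsto_of_le_of_le tendsto_const_nhds (hf δ hδ)
    (fun _ => zero_le) fun n => measure_mono fun ω hω => ?_
  simp only [Set.mem_ofPred_eq] at hω ⊢
  by_contra hc
  rw [not_le, ← dist_eq_norm] at hc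
  exact (h hc).not_ge (by rwa [dist_eq_norm])

lemma tendstoInMeasure_add {f g : ℕ → Ω → ℝ} {u v : Ω → ℝ} (hf : TendstoInMeasure Q f atTop u)
    (hg : TendstoInMeasure Q g atTop v) :
    TendstoInMeasure Q (fun n ω => f n ω + g n ω) atTop fun ω => u ω + v ω := by
  rw [tendstoInMeasure_iff_norm] at hf hg ⊢
  intro ε hε
  have h := (hf (ε / 2) (half_pos hε)).add (hg (ε / 2) (half_pos hε))
  rw [add_zero] at h
  refine tendsto_of_tendsto_of_tendsto_of_le_of_le tendsto_const_nhds h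
    (fun _ => zero_le) fun n => (measure_mono fun ω hω => ?_).trans (measure_union_le _ _)
  simp only [Set.mem_ofPred_eq, Set.mem_union, Real.norm_eq_abs] at hω ⊢
  by_contra hc
  simp only [not_or, not_le] at hc
  have h1 := abs_add_le (f n ω - u ω) (g n ω - v ω)
  rw [show f n ω + g n ω - (u ω + v ω) = f n ω - u ω + (g n ω - v ω) by ring] at hω
  linarith [hc.1, hc.2]

/-- The limit law is tight, so some tail `{|x| ≥ R + 1}` has mass below `δ`. The tail is closed, so
by the portmanteau theorem the laws of `√n f n` eventually satisfy the same bound. -/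
lemma isBigOP_of_tendstoInDistribution [IsProbabilityMeasure Q] {f : ℕ → Ω → ℝ} {N : Measure ℝ}
    [IsProbabilityMeasure N]
    (h : TendstoInDistribution (fun (n : ℕ) ω => √n * f n ω) atTop id (fun _ => Q) N) :
    IsBigOP Q (fun n ω => ENNReal.ofReal |f n ω|) fun n => (n : ℝ) ^ (-(1 / 2) : ℝ) := by
  intro δ hδ
  have hδ' : 0 < ENNReal.ofReal δ := ENNReal.ofReal_pos.2 hδ
  obtain ⟨K, hK, hKN⟩ := isTightMeasureSet_iff_exists_isCompact_measure_compl_le.1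
    (isTightMeasureSet_singleton (μ := N)) (ENNReal.ofReal (δ / 2))
    (ENNReal.ofReal_pos.2 (half_pos hδ))
  obtain ⟨R, hR⟩ := hK.isBounded.subset_closedBall 0
  have hF : IsClosed {x : ℝ | R + 1 ≤ |x|} := isClosed_le continuous_const continuous_abs
  have hNF : N {x : ℝ | R + 1 ≤ |x|} < ENNReal.ofReal δ := by
    refine lt_of_le_of_lt ((measure_mono fun x hx hxK => ?_).trans (hKN N rfl))
      ((ENNReal.ofReal_lt_ofReal_iff hδ).2 (half_lt_self hδ))
    have h1 := hR hxK
    rw [mem_closedBall_zero_iff, Real.norm_eq_abs] at h1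
    have h2 : R + 1 ≤ |x| := hx
    linarith
  have hlim := ProbabilityMeasure.limsup_measure_closed_le_of_tendsto h.tendsto hF
  simp only [ProbabilityMeasure.coe_mk, Measure.map_id] at hlim
  have hev := eventually_lt_of_limsup_lt (hlim.trans_lt hNF)
  refine ⟨R + 1, ?_⟩
  filter_upwards [hev, eventually_gt_atTop 0] with n hn hn0
  refine le_trans ?_ hn.le
  rw [Measure.map_apply_of_aemeasurable (h.forall_aemeasurable n) hF.measurableSet]
  refine measure_mono fun ω hω => ?_
  have hn1 : (0 : ℝ) < n := Nat.cast_pos.2 hn0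
  have h1 := (ENNReal.ofReal_lt_ofReal_iff'.1 hω).1
  have h2 : √(n : ℝ) * (n : ℝ) ^ (-(1 / 2) : ℝ) = 1 := by
    rw [Real.sqrt_eq_rpow, ← Real.rpow_add hn1]
    norm_num
  have h3 := mul_le_mul_of_nonneg_left h1.le (Real.sqrt_nonneg (n : ℝ))
  simp only [Set.mem_preimage, Set.mem_ofPred_eq, abs_mul, abs_of_nonneg (Real.sqrt_nonneg (n : ℝ))]
  calc R + 1 = (R + 1) * (√(n : ℝ) * (n : ℝ) ^ (-(1 / 2) : ℝ)) := by rw [h2, mul_one]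
    _ = √(n : ℝ) * ((R + 1) * (n : ℝ) ^ (-(1 / 2) : ℝ)) := by ring
    _ ≤ _ := h3

end Convergence

/-! ### Asymptotic linearity and normality of the cross-fitted estimator -/

section CrossFitting

variable {𝒳 : Type*} [MeasurableSpace 𝒳] {ρ : Measure (Obs 𝒳)} {c : Bool} {η : Nuisance 𝒳}
  {ε B : ℝ} {Ω : Type*} [MeasurableSpace Ω] {Q : Measure Ω} {O : ℕ → Ω → Obs 𝒳} {K : ℕ}

lemma CrossFit.measurable_score_learner (S : CrossFit 𝒳 K) (c : Bool) (a b : ℝ) (n : ℕ)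
    (k : Fin K) : Measurable fun p : (S.train n k → Obs 𝒳) × Obs 𝒳 =>
      score c a b (S.learner n k p.1) p.2 :=
  measurable_score c a b (η := S.learner n k) (S.measurable_e n _) (S.measurable_pi n _)
    (S.measurable_mu1 n _) (S.measurable_mu0 n _)

lemma CrossFit.measurable_score_estimate (hO : ∀ i, Measurable (O i)) (S : CrossFit 𝒳 K)
    (c : Bool) (a b : ℝ) (n i : ℕ) (k : Fin K) :
    Measurable fun ω => score c a b (S.estimate n k fun i => O i ω) (O i ω) := by
  have hT : Measurable fun ω (j : S.train n k) => O j ω := measurable_pi_lambda _ fun j => hO j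
  have h := (S.measurable_score_learner c a b n k).comp (hT.prodMk (hO i))
  exact h

lemma CrossFit.measurable_average (hO : ∀ i, Measurable (O i)) (S : CrossFit 𝒳 K) (c : Bool)
    (a b : ℝ) (n : ℕ) : Measurable fun ω => S.average (score c a b) n fun i => O i ω := by
  unfold CrossFit.average
  exact (Finset.measurable_sum _ fun i _ => S.measurable_score_estimate hO c a b n i _).div_const _

lemma CrossFit.deltaIF_eq (S : CrossFit 𝒳 K) (c : Bool) (n : ℕ) (o : ℕ → Obs 𝒳) :
    S.deltaIF c n o = S.average (score c 1 0) n o / S.average (score c 0 1) n o := by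
  simp only [deltaIF, average, score, one_mul, zero_mul, add_zero, zero_add,
    Finset.sum_sub_distrib, sub_div]

lemma CrossFit.average_score (S : CrossFit 𝒳 K) (c : Bool) (a b : ℝ) (n : ℕ) (o : ℕ → Obs 𝒳) :
    S.average (score c a b) n o
      = a * S.average (score c 1 0) n o + b * S.average (score c 0 1) n o := by
  simp only [average, score, one_mul, zero_mul, add_zero, zero_add, mul_div_assoc',
    Finset.mul_sum, Finset.sum_add_distrib, add_div]

variable [IsProbabilityMeasure Q]

/-- Asymptotic linearity: cross-fitted averages of the estimating functions are equivalent to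
averages of the estimating functions at the true nuisance functions. -/
lemma CrossFit.tendstoInMeasure_average (hO : ∀ i, Measurable (O i)) (hindep : iIndepFun O Q)
    (hlaw : ∀ i, Q.map (O i) = ρ) [IsProbabilityMeasure ρ] (hI : Identified ρ c η ε)
    (hB : ∀ᵐ o ∂ρ, |η.mu1 o.1 - η.mu0 o.1| ≤ B) (S : CrossFit 𝒳 K)
    (h : ∀ k, ConsistentEstimates Q (ρ.map Prod.fst) η fun n ω => S.estimate n k fun i => O i ω)
    (a b : ℝ) :
    TendstoInMeasure Q (fun (n : ℕ) ω => √n * (S.average (score c a b) n (fun i => O i ω)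
      - (∑ i ∈ Finset.range n, score c a b η (O i ω)) / n)) atTop fun _ => 0 := by
  rw [tendstoInMeasure_iff_norm]
  intro κ hκ
  have hK : (0 : ℝ) < K := Nat.cast_pos.2 (Fin.pos (S.fold 0 0))
  -- If the total reaches `κ √n`, then some fold reaches its share `κ √n / K`; there are finitely
  -- many folds.
  have hlim : Tendsto (fun n : ℕ => ∑ k : Fin K, Q {ω | κ / K * √n ≤
      |∑ i ∈ Finset.range n with S.fold n i = k,
        (score c a b (S.estimate n k fun i => O i ω) (O i ω) - score c a b η (O i ω))|})
      atTop (𝓝 0) := by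
    have := tendsto_finsetSum Finset.univ fun k _ =>
      tendsto_measure_fold_sum hO hindep hlaw hI hB S k (h k) a b (div_pos hκ hK)
    simpa using this
  refine tendsto_of_tendsto_of_tendsto_of_le_of_le' tendsto_const_nhds hlim
    (Eventually.of_forall fun _ => zero_le) ?_
  filter_upwards [eventually_gt_atTop 0] with n hn0
  have hn1 : (0 : ℝ) < n := Nat.cast_pos.2 hn0
  have hs : 0 < √(n : ℝ) := Real.sqrt_pos.2 hn1
  refine le_trans (measure_mono fun ω hω => ?_) (measure_biUnion_finset_le Finset.univ _)
  simp only [Set.mem_iUnion, Set.mem_ofPred_eq, Finset.mem_univ, exists_prop, true_and]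
  by_contra! hc
  have hω' : κ ≤ ‖√(n : ℝ) * (S.average (score c a b) n (fun i => O i ω)
      - (∑ i ∈ Finset.range n, score c a b η (O i ω)) / n) - 0‖ := hω
  have hfib : ∑ i ∈ Finset.range n, (score c a b (S.estimate n (S.fold n i) fun i => O i ω) (O i ω)
        - score c a b η (O i ω))
      = ∑ k : Fin K, ∑ i ∈ Finset.range n with S.fold n i = k,
        (score c a b (S.estimate n k fun i => O i ω) (O i ω) - score c a b η (O i ω)) := by
    rw [← Finset.sum_fiberwise (Finset.range n) (S.fold n)]
    refine Finset.sum_congr rfl fun k _ => Finset.sum_congr rfl fun i hi => ?_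
    rw [(Finset.mem_filter.1 hi).2]
  have e1 : √(n : ℝ) * (S.average (score c a b) n (fun i => O i ω)
      - (∑ i ∈ Finset.range n, score c a b η (O i ω)) / n)
      = (√(n : ℝ))⁻¹ * ∑ k : Fin K, ∑ i ∈ Finset.range n with S.fold n i = k,
        (score c a b (S.estimate n k fun i => O i ω) (O i ω) - score c a b η (O i ω)) := by
    rw [← hfib, CrossFit.average, ← sub_div, ← Finset.sum_sub_distrib, mul_div_assoc',
      mul_div_right_comm, Real.sqrt_div_self', one_div]
  rw [sub_zero, e1, norm_mul, norm_inv, Real.norm_of_nonneg hs.le, Real.norm_eq_abs,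
    inv_mul_eq_div, le_div_iff₀ hs] at hω'
  have h2 := (Finset.abs_sum_le_sum_abs _ _).trans_lt (Finset.sum_lt_sum_of_nonempty
    (Finset.univ_nonempty_iff.2 ⟨S.fold 0 0⟩) fun k _ => hc k)
  rw [Finset.sum_const, Finset.card_univ, Fintype.card_fin, nsmul_eq_mul, ← mul_assoc,
    mul_div_cancel₀ _ hK.ne'] at h2
  exact hω'.not_gt h2

/-- The law of large numbers holds for the average at the true nuisances, and the effect of
estimating them vanishes even after multiplication by `√n ≥ 1`. -/
lemma CrossFit.tendstoInMeasure_average_phiPi (hO : ∀ i, Measurable (O i)) (hindep : iIndepFun O Q)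
    (hlaw : ∀ i, Q.map (O i) = ρ) [IsProbabilityMeasure ρ] (hI : Identified ρ c η ε)
    (hB : ∀ᵐ o ∂ρ, |η.mu1 o.1 - η.mu0 o.1| ≤ B) (S : CrossFit 𝒳 K)
    (h : ∀ k, ConsistentEstimates Q (ρ.map Prod.fst) η fun n ω => S.estimate n k fun i => O i ω) :
    TendstoInMeasure Q (fun n ω => S.average (score c 0 1) n fun i => O i ω) atTop
      fun _ => ∫ o, η.pi o.1 ∂ρ := by
  have hm := hI.score_measurable 0 1
  have h2 := hI.memLp_score 0 1
  have hid : ∀ i, IdentDistrib (fun ω => score c 0 1 η (O i ω)) (fun ω => score c 0 1 η (O 0 ω)) Q Q :=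
    fun i => IdentDistrib.comp (u := score c 0 1 η)
      ⟨(hO i).aemeasurable, (hO 0).aemeasurable, (hlaw i).trans (hlaw 0).symm⟩ hm
  have hint : Integrable (fun ω => score c 0 1 η (O 0 ω)) Q := by
    have := h2.integrable one_le_two
    rw [← hlaw 0] at this
    exact this.comp_measurable (hO 0)
  have hmean : ∫ ω, score c 0 1 η (O 0 ω) ∂Q = ∫ o, η.pi o.1 ∂ρ := by
    rw [← hI.integral_score.1, ← hlaw 0, integral_map (hO 0).aemeasurable hm.aestronglyMeasurable]
  have hsl := strong_law_ae_real (fun i ω => score c 0 1 η (O i ω)) hint (fun i j hij => (hindep.indepFun hij).comp hm hm) hid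
  rw [hmean] at hsl
  have havg : TendstoInMeasure Q (fun (n : ℕ) ω => (∑ i ∈ Finset.range n, score c 0 1 η (O i ω)) / n)
      atTop fun _ => ∫ o, η.pi o.1 ∂ρ :=
    tendstoInMeasure_of_tendsto_ae (fun n => ((Finset.measurable_sum _ fun i _ =>
      hm.comp (hO i)).div_const _).aestronglyMeasurable) hsl
  have hdiff : TendstoInMeasure Q (fun (n : ℕ) ω => S.average (score c 0 1) n (fun i => O i ω)
      - (∑ i ∈ Finset.range n, score c 0 1 η (O i ω)) / n) atTop fun _ => 0 := by
    have h3 := S.tendstoInMeasure_average hO hindep hlaw hI hB h 0 1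
    rw [tendstoInMeasure_iff_norm] at h3 ⊢
    intro κ hκ
    refine tendsto_of_tendsto_of_tendsto_of_le_of_le' tendsto_const_nhds (h3 κ hκ)
      (Eventually.of_forall fun _ => zero_le) ?_
    filter_upwards [eventually_ge_atTop 1] with n hn
    refine measure_mono fun ω hω => ?_
    simp only [Set.mem_ofPred_eq, sub_zero, norm_mul] at hω ⊢
    have h4 : 1 ≤ ‖√(n : ℝ)‖ := by
      rw [Real.norm_of_nonneg (Real.sqrt_nonneg _), Real.one_le_sqrt]
      exact_mod_cast hn
    exact hω.trans (le_mul_of_one_le_left (norm_nonneg _) h4)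
  have := tendstoInMeasure_add hdiff havg
  simpa using this

/-- Asymptotic normality of the cross-fitted estimator. -/
lemma CrossFit.tendstoInDistribution_deltaIF (hO : ∀ i, Measurable (O i)) (hindep : iIndepFun O Q)
    (hlaw : ∀ i, Q.map (O i) = ρ) [IsProbabilityMeasure ρ] (hI : Identified ρ c η ε)
    (hB : ∀ᵐ o ∂ρ, |η.mu1 o.1 - η.mu0 o.1| ≤ B) (S : CrossFit 𝒳 K)
    (h : ∀ k, ConsistentEstimates Q (ρ.map Prod.fst) η fun n ω => S.estimate n k fun i => O i ω)
    (hpi : ∫ o, η.pi o.1 ∂ρ ≠ 0) {φ : Obs 𝒳 → ℝ}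
    (hφ : φ = phiDelta c η (∫ o, η.pi o.1 ∂ρ) (deltaPI c ρ)) :
    TendstoInDistribution (fun (n : ℕ) ω => √n * (S.deltaIF c n (fun i => O i ω) - deltaPI c ρ))
      atTop id (fun _ => Q) (gaussianReal 0 (Var[φ; ρ]).toNNReal) := by
  have hIF := hI.isInfluenceFunction hpi
  rw [← hφ] at hIF
  obtain ⟨hL2, hmean, -⟩ := hIF
  rw [phiDelta_eq_score] at hφ
  obtain ⟨p, hp⟩ : ∃ p, p = ∫ o, η.pi o.1 ∂ρ := ⟨_, rfl⟩
  obtain ⟨Δ, hΔ⟩ : ∃ Δ, Δ = deltaPI c ρ := ⟨_, rfl⟩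
  rw [← hp] at hpi hφ
  rw [← hΔ] at hφ ⊢
  have hm : Measurable φ := by rw [hφ]; exact hI.score_measurable _ _
  have hid : ∀ i, IdentDistrib (fun ω => φ (O i ω)) (fun ω => φ (O 0 ω)) Q Q := fun i =>
    IdentDistrib.comp (u := φ)
      ⟨(hO i).aemeasurable, (hO 0).aemeasurable, (hlaw i).trans (hlaw 0).symm⟩ hm
  have hL2' : MemLp (fun ω => φ (O 0 ω)) 2 Q := by
    have := hL2
    rw [← hlaw 0] at this
    exact this.comp_of_map (hO 0).aemeasurable
  have hmean' : ∫ ω, φ (O 0 ω) ∂Q = 0 := by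
    rw [← hmean, ← hlaw 0, integral_map (hO 0).aemeasurable hm.aestronglyMeasurable]
  have hvar : Var[fun ω => φ (O 0 ω); Q] = Var[φ; ρ] := by
    rw [← hlaw 0, variance_map hm.aemeasurable (hO 0).aemeasurable]; rfl
  have hclt := tendstoInDistribution_inv_sqrt_mul_sum_sub (P := Q)
    (P' := gaussianReal 0 (Var[φ; ρ]).toNNReal) (Y := id) (X := fun i ω => φ (O i ω))
    ⟨aemeasurable_id, by rw [hvar, Measure.map_id]⟩ hL2' (hindep.comp _ fun _ => hm) hid
  simp only [hmean', mul_zero, sub_zero] at hclt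
  -- The estimated scores are combined with the fixed coefficients of `φ`, so their scaled average
  -- inherits the limit of the average of `φ`.
  have hV := tendstoInDistribution_of_tendstoInMeasure_sub
    (fun (n : ℕ) ω => √n * S.average (score c p⁻¹ (-Δ * p⁻¹)) n fun i => O i ω) id hclt (by
      have h3 := S.tendstoInMeasure_average hO hindep hlaw hI hB h p⁻¹ (-Δ * p⁻¹)
      refine h3.congr_left fun n => Eventually.of_forall fun ω => ?_
      simp only [Pi.sub_apply, hφ]
      rw [mul_sub, mul_div_assoc', mul_div_right_comm, Real.sqrt_div_self', one_div])
    fun n => ((S.measurable_average hO c _ _ n).const_mul _).aemeasurable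
  have hD := S.tendstoInMeasure_average_phiPi hO hindep hlaw hI hB h
  rw [← hp] at hD
  -- The scaled error of the estimator is the average in `hV` times `p` over the estimated
  -- denominator. This ratio tends to 1, so Slutsky's lemma applies.
  have hU := tendstoInMeasure_comp_of_continuousAt (g := fun x => p / x) hD
    (continuousAt_const.div continuousAt_id hpi)
  have hVU := hV.continuous_comp_prodMk_of_tendstoInMeasure_const
    (g := fun x : ℝ × ℝ => x.1 * x.2) (by fun_prop) hU
    fun n => ((S.measurable_average hO c 0 1 n).const_div p).aemeasurable
  simp only [div_self hpi, mul_one] at hVU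
  refine tendstoInDistribution_of_tendstoInMeasure_sub _ id hVU ?_ fun n => ?_
  · rw [tendstoInMeasure_iff_norm] at hD ⊢
    intro κ hκ
    refine tendsto_of_tendsto_of_tendsto_of_le_of_le tendsto_const_nhds (hD |p| (abs_pos.2 hpi))
      (fun _ => zero_le) fun n => measure_mono fun ω hω => ?_
    simp only [Set.mem_ofPred_eq, Pi.sub_apply, Pi.zero_apply, sub_zero] at hω ⊢
    -- The factorization is exact unless the estimated denominator is 0, where division returns 0.
    -- In that event the denominator misses its limit `p` by `|p| > 0`, so its probability vanishes.
    by_cases hz : S.average (score c 0 1) n (fun i => O i ω) = 0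
    · rw [hz, zero_sub, norm_neg, Real.norm_eq_abs]
    · rw [S.deltaIF_eq, S.average_score c p⁻¹] at hω
      exfalso
      refine hω.not_gt (lt_of_eq_of_lt ?_ hκ)
      rw [norm_eq_zero]
      field_simp
      ring
  · refine (((Measurable.sub_const ?_ Δ)).const_mul _).aemeasurable
    simp only [S.deltaIF_eq]
    exact (S.measurable_average hO c 1 0 n).div (S.measurable_average hO c 0 1 n)

end CrossFitting

end PrincipalStrat

/-! ### Assembly -/

theorem mainTheorem9
    -- the population: full data of a generic individual
    {Ω 𝒳 : Type*} [MeasurableSpace Ω] [StandardBorelSpace Ω] [MeasurableSpace 𝒳]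
    (P : Measure Ω) [IsProbabilityMeasure P]
    (X : Ω → 𝒳) (Z C : Ω → Bool) (Y1 Y0 : Ω → ℝ)
    (hX : Measurable X) (hZ : Measurable Z) (hC : Measurable C)
    (hY1 : Measurable Y1) (hY0 : Measurable Y0)
    (hY1_sq : MemLp Y1 2 P) (hY0_sq : MemLp Y0 2 P)
    (c : Bool) (hc : P {ω | C ω = c} ≠ 0)
    -- treatment assignment ignorability
    (hign : CondIndepFun (MeasurableSpace.comap X inferInstance) hX.comap_le
      Z (fun ω => (C ω, Y1 ω, Y0 ω)) P)
    -- true nuisance functions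
    (η : PrincipalStrat.Nuisance 𝒳)
    (hη : PrincipalStrat.IsTrueNuisance P c X Z C Y1 Y0 η)
    -- positivity
    (hpos : ∃ ε : ℝ, 0 < ε ∧ ∀ᵐ ω ∂P, ε ≤ η.e (X ω) ∧ η.e (X ω) < 1 - ε)
    -- bounded contrast of the conditional outcome means
    (hbdd : ∃ B : ℝ, ∀ᵐ ω ∂P, |η.mu1 (X ω) - η.mu0 (X ω)| ≤ B)
    -- the sample: i.i.d. copies of the observed data
    {Ω' : Type*} [MeasurableSpace Ω'] (Q : Measure Ω') [IsProbabilityMeasure Q]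
    (O : ℕ → Ω' → PrincipalStrat.Obs 𝒳)
    (hO : ∀ i, Measurable (O i)) (hindep : iIndepFun O Q)
    (hlaw : ∀ i, Q.map (O i) = P.map (PrincipalStrat.observe X Z C Y1 Y0))
    -- cross-fitted nuisance estimators
    {K : ℕ} (S : PrincipalStrat.CrossFit 𝒳 K) (est : ℕ → Fin K → Ω' → PrincipalStrat.Nuisance 𝒳)
    (hest : ∀ n k ω, est n k ω = S.estimate n k (fun i => O i ω))
    (hpi_range : ∀ n k ω x, 0 ≤ (est n k ω).pi x ∧ (est n k ω).pi x ≤ 1)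
    -- mean squared error consistency
    (he : ∀ k, PrincipalStrat.IsLittleOP Q
      (fun n ω => PrincipalStrat.l2err (P.map X) (est n k ω).e η.e) (fun _ => 1))
    (hpi : ∀ k, PrincipalStrat.IsLittleOP Q
      (fun n ω => PrincipalStrat.l2err (P.map X) (est n k ω).pi η.pi) (fun _ => 1))
    (hmu1 : ∀ k, PrincipalStrat.IsLittleOP Q
      (fun n ω => PrincipalStrat.l2err (P.map X) (est n k ω).mu1 η.mu1) (fun _ => 1))
    (hmu0 : ∀ k, PrincipalStrat.IsLittleOP Q
      (fun n ω => PrincipalStrat.l2err (P.map X) (est n k ω).mu0 η.mu0) (fun _ => 1))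
    -- bounded inverse propensity estimates, for both arms
    (hinv1 : ∀ k, PrincipalStrat.IsBigOP Q
      (fun n ω => PrincipalStrat.invSup (P.map X) (est n k ω).e) (fun _ => 1))
    (hinv0 : ∀ k, PrincipalStrat.IsBigOP Q
      (fun n ω => PrincipalStrat.invSup (P.map X) (fun x => 1 - (est n k ω).e x)) (fun _ => 1))
    -- error rate conditions
    (hrate_e_pi : ∀ k, PrincipalStrat.IsLittleOP Q
      (fun n ω => PrincipalStrat.l2err (P.map X) (est n k ω).e η.e
        * PrincipalStrat.l2err (P.map X) (est n k ω).pi η.pi)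
      (fun n => (n : ℝ) ^ (-(1 / 2) : ℝ)))
    (hrate_e_mu1 : ∀ k, PrincipalStrat.IsLittleOP Q
      (fun n ω => PrincipalStrat.l2err (P.map X) (est n k ω).e η.e
        * PrincipalStrat.l2err (P.map X) (est n k ω).mu1 η.mu1)
      (fun n => (n : ℝ) ^ (-(1 / 2) : ℝ)))
    (hrate_e_mu0 : ∀ k, PrincipalStrat.IsLittleOP Q
      (fun n ω => PrincipalStrat.l2err (P.map X) (est n k ω).e η.e
        * PrincipalStrat.l2err (P.map X) (est n k ω).mu0 η.mu0)
      (fun n => (n : ℝ) ^ (-(1 / 2) : ℝ)))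
    (hrate_pi_mu0 : ∀ k, PrincipalStrat.IsLittleOP Q
      (fun n ω => PrincipalStrat.l2err (P.map X) (est n k ω).pi η.pi
        * PrincipalStrat.l2err (P.map X) (est n k ω).mu0 η.mu0)
      (fun n => (n : ℝ) ^ (-(1 / 2) : ℝ)))
    -- the law of the observed data, the identified effect and its influence function
    (PO : Measure (PrincipalStrat.Obs 𝒳))
    (hPO : PO = P.map (PrincipalStrat.observe X Z C Y1 Y0))
    (Δ : ℝ) (hΔ : Δ = PrincipalStrat.deltaPI c PO)
    (φ : PrincipalStrat.Obs 𝒳 → ℝ)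
    (hφ : φ = PrincipalStrat.phiDelta c η (∫ ω, η.pi (X ω) ∂P) Δ) :
    -- the estimated functional is the principal causal effect under principal ignorability
    (PrincipalStrat.PrincipalIgnorability P X C Y0 → Δ = PrincipalStrat.delta P c C Y1 Y0) ∧
    -- root-n consistency
    PrincipalStrat.IsBigOP Q
      (fun n ω => ENNReal.ofReal |S.deltaIF c n (fun i => O i ω) - Δ|)
      (fun n => (n : ℝ) ^ (-(1 / 2) : ℝ)) ∧
    -- asymptotic normality, the asymptotic variance being that of the influence function
    PrincipalStrat.IsInfluenceFunction (PrincipalStrat.deltaPI c) PO φ ∧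
    TendstoInDistribution
      (fun (n : ℕ) (ω : Ω') => Real.sqrt n * (S.deltaIF c n (fun i => O i ω) - Δ))
      atTop (id : ℝ → ℝ) (fun _ => Q) (gaussianReal 0 (Var[φ; PO]).toNNReal) := by
  obtain ⟨ε, hε, hpos⟩ := hpos
  obtain ⟨B, hbdd⟩ := hbdd
  have hpos' : ∀ᵐ ω ∂P, ε ≤ η.e (X ω) ∧ η.e (X ω) ≤ 1 - ε := hpos.mono fun ω h => ⟨h.1, h.2.le⟩
  have hobs := PrincipalStrat.measurable_observe hX hZ hC hY1 hY0
  have hmap : PO.map Prod.fst = P.map X := by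
    rw [hPO, Measure.map_map measurable_fst hobs]
    rfl
  have hprob : IsProbabilityMeasure PO := by
    rw [hPO]
    exact Measure.isProbabilityMeasure_map hobs.aemeasurable
  have hI : PrincipalStrat.Identified PO c η ε := by
    rw [hPO]
    exact PrincipalStrat.identified_of_trueNuisance hX hZ hC hY1 hY0 hY1_sq hY0_sq hign hη hε hpos'
      hbdd
  have hfst : ∀ {f : 𝒳 → ℝ}, Measurable f → ∫ o, f o.1 ∂PO = ∫ ω, f (X ω) ∂P := fun {f} hf => by
    have h : AEStronglyMeasurable f (P.map X) := hf.aestronglyMeasurable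
    rw [← integral_map hX.aemeasurable h, ← hmap, integral_map measurable_fst.aemeasurable]
    rwa [hmap]
  have hpibar : ∫ o, η.pi o.1 ∂PO = ∫ ω, η.pi (X ω) ∂P := hfst hη.pi_eq.1
  -- The mean of `π_c(X)` is `P(C = c)`, by the tower property.
  have hpi0 : ∫ o, η.pi o.1 ∂PO ≠ 0 := by
    have h1 : ∫ ω, η.pi (X ω) ∂P = ∫ ω, PrincipalStrat.ind (C ω == c) ∂P := by
      rw [integral_congr_ae hη.pi_eq.2, integral_condExp hX.comap_le]
    have h2 : (fun ω => PrincipalStrat.ind (C ω == c)) = {ω | C ω = c}.indicator 1 := by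
      ext ω
      by_cases h : C ω = c <;> simp [PrincipalStrat.ind, h]
    have hCm : MeasurableSet {ω | C ω = c} := hC (measurableSet_singleton c)
    rw [hpibar, h1, h2, integral_indicator_one hCm, Measure.real, ENNReal.toReal_ne_zero]
    exact ⟨hc, measure_ne_top _ _⟩
  have hB : ∀ᵐ o ∂PO, |η.mu1 o.1 - η.mu0 o.1| ≤ B := by
    rw [hPO]
    refine (ae_map_iff hobs.aemeasurable (measurableSet_le
      ((hI.mu1_meas.sub hI.reg_mu0.1).comp measurable_fst).abs measurable_const)).2 hbdd
  have hcons : ∀ k, PrincipalStrat.ConsistentEstimates Q (PO.map Prod.fst) η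
      fun n ω => S.estimate n k fun i => O i ω := fun k => by
    simp only [hmap, ← hest]
    exact ⟨fun n ω x => hpi_range n k ω x, he k, hpi k, hmu1 k, hmu0 k, hinv1 k, hinv0 k,
      hrate_e_pi k, hrate_e_mu1 k, hrate_e_mu0 k, hrate_pi_mu0 k⟩
  rw [← hpibar, hΔ] at hφ
  have hdist := S.tendstoInDistribution_deltaIF hO hindep (fun i => (hlaw i).trans hPO.symm) hI hB
    hcons hpi0 hφ
  rw [← hΔ] at hdist
  refine ⟨fun hPI => ?_, PrincipalStrat.isBigOP_of_tendstoInDistribution hdist, ?_, hdist⟩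
  · rw [PrincipalStrat.delta_eq_of_principalIgnorability hX hZ hC hY1 hY0 hY1_sq hY0_sq hign hη hε
      hpos' hPI, hΔ, hI.deltaPI_eq, hI.integral_score.1, hI.integral_score.2, hpibar]
    congr 1
    simp only [← mul_sub]
    exact hfst (hη.pi_eq.1.mul (hη.mu1_eq.1.sub hη.mu0_eq.1))
  · rw [hφ]
    exact hI.isInfluenceFunction hpi0
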